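/- A packing instance consists of a finite hypergraph $H=(V,\mathcal{F})$, a nonnegative rational weight $w_v$ for every vertex $v\in V$, and an integer capacity $c(h)\ge 1$ for every hyperedge $h\in\mathcal{F}$. A packing is a set $X\subseteq V$ with $|X\cap h|\le c(h)$ for all $h\in\mathcal{F}$; $\mathrm{Opt}$ is the maximum weight $w(X)=\sum_{v\in X}w_v$ of a packing, and $\nu=\min_{h\in\mathcal{F}}c(h)$ (with $1/\nu=0$ if there are no hyperedges). The LP relaxation is to maximize $\sum_v w_vx_v$ subject to $\sum_{v\in h}x_v\le c(h)$ for all $h\in\mathcal{F}$ and $0\le x_v\le 1$ for all $v\in V$; the energy of a solution $x$ is $\sum_v x_v$. For integers $k,t\ge 0$ let $f_k(t)$ be the maximum, over all $Y\subseteq V$ with $|Y|\le t$, of the number of distinct sets of size $k+1$ of the form $h\cap Y$, $h\in\mathcal{F}$. The size of an instance is $|V|+|\mathcal{F}|$ plus the total bit length of all capacities and weights (so it is polynomial in $|V|$ and the bit lengths of the numbers when $|\mathcal{F}|$ is polynomial in $|V|$). Theorem. There is a randomized algorithm that, for every packing instance, always halts after a number of steps that is polynomial in the size of the instance, and always outputs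 a packing $X$, such that the following holds. For every constant $c$ there is a constant $K>0$, depending only on $c$, such that for every non-decreasing function $\gamma:[1,\infty)\to[1,\infty)$ and every packing instance with the bounded growth property $f_k(t)\le 2^{ck}\,t\,\gamma(t)$ for all integers $k\ge 0$ and $t\ge 1$, $$\mathbb{E}[w(X)]\ \ge\ K\cdot\frac{\mathrm{Opt}}{\gamma(\mathcal{E})^{1/\nu}},$$ where $\mathcal{E}$ is the energy of an arbitrary optimal solution of the LP relaxation (if $\mathcal{E}<1$ then $\mathrm{Opt}=0$, and the right-hand side is read as $0$). -/

import Mathlib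

open Finset

namespace Packing

/-! ### Packing instances -/

/-- An instance of the hypergraph packing problem: `n` vertices, `m` hyperedges (an indexed family
of vertex sets), a positive integer capacity for every hyperedge and a nonnegative rational
weight for every vertex. -/
structure Instance where
  n : ℕ
  m : ℕ
  edge : Fin m → Finset (Fin n)
  cap : Fin m → ℕ
  weight : Fin n → ℚ≥0
  one_le_cap : ∀ j, 1 ≤ cap j

namespace Instance

variable (I : Instance)

/-- `X` is a packing: no hyperedge contains more vertices of `X` than its capacity. -/
def IsPacking (X : Finset (Fin I.n)) : Prop :=
  ∀ j, (X ∩ I.edge j).card ≤ I.cap j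

/-- The total weight of a set of vertices. -/
def totalWeight (X : Finset (Fin I.n)) : ℚ≥0 :=
  ∑ v ∈ X, I.weight v

open Classical in
/-- The maximum weight of a packing (the empty set is one, so this is a maximum over a nonempty
finite family of nonnegative numbers). -/
noncomputable def opt : ℚ≥0 :=
  (univ.filter fun X : Finset (Fin I.n) => I.IsPacking X).sup I.totalWeight

/-- The minimum capacity of a hyperedge. If there are no hyperedges its value is `0`. -/
noncomputable def minCapacity : ℕ :=
  ⨅ j, I.cap j

/-- Feasibility for the linear programming relaxation. -/
def IsFractionalPacking (x : Fin I.n → ℝ) : Prop :=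
  (∀ v, 0 ≤ x v ∧ x v ≤ 1) ∧ ∀ j, ∑ v ∈ I.edge j, x v ≤ (I.cap j : ℝ)

/-- The objective function of the linear programming relaxation. -/
noncomputable def fractionalWeight (x : Fin I.n → ℝ) : ℝ :=
  ∑ v, (I.weight v : ℝ) * x v

/-- `x` is an optimal solution of the linear programming relaxation. -/
def IsOptimalFractional (x : Fin I.n → ℝ) : Prop :=
  I.IsFractionalPacking x ∧
    ∀ y, I.IsFractionalPacking y → I.fractionalWeight y ≤ I.fractionalWeight x

/-- The energy of a fractional solution. -/
def energy (x : Fin I.n → ℝ) : ℝ :=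
  ∑ v, x v

/-- The hyperedges of the sub-hypergraph induced by `X`, each counted once. -/
def inducedEdges (X : Finset (Fin I.n)) : Finset (Finset (Fin I.n)) :=
  univ.image fun j => I.edge j ∩ X

/-- The largest number of hyperedges of size `k + 1` in a sub-hypergraph induced by at most `t`
vertices. -/
def growth (k t : ℕ) : ℕ :=
  (univ.filter fun X : Finset (Fin I.n) => X.card ≤ t).sup fun X =>
    ((I.inducedEdges X).filter fun h => h.card = k + 1).card

/-- Bounded growth with rate `γ`, where `c` is the constant hidden in `2 ^ O(k)`. -/
def BoundedGrowth (c : ℕ) (γ : ℝ → ℝ) : Prop :=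
  ∀ k t : ℕ, (I.growth k t : ℝ) ≤ 2 ^ (c * k) * (t : ℝ) * γ (t : ℝ)

/-- The size of an instance: the number of vertices plus the number of hyperedges plus the total
bit length of all capacities and weights. -/
def size : ℕ :=
  I.n + I.m + ∑ j, Nat.size (I.cap j) +
    ∑ v, (Nat.size (I.weight v).num + Nat.size (I.weight v).den)

end Instance

/-! ### The machine model

A random access machine with logarithmic cost, programmed with structured commands. The memory
holds natural numbers, in variables `0, 1, 2, …` and in arrays `0, 1, 2, …`; every operation costs
the total bit length of the numbers (contents and addresses) that it handles, plus one. -/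

/-- A memory state. -/
structure State where
  var : ℕ → ℕ
  arr : ℕ → ℕ → ℕ

/-- Arithmetic expressions (`sub` is truncated, `div` rounds down). -/
inductive Expr where
  | lit (a : ℕ)
  | var (x : ℕ)
  | get (a : ℕ) (i : Expr)
  | add (e f : Expr)
  | sub (e f : Expr)
  | mul (e f : Expr)
  | div (e f : Expr)

/-- The value of an expression. -/
def Expr.eval (σ : State) : Expr → ℕ
  | .lit a => a
  | .var x => σ.var x
  | .get a i => σ.arr a (i.eval σ)
  | .add e f => e.eval σ + f.eval σ
  | .sub e f => e.eval σ - f.eval σ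
  | .mul e f => e.eval σ * f.eval σ
  | .div e f => e.eval σ / f.eval σ

/-- The number of steps for the evaluation of an expression. -/
def Expr.cost (σ : State) : Expr → ℕ
  | .lit a => Nat.size a + 1
  | .var x => Nat.size (σ.var x) + 1
  | .get a i => i.cost σ + Nat.size (i.eval σ) + Nat.size (σ.arr a (i.eval σ)) + 1
  | .add e f => e.cost σ + f.cost σ + Nat.size (e.eval σ) + Nat.size (f.eval σ) + 1
  | .sub e f => e.cost σ + f.cost σ + Nat.size (e.eval σ) + Nat.size (f.eval σ) + 1
  | .mul e f => e.cost σ + f.cost σ + Nat.size (e.eval σ) + Nat.size (f.eval σ) + 1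
  | .div e f => e.cost σ + f.cost σ + Nat.size (e.eval σ) + Nat.size (f.eval σ) + 1

/-- Programs. The tests of `cond` and `loop` succeed when the value is not zero. -/
inductive Program where
  | skip
  | assign (x : ℕ) (e : Expr)
  | store (a : ℕ) (i e : Expr)
  | seq (p q : Program)
  | cond (e : Expr) (p q : Program)
  | loop (e : Expr) (p : Program)

/-- The state after writing the value `b` into variable `x`. -/
def State.setVar (σ : State) (x b : ℕ) : State :=
  { σ with var := Function.update σ.var x b }

/-- The state after writing the value `b` into cell `i` of array `a`. -/
def State.setArr (σ : State) (a i b : ℕ) : State :=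
  { σ with arr := Function.update σ.arr a (Function.update (σ.arr a) i b) }

/-- `Exec p σ τ t`: started in state `σ`, the program `p` halts in state `τ` after exactly `t`
steps. -/
inductive Exec : Program → State → State → ℕ → Prop
  | skip (σ : State) : Exec .skip σ σ 1
  | assign (σ : State) (x : ℕ) (e : Expr) :
      Exec (.assign x e) σ (σ.setVar x (e.eval σ)) (e.cost σ + 1)
  | store (σ : State) (a : ℕ) (i e : Expr) :
      Exec (.store a i e) σ (σ.setArr a (i.eval σ) (e.eval σ))
        (i.cost σ + e.cost σ + Nat.size (i.eval σ) + Nat.size (e.eval σ) + 1)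
  | seq {p q : Program} {σ τ ρ : State} {s t : ℕ} :
      Exec p σ τ s → Exec q τ ρ t → Exec (.seq p q) σ ρ (s + t + 1)
  | cond_true {e : Expr} {p q : Program} {σ τ : State} {t : ℕ} :
      e.eval σ ≠ 0 → Exec p σ τ t → Exec (.cond e p q) σ τ (e.cost σ + t + 1)
  | cond_false {e : Expr} {p q : Program} {σ τ : State} {t : ℕ} :
      e.eval σ = 0 → Exec q σ τ t → Exec (.cond e p q) σ τ (e.cost σ + t + 1)
  | loop_stop {e : Expr} {p : Program} {σ : State} :
      e.eval σ = 0 → Exec (.loop e p) σ σ (e.cost σ + 1)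
  | loop_step {e : Expr} {p : Program} {σ τ ρ : State} {s t : ℕ} :
      e.eval σ ≠ 0 → Exec p σ τ s → Exec (.loop e p) τ ρ t →
        Exec (.loop e p) σ ρ (e.cost σ + s + t + 1)

/-- The machine is deterministic: final state and number of steps are determined by the program
and the initial state. -/
theorem Exec.deterministic {p : Program} {σ τ : State} {t : ℕ} (h : Exec p σ τ t) :
    ∀ {τ' : State} {t' : ℕ}, Exec p σ τ' t' → τ' = τ ∧ t' = t := by
  induction h with
  | skip σ => intro τ' t' h'; cases h'; exact ⟨rfl, rfl⟩
  | assign σ x e => intro τ' t' h'; cases h'; exact ⟨rfl, rfl⟩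
  | store σ a i e => intro τ' t' h'; cases h'; exact ⟨rfl, rfl⟩
  | seq _ _ ih1 ih2 =>
    intro τ' t' h'
    cases h' with
    | seq h1 h2 =>
      obtain ⟨rfl, rfl⟩ := ih1 h1
      obtain ⟨rfl, rfl⟩ := ih2 h2
      exact ⟨rfl, rfl⟩
  | cond_true he _ ih =>
    intro τ' t' h'
    cases h' with
    | cond_true _ h1 => obtain ⟨rfl, rfl⟩ := ih h1; exact ⟨rfl, rfl⟩
    | cond_false h0 _ => exact absurd h0 he
  | cond_false he _ ih =>
    intro τ' t' h'
    cases h' with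
    | cond_true h0 _ => exact absurd he h0
    | cond_false _ h1 => obtain ⟨rfl, rfl⟩ := ih h1; exact ⟨rfl, rfl⟩
  | loop_stop he =>
    intro τ' t' h'
    cases h' with
    | loop_stop _ => exact ⟨rfl, rfl⟩
    | loop_step h0 _ _ => exact absurd he h0
  | loop_step he _ _ ih1 ih2 =>
    intro τ' t' h'
    cases h' with
    | loop_stop h0 => exact absurd h0 he
    | loop_step _ h1 h2 =>
      obtain ⟨rfl, rfl⟩ := ih1 h1
      obtain ⟨rfl, rfl⟩ := ih2 h2
      exact ⟨rfl, rfl⟩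

/-! ### Randomized algorithms for packing -/

/-- The initial state for the instance `I` and the coin tosses `r`: variables `0` and `1` hold the
numbers of vertices and of hyperedges, array `0` the incidence matrix (row after row, one row per
hyperedge), array `1` the capacities, arrays `2` and `3` the numerators and denominators of the
weights, array `4` the coin tosses, and everything else is `0`. -/
def initialState (I : Instance) {L : ℕ} (r : Fin L → Bool) : State where
  var x := if x = 0 then I.n else if x = 1 then I.m else 0
  arr a i :=
    if a = 0 then
      if ∃ (j : Fin I.m) (v : Fin I.n), v ∈ I.edge j ∧ i = j * I.n + v then 1 else 0
    else if a = 1 then if h : i < I.m then I.cap ⟨i, h⟩ else 0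
    else if a = 2 then if h : i < I.n then (I.weight ⟨i, h⟩).num else 0
    else if a = 3 then if h : i < I.n then (I.weight ⟨i, h⟩).den else 0
    else if a = 4 then if h : i < L then (r ⟨i, h⟩).toNat else 0
    else 0

/-- On the instance `I` with coin tosses `r`, the program `p` halts within `T` steps and outputs
the set `X`, given by the nonzero cells of array `5`. -/
def Outputs (p : Program) (I : Instance) {L : ℕ} (r : Fin L → Bool) (T : ℕ)
    (X : Finset (Fin I.n)) : Prop :=
  ∃ (τ : State) (t : ℕ), Exec p (initialState I r) τ t ∧ t ≤ T ∧ ∀ v, v ∈ X ↔ τ.arr 5 v ≠ 0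

/-- The expected weight of the random set `X r`, where `r` consists of `L` independent fair coin
tosses. -/
noncomputable def expectedWeight (I : Instance) {L : ℕ}
    (X : (Fin L → Bool) → Finset (Fin I.n)) : ℝ :=
  (∑ r, (I.totalWeight (X r) : ℝ)) / 2 ^ L

end Packing

/-! Let `y` be a nearly optimal LP solution and `g = γ(E)^{1/ν}`, where `E` is the energy. Sample
every vertex independently with probability `θ y_v`, where `θ` is within a factor 2 of `1 / (400 ·
2^c · g)`. From the sample `R` delete each vertex that, for some hyperedge `h` containing it, is not
among the first `c(h)` vertices of `R ∩ h` in decreasing order of weight. The rest is a packing.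
Every deleted vertex is the last element of some `S ⊆ R ∩ h` with `|S| = c(h) + 1`, an obstruction,
and different vertices have different obstructions (`sum_sub_altered_le`). Hence the expected loss
is at most the sum of `min w(S) · Pr[S ⊆ R]` over all obstructions. Writing the minimum as a sum
over weight thresholds reduces this to an unweighted estimate inside each set `U` of vertices above
a threshold.

The estimate is a counting argument (`sum_prod_obstruction_le`). Sample from `y / 8` on `U`. For an
obstruction `S ⊆ h` of size `k + 1`, the event that the sample meets `h` exactly in `S` and has at
most `E` elements has probability at least `∏_S y` up to a factor exponential in `k`. A fixed sample
`R` admits at most `2^{ck} |R| γ(E)` such `S`, by bounded growth. Taking expectations, the products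
`∏_S y` sum to at most `2 (24 · 2^c)^k γ(E) ∑_U y`. Scaling by `θ` gains a factor `θ^k`, and `γ(E) ≤
g^k` because `k = c(h) ≥ ν`; the sum over `k ≥ 1` is then a small geometric series
(`sum_prod_obstructions_le`). Samples with more than `E / 2` elements carry little weight and are
given up (`subsetExp_sum_card_le`).

The algorithm knows neither `c` nor `γ` nor `E`. It tries every integer energy bound up to `n` as an
extra LP constraint and every power of two as a scaling factor, and keeps the best candidate. For
every outcome of the coins the output is at least as good as each candidate, so one good pair of
parameters suffices. The LP is solved within a factor 6 by multiplicative weights in integer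
arithmetic (`mwRun_spec`). The heaviest single vertex serves as a first candidate; it settles the
cases `E < 4` and `400 · 2^c · g ≥ n`, since the LP value is at most `E` times the largest weight.

The program is verified with Hoare-style triples `Run`, which also carry the running time: if all
numbers have at most `B` bits and all loops at most `B` rounds, the time is a polynomial in `B`, and
`fitsIn_sizeBound` supplies a `B` polynomial in the size of the instance. -/

namespace Packing

/-! ### Random subsets with independent elements -/

section RandomSubset

variable {V : Type*} [Fintype V] [DecidableEq V]

/-- The expectation of `f R` when `R` contains every `v` independently with probability `p v`. -/
def subsetExp (p : V → ℝ) (f : Finset V → ℝ) : ℝ :=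
  ∑ R : Finset V, ((∏ v ∈ R, p v) * ∏ v ∈ univ \ R, (1 - p v)) * f R

/-- Independence in product form: expanding the product of sums, by the set of factors from which
the first summand is taken, produces exactly the weights of `subsetExp`. -/
theorem subsetExp_prod (p a b : V → ℝ) :
    subsetExp p (fun R => ∏ v, if v ∈ R then a v else b v) =
      ∏ v, (p v * a v + (1 - p v) * b v) := by
  rw [Finset.prod_add, powerset_univ, subsetExp]
  refine sum_congr rfl fun R _ => ?_
  have : (∏ v, if v ∈ R then a v else b v) = (∏ v ∈ R, a v) * ∏ v ∈ univ \ R, b v := by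
    rw [prod_ite]
    congr 1
    · refine prod_congr ?_ fun _ _ => rfl
      ext; simp
    · refine prod_congr ?_ fun _ _ => rfl
      ext; simp
  rw [this, prod_mul_distrib, prod_mul_distrib]
  ring

theorem subsetExp_sub (p : V → ℝ) (f g : Finset V → ℝ) :
    subsetExp p (fun R => f R - g R) = subsetExp p f - subsetExp p g := by
  simp only [subsetExp, mul_sub, sum_sub_distrib]

theorem subsetExp_sum {ι : Type*} (s : Finset ι) (p : V → ℝ) (f : ι → Finset V → ℝ) :
    subsetExp p (fun R => ∑ i ∈ s, f i R) = ∑ i ∈ s, subsetExp p (f i) := by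
  simp only [subsetExp, mul_sum]
  exact sum_comm

theorem subsetExp_const_mul (p : V → ℝ) (a : ℝ) (f : Finset V → ℝ) :
    subsetExp p (fun R => a * f R) = a * subsetExp p f := by
  simp only [subsetExp, mul_sum]
  exact sum_congr rfl fun _ _ => by ring

theorem subsetExp_mono {p : V → ℝ} (h0 : ∀ v, 0 ≤ p v) (h1 : ∀ v, p v ≤ 1)
    {f g : Finset V → ℝ} (h : ∀ R, f R ≤ g R) : subsetExp p f ≤ subsetExp p g :=
  sum_le_sum fun R _ => mul_le_mul_of_nonneg_left (h R) <|
    mul_nonneg (prod_nonneg fun v _ => h0 v) (prod_nonneg fun v _ => sub_nonneg.2 (h1 v))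

/-- The probability that `R` contains `S` and avoids `N`. -/
theorem subsetExp_subset_disjoint (p : V → ℝ) {S N : Finset V} (hd : Disjoint S N) :
    subsetExp p (fun R => if S ⊆ R ∧ Disjoint N R then 1 else 0) =
      (∏ v ∈ S, p v) * ∏ v ∈ N, (1 - p v) := by
  have key : (fun R : Finset V => if S ⊆ R ∧ Disjoint N R then (1 : ℝ) else 0) =
      fun R => ∏ v, if v ∈ R then (if v ∈ N then 0 else 1) else (if v ∈ S then 0 else 1) := by
    ext R
    split_ifs with h
    · refine (prod_eq_one fun v _ => ?_).symm
      by_cases hv : v ∈ R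
      · have hN : v ∉ N := fun hN => disjoint_left.1 h.2 hN hv
        simp [hv, hN]
      · have hS : v ∉ S := fun hS => hv (h.1 hS)
        simp [hv, hS]
    · rw [not_and_or] at h
      rcases h with h | h
      · obtain ⟨v, hS, hR⟩ := not_subset.1 h
        exact (prod_eq_zero (mem_univ v) (by simp [hS, hR])).symm
      · obtain ⟨v, hN, hR⟩ := not_disjoint_iff.1 h
        exact (prod_eq_zero (mem_univ v) (by simp [hN, hR])).symm
  rw [key, subsetExp_prod]
  have : ∀ v, (p v * (if v ∈ N then 0 else 1) + (1 - p v) * (if v ∈ S then 0 else 1)) =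
      (if v ∈ S then p v else 1) * (if v ∈ N then 1 - p v else 1) := by
    intro v
    by_cases hS : v ∈ S
    · simp [hS, disjoint_left.1 hd hS]
    · by_cases hN : v ∈ N <;> simp [hS, hN]
  rw [prod_congr rfl fun v _ => this v, prod_mul_distrib, prod_ite_mem, prod_ite_mem,
    univ_inter, univ_inter]

theorem subsetExp_subset (p : V → ℝ) (S : Finset V) :
    subsetExp p (fun R => if S ⊆ R then 1 else 0) = ∏ v ∈ S, p v := by
  simpa using subsetExp_subset_disjoint p (disjoint_empty_right S)

theorem subsetExp_mem (p : V → ℝ) (v : V) :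
    subsetExp p (fun R => if v ∈ R then 1 else 0) = p v := by
  simpa using subsetExp_subset p {v}

theorem subsetExp_sum_mem (p w : V → ℝ) :
    subsetExp p (fun R => ∑ v ∈ R, w v) = ∑ v, w v * p v := by
  have : (fun R : Finset V => ∑ v ∈ R, w v) =
      fun R => ∑ v, w v * (if v ∈ R then 1 else 0) := by
    ext R; simp
  rw [this, subsetExp_sum]
  simp only [subsetExp_const_mul, subsetExp_mem]

theorem subsetExp_card (p : V → ℝ) :
    subsetExp p (fun R => (R.card : ℝ)) = ∑ v, p v := by
  simpa using subsetExp_sum_mem p fun _ => 1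

/-- `Pr[R ∩ h = S, |R| ≤ t] ≥ Pr[R ∩ h = S] / 2` if `S` and the expectation of `R` are small. -/
theorem half_le_subsetExp_inter_eq_card_le {p : V → ℝ} (h0 : ∀ v, 0 ≤ p v) (h1 : ∀ v, p v ≤ 1)
    {S h : Finset V} (hS : S ⊆ h) {t : ℝ} (ht : 0 < t) (hSt : (S.card : ℝ) ≤ t / 2)
    (hp : ∑ v, p v ≤ t / 4) :
    ((∏ v ∈ S, p v) * ∏ v ∈ h \ S, (1 - p v)) / 2 ≤
      subsetExp p (fun R => if h ∩ R = S ∧ (R.card : ℝ) ≤ t then 1 else 0) := by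
  set a : ℝ := (∏ v ∈ S, p v) * ∏ v ∈ h \ S, (1 - p v) with ha
  have ha0 : 0 ≤ a := mul_nonneg (prod_nonneg fun v _ => h0 v)
    (prod_nonneg fun v _ => sub_nonneg.2 (h1 v))
  have hiff : ∀ R : Finset V, h ∩ R = S ↔ S ⊆ R ∧ Disjoint (h \ S) R := by
    intro R
    constructor
    · rintro rfl
      refine ⟨inter_subset_right, disjoint_left.2 fun v hv hR => ?_⟩
      simp only [mem_sdiff, mem_inter, not_and] at hv
      exact hv.2 hv.1 hR
    · rintro ⟨h2, h3⟩
      ext v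
      rw [mem_inter]
      refine ⟨fun hv => ?_, fun hv => ⟨hS hv, h2 hv⟩⟩
      by_contra hvS
      exact disjoint_left.1 h3 (mem_sdiff.2 ⟨hv.1, hvS⟩) hv.2
  have e1 : subsetExp p (fun R => if h ∩ R = S then 1 else 0) = a := by
    simp only [hiff]
    exact subsetExp_subset_disjoint p disjoint_sdiff
  -- Membership of a vertex outside `h` is independent of the trace of the sample on `h`.
  have e2 : ∀ u ∈ univ \ h, subsetExp p (fun R => if h ∩ R = S ∧ u ∈ R then 1 else 0) =
      p u * a := by
    intro u hu
    have huh : u ∉ h := (mem_sdiff.1 hu).2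
    have huS : u ∉ S := fun h' => huh (hS h')
    have hd : Disjoint (insert u S) (h \ S) := by
      rw [disjoint_insert_left]
      exact ⟨fun h' => huh (mem_sdiff.1 h').1, disjoint_sdiff⟩
    have h2 := subsetExp_subset_disjoint p hd
    rw [prod_insert huS, mul_assoc, ← ha] at h2
    rw [← h2]
    congr 1
    ext R
    congr 1
    rw [hiff, insert_subset_iff]
    exact propext (by tauto)
  -- Markov's inequality inside the event `h ∩ R = S`: if `|R| > t` while `|S| ≤ t / 2`, then more
  -- than `t / 2` elements of `R` lie outside `h`, and the subtracted term exceeds 1.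
  have key : ∀ R : Finset V, (if h ∩ R = S then (1 : ℝ) else 0) -
      (2 / t) * ∑ u ∈ univ \ h, (if h ∩ R = S ∧ u ∈ R then (1 : ℝ) else 0) ≤
      if h ∩ R = S ∧ (R.card : ℝ) ≤ t then 1 else 0 := by
    intro R
    by_cases hR : h ∩ R = S
    · simp only [hR, true_and, if_true]
      split_ifs with hc
      · have : 0 ≤ ∑ u ∈ univ \ h, (if u ∈ R then (1 : ℝ) else 0) :=
          sum_nonneg fun u _ => by split_ifs <;> norm_num
        have := mul_nonneg (div_nonneg zero_le_two ht.le) this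
        linarith
      · have hsum : ∑ u ∈ univ \ h, (if u ∈ R then (1 : ℝ) else 0) = ((R \ h).card : ℝ) := by
          rw [sum_boole]
          congr 2
          ext v
          simp [and_comm]
        have hcard : (R.card : ℝ) = (R \ h).card + S.card := by
          rw [← hR, inter_comm, ← Nat.cast_add, card_sdiff_add_card_inter]
        rw [hsum, sub_nonpos, div_mul_eq_mul_div, le_div_iff₀ ht]
        push Not at hc
        linarith
    · simp [hR]
  have := subsetExp_mono h0 h1 key
  rw [subsetExp_sub, subsetExp_const_mul, subsetExp_sum, e1, sum_congr rfl e2, ← sum_mul] at this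
  refine le_trans ?_ this
  have hle : ∑ u ∈ univ \ h, p u ≤ t / 4 :=
    (sum_le_sum_of_subset_of_nonneg (sdiff_subset) fun v _ _ => h0 v).trans hp
  have h3 : (2 / t) * ((∑ u ∈ univ \ h, p u) * a) ≤ (2 / t) * (t / 4 * a) := by gcongr
  have h4 : (2 / t) * (t / 4 * a) = a / 2 := by field_simp; norm_num
  linarith

/-- Few sets are large if the expected size is small, even weighted with `w`. -/
theorem subsetExp_sum_card_le {p w : V → ℝ} (h0 : ∀ v, 0 ≤ p v) (h1 : ∀ v, p v ≤ 1)
    (hw : ∀ v, 0 ≤ w v) {t a : ℝ} (ht : 4 ≤ t) (hp : ∑ v, p v ≤ a * t) :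
    subsetExp p (fun R => if t / 2 < (R.card : ℝ) then ∑ v ∈ R, w v else 0) ≤
      4 * a * ∑ v, w v * p v := by
  -- A second-moment bound: in a large `R` each `v` has `|R| - 1 ≥ t / 4` partners, because `t ≥ 4`.
  -- So the weight of `v` is paid for by the pairs `{u, v} ⊆ R`, whose probabilities factor.
  have key : ∀ R : Finset V, (if t / 2 < (R.card : ℝ) then ∑ v ∈ R, w v else 0) ≤
      ∑ v, ∑ u ∈ univ.erase v, (4 / t * w v) * (if {u, v} ⊆ R then (1 : ℝ) else 0) := by
    intro R
    split_ifs with hR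
    · rw [← sum_filter_add_sum_filter_not univ (· ∈ R)]
      have h2 : 0 ≤ ∑ v with v ∉ R, ∑ u ∈ univ.erase v, (4 / t * w v) *
          (if {u, v} ⊆ R then (1 : ℝ) else 0) :=
        sum_nonneg fun v _ => sum_nonneg fun u _ => mul_nonneg (mul_nonneg (by positivity) (hw v))
          (by split_ifs <;> norm_num)
      refine le_trans ?_ (le_add_of_nonneg_right h2)
      have : univ.filter (· ∈ R) = R := by ext; simp
      rw [this]
      refine sum_le_sum fun v hv => ?_
      have h3 : ∑ u ∈ univ.erase v, (if {u, v} ⊆ R then (1 : ℝ) else 0) = R.card - 1 := by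
        rw [sum_boole]
        have : (univ.erase v).filter (fun u => {u, v} ⊆ R) = R.erase v := by
          ext u
          simp [insert_subset_iff, hv]
        rw [this, card_erase_of_mem hv, Nat.cast_sub (card_pos.2 ⟨v, hv⟩)]
        simp
      rw [← mul_sum, h3]
      have h4 : 1 ≤ 4 / t * ((R.card : ℝ) - 1) := by
        rw [div_mul_eq_mul_div, le_div_iff₀ (by linarith)]
        linarith
      nlinarith [hw v]
    · exact sum_nonneg fun v _ => sum_nonneg fun u _ => mul_nonneg (mul_nonneg
        (div_nonneg (by norm_num) (by linarith)) (hw v)) (by split_ifs <;> norm_num)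
  refine (subsetExp_mono h0 h1 key).trans ?_
  rw [subsetExp_sum, mul_sum]
  refine sum_le_sum fun v _ => ?_
  rw [subsetExp_sum]
  have : ∀ u ∈ univ.erase v, subsetExp p (fun R => (4 / t * w v) *
      (if {u, v} ⊆ R then (1 : ℝ) else 0)) = (4 / t * w v * p v) * p u := by
    intro u hu
    rw [subsetExp_const_mul, subsetExp_subset, prod_pair (ne_of_mem_erase hu)]
    ring
  rw [sum_congr rfl this, ← mul_sum]
  have h5 : ∑ u ∈ univ.erase v, p u ≤ a * t :=
    (sum_le_sum_of_subset_of_nonneg (erase_subset _ _) fun v _ _ => h0 v).trans hp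
  have h6 : 0 ≤ 4 / t * w v * p v := by
    have := hw v; have := h0 v; positivity
  calc 4 / t * w v * p v * ∑ u ∈ univ.erase v, p u ≤ 4 / t * w v * p v * (a * t) := by gcongr
    _ = 4 * a * (w v * p v) := by field_simp

end RandomSubset

end Packing

/-! ### Alteration of a sample, and the scarcity of obstructions -/

namespace Packing
namespace Instance

variable (I : Instance)

/-- A linear order of the vertices that refines the order by weight. -/
def rankKey (W : Fin I.n → ℕ) (v : Fin I.n) : ℕ := W v * I.n + v

/-- The vertices of `R` that are, for each of their hyperedges `h`, among the first `c(h)` vertices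
of `R ∩ h` in decreasing order. -/
def altered (W : Fin I.n → ℕ) (R : Finset (Fin I.n)) : Finset (Fin I.n) :=
  R.filter fun v => ∀ j, v ∈ I.edge j →
    ((R ∩ I.edge j).filter fun u => I.rankKey W v ≤ I.rankKey W u).card ≤ I.cap j

variable {I}

theorem rankKey_injective (W : Fin I.n → ℕ) : Function.Injective (I.rankKey W) := by
  intro u v h
  have h1 : (W u * I.n + u) % I.n = (W v * I.n + v) % I.n := congrArg (· % I.n) h
  simpa [Nat.add_mod, Nat.mod_eq_of_lt, Fin.ext_iff] using h1

theorem weight_le_of_rankKey_le {W : Fin I.n → ℕ} {u v : Fin I.n}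
    (h : I.rankKey W u ≤ I.rankKey W v) : W u ≤ W v := by
  by_contra! hlt
  have h1 : (W v + 1) * I.n ≤ W u * I.n := Nat.mul_le_mul_right _ hlt
  have := v.2
  unfold rankKey at h
  rw [add_mul] at h1
  omega

theorem altered_subset (W : Fin I.n → ℕ) (R : Finset (Fin I.n)) : I.altered W R ⊆ R :=
  filter_subset _ _

/-- The vertex of smallest key among those kept in a hyperedge has all the others counted in its own
test, and it passed that test. -/
theorem isPacking_altered (W : Fin I.n → ℕ) (R : Finset (Fin I.n)) :
    I.IsPacking (I.altered W R) := by
  intro j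
  rcases (I.altered W R ∩ I.edge j).eq_empty_or_nonempty with h | h
  · simp [h]
  · obtain ⟨v, hv, hmin⟩ := exists_min_image _ (I.rankKey W) h
    rw [mem_inter] at hv
    refine le_trans (card_le_card fun u hu => ?_) ((mem_filter.1 hv.1).2 j hv.2)
    have hu' := mem_inter.1 hu
    exact mem_filter.2 ⟨mem_inter.2 ⟨altered_subset _ _ hu'.1, hu'.2⟩, hmin u hu⟩

variable (I) in
open Classical in
/-- The minimal non-packings with at most `t` elements. -/
noncomputable def obstructions (t : ℝ) : Finset (Finset (Fin I.n)) :=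
  univ.filter fun S => (∃ j, S.card = I.cap j + 1 ∧ S ⊆ I.edge j) ∧ (S.card : ℝ) ≤ t

theorem mem_obstructions {t : ℝ} {S : Finset (Fin I.n)} :
    S ∈ I.obstructions t ↔ (∃ j, S.card = I.cap j + 1 ∧ S ⊆ I.edge j) ∧ (S.card : ℝ) ≤ t := by
  simp [obstructions]

variable (I) in
/-- The minimum weight of an element of `S`, written as a sum over all thresholds below `N`. -/
noncomputable def minWeight (W : Fin I.n → ℕ) (N : ℕ) (S : Finset (Fin I.n)) : ℝ :=
  ∑ τ ∈ range N, if S ⊆ univ.filter (fun v => τ < W v) then 1 else 0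

theorem minWeight_nonneg (W : Fin I.n → ℕ) (N : ℕ) (S : Finset (Fin I.n)) :
    0 ≤ I.minWeight W N S :=
  sum_nonneg fun _ _ => by split_ifs <;> norm_num

theorem sum_threshold {a N : ℕ} (h : a ≤ N) :
    ∑ τ ∈ range N, (if τ < a then (1 : ℝ) else 0) = a := by
  rw [sum_boole]
  congr 1
  have : (range N).filter (· < a) = range a := by
    ext τ
    simp only [mem_filter, mem_range]
    omega
  rw [this, card_range]

theorem le_minWeight {W : Fin I.n → ℕ} {N : ℕ} {v : Fin I.n} (hN : W v ≤ N)
    {S : Finset (Fin I.n)} (hS : ∀ u ∈ S, W v ≤ W u) : (W v : ℝ) ≤ I.minWeight W N S := by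
  rw [← sum_threshold hN]
  refine sum_le_sum fun τ _ => ?_
  split_ifs with h1 h2
  · exact le_rfl
  · exact absurd (fun (u : Fin I.n) hu => mem_filter.2 ⟨mem_univ u, h1.trans_le (hS u hu)⟩) h2
  · exact zero_le_one
  · exact le_rfl

/-- A dropped vertex fails the test of some hyperedge, so together with `c(h)` vertices of larger
key it forms an obstruction inside `R` whose weights are all at least its own. Charging the vertex
to this set is injective. The bound on `|R|` ensures that only obstructions of size at most `t` are
needed. -/
theorem sum_sub_altered_le {W : Fin I.n → ℕ} {N : ℕ} (hN : ∀ v, W v ≤ N)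
    {R : Finset (Fin I.n)} {t : ℝ} (hR : (R.card : ℝ) ≤ t) :
    ∑ v ∈ R, (W v : ℝ) - ∑ v ∈ I.altered W R, (W v : ℝ) ≤
      ∑ S ∈ I.obstructions t, I.minWeight W N S * (if S ⊆ R then 1 else 0) := by
  have h1 : ∀ v : Fin I.n, v ∈ R \ I.altered W R → ∃ S ∈ I.obstructions t,
      S ⊆ R ∧ v ∈ S ∧ ∀ u ∈ S, I.rankKey W v ≤ I.rankKey W u := by
    intro v hv
    rw [mem_sdiff] at hv
    have h2 : ¬ ∀ j, v ∈ I.edge j →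
        ((R ∩ I.edge j).filter fun u => I.rankKey W v ≤ I.rankKey W u).card ≤ I.cap j :=
      fun h => hv.2 (mem_filter.2 ⟨hv.1, h⟩)
    push Not at h2
    obtain ⟨j, hvj, hc⟩ := h2
    obtain ⟨S, hvS, hS, hcard⟩ := exists_subsuperset_card_eq (n := I.cap j + 1)
      (s := {v}) (t := (R ∩ I.edge j).filter fun u => I.rankKey W v ≤ I.rankKey W u)
      (singleton_subset_iff.2 (mem_filter.2 ⟨mem_inter.2 ⟨hv.1, hvj⟩, le_rfl⟩))
      (by simp) hc
    have hSR : S ⊆ R := fun u hu => (mem_inter.1 (mem_filter.1 (hS hu)).1).1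
    refine ⟨S, mem_obstructions.2 ⟨⟨j, hcard,
      fun u hu => (mem_inter.1 (mem_filter.1 (hS hu)).1).2⟩, ?_⟩, hSR,
      singleton_subset_iff.1 hvS, fun u hu => (mem_filter.1 (hS hu)).2⟩
    exact le_trans (by exact_mod_cast card_le_card hSR) hR
  choose! f hf hfR hvf hmin using h1
  rw [← sum_sdiff (altered_subset W R), add_sub_cancel_right]
  -- The vertex is recovered from its obstruction as the unique element of smallest key.
  have hinj : Set.InjOn f ↑(R \ I.altered W R) := by
    intro u hu v hv huv
    refine rankKey_injective W (le_antisymm ?_ ?_)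
    · exact hmin u hu v (huv ▸ hvf v hv)
    · exact hmin v hv u (huv ▸ hvf u hu)
  calc ∑ v ∈ R \ I.altered W R, (W v : ℝ)
      ≤ ∑ v ∈ R \ I.altered W R, I.minWeight W N (f v) * (if f v ⊆ R then 1 else 0) := by
        refine sum_le_sum fun v hv => ?_
        rw [if_pos (hfR v hv), mul_one]
        exact le_minWeight (hN v) fun u hu => weight_le_of_rankKey_le (hmin v hv u hu)
    _ = ∑ S ∈ (R \ I.altered W R).image f,
          I.minWeight W N S * (if S ⊆ R then 1 else 0) :=
        (sum_image (f := fun S => I.minWeight W N S * (if S ⊆ R then 1 else 0)) hinj).symm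
    _ ≤ _ := by
        refine sum_le_sum_of_subset_of_nonneg ?_ fun S _ _ => mul_nonneg (minWeight_nonneg _ _ _)
          (by split_ifs <;> norm_num)
        intro S hS
        obtain ⟨v, hv, rfl⟩ := mem_image.1 hS
        exact hf v hv

/-- For `p ≤ 1 / 8` one has `1 - p ≥ e^{-2p}`, so the product is at least the exponential of minus
twice the sum, hence at least `e^{-k} ≥ 3^{-k}`. -/
theorem pow_three_inv_le_prod {V : Type*} (s : Finset V) {p : V → ℝ} {k : ℕ}
    (h0 : ∀ v, 0 ≤ p v) (h1 : ∀ v, p v ≤ 1 / 8) (hs : ∑ v ∈ s, p v ≤ k / 8) :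
    ((1 : ℝ) / 3) ^ k ≤ ∏ v ∈ s, (1 - p v) := by
  have h2 : ∀ v ∈ s, Real.exp (-(2 * p v)) ≤ 1 - p v := by
    intro v _
    have := h0 v
    have := h1 v
    rw [Real.exp_neg, inv_le_iff_one_le_mul₀ (Real.exp_pos _)]
    have h3 := Real.add_one_le_exp (2 * p v)
    nlinarith
  refine le_trans ?_ (prod_le_prod (fun v _ => (Real.exp_pos _).le) h2)
  rw [← Real.exp_sum, sum_neg_distrib, ← mul_sum]
  have h3 : Real.exp (-(k : ℝ)) ≤ Real.exp (-(2 * ∑ v ∈ s, p v)) := by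
    apply Real.exp_le_exp.2
    have : (0 : ℝ) ≤ k := k.cast_nonneg
    linarith
  refine le_trans ?_ h3
  rw [Real.exp_neg, ← Real.exp_one_pow, ← inv_pow, one_div]
  gcongr
  exact (Real.exp_one_lt_d9.trans (by norm_num)).le

/-- In a set that is sampled from a fractional packing, the obstructions of a given size are
scarce. -/
theorem sum_prod_obstruction_le {c : ℕ} {γ : ℝ → ℝ} (hγ : MonotoneOn γ (Set.Ici 1))
    (hγ1 : ∀ t, 1 ≤ t → 1 ≤ γ t) (hg : I.BoundedGrowth c γ) {y : Fin I.n → ℝ}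
    (hy0 : ∀ v, 0 ≤ y v) (hy1 : ∀ v, y v ≤ 1)
    (hy : ∀ j, ∑ v ∈ I.edge j, y v ≤ (I.cap j : ℝ)) {E : ℝ} (hE : 4 ≤ E)
    (hyE : ∑ v, y v ≤ 2 * E) (U : Finset (Fin I.n)) (k : ℕ) :
    ∑ S ∈ (I.obstructions (E / 2)).filter (fun S => S ⊆ U ∧ S.card = k + 1), ∏ v ∈ S, y v ≤
      2 * (24 * 2 ^ c) ^ k * γ E * ∑ v ∈ U, y v := by
  -- The divisor 8 makes the expected size at most `E / 4`, as `half_le_subsetExp_inter_eq_card_le`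
  -- demands, and every probability at most `1 / 8`. The restriction to `U` puts only `∑_U y` on the
  -- right-hand side.
  set p : Fin I.n → ℝ := fun v => if v ∈ U then y v / 8 else 0 with hp
  have hp0 : ∀ v, 0 ≤ p v := fun v => by
    have := hy0 v
    simp only [hp]
    split_ifs
    · positivity
    · exact le_rfl
  have hpy : ∀ v, p v ≤ y v / 8 := fun v => by
    have := hy0 v
    simp only [hp]
    split_ifs
    · exact le_rfl
    · positivity
  have hp1 : ∀ v, p v ≤ 1 / 8 := fun v => by have := hy1 v; have := hpy v; linarith
  have hp1' : ∀ v, p v ≤ 1 := fun v => by have := hp1 v; linarith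
  set A := (I.obstructions (E / 2)).filter (fun S => S ⊆ U ∧ S.card = k + 1) with hA
  have hex : ∀ S : Finset (Fin I.n), S ∈ A → ∃ j, I.cap j = k ∧ S ⊆ I.edge j := by
    intro S hS
    obtain ⟨h1, -, h2⟩ := mem_filter.1 hS
    obtain ⟨⟨j, h3, h4⟩, -⟩ := mem_obstructions.1 h1
    exact ⟨j, by omega, h4⟩
  have hfib : ∀ S ∈ A, ∃ h : Finset (Fin I.n), (∃ j, h = I.edge j) ∧
      ((1 : ℝ) / 3) ^ k * ((∏ v ∈ S, y v) / 8 ^ (k + 1)) / 2 ≤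
      subsetExp p (fun R => if h ∩ R = S ∧ (R.card : ℝ) ≤ E then 1 else 0) := by
    intro S hS
    obtain ⟨j, hj, hSj⟩ := hex S hS
    obtain ⟨h1, hSU, h2⟩ := mem_filter.1 hS
    obtain ⟨-, h3⟩ := mem_obstructions.1 h1
    refine ⟨I.edge j, ⟨j, rfl⟩, le_trans ?_
      (half_le_subsetExp_inter_eq_card_le hp0 hp1' hSj (by linarith) h3 ?_)⟩
    · have e1 : ∏ v ∈ S, p v = (∏ v ∈ S, y v) / 8 ^ (k + 1) := by
        rw [← h2, ← prod_const, ← prod_div_distrib]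
        exact prod_congr rfl fun v hv => by simp [hp, hSU hv]
      have e2 : ((1 : ℝ) / 3) ^ k ≤ ∏ v ∈ I.edge j \ S, (1 - p v) := by
        refine pow_three_inv_le_prod _ hp0 hp1 ?_
        calc ∑ v ∈ I.edge j \ S, p v ≤ ∑ v ∈ I.edge j, p v :=
              sum_le_sum_of_subset_of_nonneg sdiff_subset fun v _ _ => hp0 v
          _ ≤ ∑ v ∈ I.edge j, y v / 8 := sum_le_sum fun v _ => hpy v
          _ ≤ k / 8 := by rw [← sum_div, ← hj]; have := hy j; linarith
      rw [← e1, mul_comm]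
      have : 0 ≤ ∏ v ∈ S, p v := prod_nonneg fun v _ => hp0 v
      gcongr
    · calc ∑ v, p v ≤ ∑ v, y v / 8 := sum_le_sum fun v _ => hpy v
        _ ≤ E / 4 := by rw [← sum_div]; linarith
  choose! h hh hle using hfib
  -- The obstructions counted for `R` are themselves traces of hyperedges on `R`, so bounded growth
  -- limits their number.
  have hcount : ∀ R : Finset (Fin I.n),
      ∑ S ∈ A, (if h S ∩ R = S ∧ (R.card : ℝ) ≤ E then (1 : ℝ) else 0) ≤
        2 ^ (c * k) * γ E * R.card := by
    intro R
    have hγE : 0 ≤ γ E := zero_le_one.trans (hγ1 E (by linarith))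
    by_cases hR : (R.card : ℝ) ≤ E
    · simp only [hR, and_true]
      rw [sum_boole]
      -- `γ` is monotone only on `[1, ∞)`, so the empty sample is treated apart; it has no trace of
      -- size `k + 1`.
      rcases R.eq_empty_or_nonempty with rfl | hne
      · have : A.filter (fun S => h S ∩ ∅ = S) = ∅ := by
          refine filter_eq_empty_iff.2 fun S hS hS' => ?_
          rw [inter_empty] at hS'
          have := (mem_filter.1 hS).2.2
          rw [← hS', card_empty] at this
          omega
        rw [this]
        simp
      · have hcard : (1 : ℝ) ≤ R.card := by exact_mod_cast card_pos.2 hne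
        have h1 : (A.filter fun S => h S ∩ R = S).card ≤ I.growth k R.card := by
          refine le_trans (card_le_card (t := (I.inducedEdges R).filter fun h => h.card = k + 1)
            fun S hS => ?_) ?_
          · obtain ⟨hSA, hS⟩ := mem_filter.1 hS
            refine mem_filter.2 ⟨?_, (mem_filter.1 hSA).2.2⟩
            obtain ⟨j, hj⟩ := hh S hSA
            exact mem_image.2 ⟨j, mem_univ j, by rw [← hj, hS]⟩
          · exact le_sup (f := fun X => ((I.inducedEdges X).filter fun h => h.card = k + 1).card)
              (show R ∈ univ.filter fun X => X.card ≤ R.card from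
                mem_filter.2 ⟨mem_univ R, le_rfl⟩)
        calc ((A.filter fun S => h S ∩ R = S).card : ℝ) ≤ I.growth k R.card := by
              exact_mod_cast h1
          _ ≤ 2 ^ (c * k) * (R.card : ℝ) * γ (R.card : ℝ) := hg k R.card
          _ ≤ 2 ^ (c * k) * (R.card : ℝ) * γ E := by
              gcongr
              exact hγ hcard (by simp only [Set.mem_Ici]; linarith) hR
          _ = 2 ^ (c * k) * γ E * R.card := by ring
    · simp only [hR, and_false, if_false, sum_const_zero]
      positivity
  have hsum := subsetExp_mono hp0 hp1' hcount
  rw [subsetExp_sum, subsetExp_const_mul, subsetExp_card] at hsum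
  have hpU : ∑ v, p v = (∑ v ∈ U, y v) / 8 := by
    simp only [hp]
    rw [sum_ite_mem, univ_inter, sum_div]
  have h2 := (sum_le_sum hle).trans hsum
  rw [← sum_div, ← mul_sum, ← sum_div, hpU] at h2
  have e3 : (24 * (2 : ℝ) ^ c) ^ k = 3 ^ k * 8 ^ k * 2 ^ (c * k) := by
    rw [pow_mul, ← mul_pow, ← mul_pow]
    norm_num
  rw [e3]
  have h3 : (0 : ℝ) < 3 ^ k * 8 ^ (k + 1) * 2 := by positivity
  calc ∑ S ∈ A, ∏ v ∈ S, y v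
      = (3 ^ k * 8 ^ (k + 1) * 2) *
        (((1 : ℝ) / 3) ^ k * ((∑ S ∈ A, ∏ v ∈ S, y v) / 8 ^ (k + 1)) / 2) := by
        rw [one_div, inv_pow]
        field_simp
    _ ≤ (3 ^ k * 8 ^ (k + 1) * 2) * (2 ^ (c * k) * γ E * ((∑ v ∈ U, y v) / 8)) := by gcongr
    _ = _ := by ring

theorem sum_pow_sixteen_le (n : ℕ) :
    ∑ k ∈ range (n + 1), (if k = 0 then 0 else 2 * ((1 : ℝ) / 16) ^ k) ≤ 1 / 4 := by
  -- The subtracted term is the room that the induction needs.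
  suffices ∑ k ∈ range (n + 1), (if k = 0 then 0 else 2 * ((1 : ℝ) / 16) ^ k) ≤
      1 / 4 - 1 / 4 * (1 / 16) ^ n by
    have h : (0 : ℝ) ≤ 1 / 4 * (1 / 16) ^ n := by positivity
    linarith
  induction n with
  | zero => simp
  | succ n ih =>
    rw [sum_range_succ, if_neg (Nat.succ_ne_zero n), pow_succ]
    have h : (0 : ℝ) ≤ (1 / 16) ^ n := by positivity
    linarith

/-- An obstruction of size `k + 1` comes from a hyperedge of capacity exactly `k`, so `γ E ≤ g ^ k`.
The factor `θ ^ k` gained by scaling therefore beats the whole bound of `sum_prod_obstruction_le`.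
Capacities are positive, so `k = 0` does not occur and the geometric series starts at `k = 1`. -/
theorem sum_prod_obstructions_le {c : ℕ} {γ : ℝ → ℝ} (hγ : MonotoneOn γ (Set.Ici 1))
    (hγ1 : ∀ t, 1 ≤ t → 1 ≤ γ t) (hg : I.BoundedGrowth c γ) {y : Fin I.n → ℝ}
    (hy0 : ∀ v, 0 ≤ y v) (hy1 : ∀ v, y v ≤ 1)
    (hy : ∀ j, ∑ v ∈ I.edge j, y v ≤ (I.cap j : ℝ)) {E : ℝ} (hE : 4 ≤ E)
    (hyE : ∑ v, y v ≤ 2 * E) {g θ : ℝ} (hg1 : 1 ≤ g) (hgγ : ∀ j, γ E ≤ g ^ I.cap j)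
    (hθ0 : 0 ≤ θ) (hθ : θ * (400 * 2 ^ c * g) ≤ 1) (U : Finset (Fin I.n)) :
    ∑ S ∈ (I.obstructions (E / 2)).filter (· ⊆ U), ∏ v ∈ S, θ * y v ≤
      1 / 4 * ∑ v ∈ U, θ * y v := by
  have hU : 0 ≤ ∑ v ∈ U, θ * y v := sum_nonneg fun v _ => mul_nonneg hθ0 (hy0 v)
  have hmaps : ∀ S ∈ (I.obstructions (E / 2)).filter (· ⊆ U), S.card - 1 ∈ range (I.n + 1) := by
    intro S _
    have := card_le_univ S
    rw [Fintype.card_fin] at this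
    exact mem_range.2 (by omega)
  rw [← sum_fiberwise_of_maps_to hmaps]
  refine le_trans (sum_le_sum (g := fun k => (if k = 0 then 0 else 2 * ((1 : ℝ) / 16) ^ k) *
    ∑ v ∈ U, θ * y v) fun k _ => ?_) ?_
  · have hset : ((I.obstructions (E / 2)).filter (· ⊆ U)).filter (fun S => S.card - 1 = k) ⊆
        (I.obstructions (E / 2)).filter (fun S => S ⊆ U ∧ S.card = k + 1) := by
      intro S hS
      obtain ⟨h1, h2⟩ := mem_filter.1 hS
      obtain ⟨h3, h4⟩ := mem_filter.1 h1
      obtain ⟨⟨j, h5, -⟩, -⟩ := mem_obstructions.1 h3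
      exact mem_filter.2 ⟨h3, h4, by omega⟩
    refine le_trans (sum_le_sum_of_subset_of_nonneg hset fun S _ _ =>
      prod_nonneg fun v _ => mul_nonneg hθ0 (hy0 v)) ?_
    rcases ((I.obstructions (E / 2)).filter
      (fun S => S ⊆ U ∧ S.card = k + 1)).eq_empty_or_nonempty with he | ⟨S, hS⟩
    · rw [he, sum_empty]
      refine mul_nonneg ?_ hU
      split_ifs <;> positivity
    · obtain ⟨h3, h4⟩ := mem_filter.1 hS
      obtain ⟨⟨j, h5, -⟩, -⟩ := mem_obstructions.1 h3
      have hk : I.cap j = k := by omega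
      have hk0 : k ≠ 0 := by have := I.one_le_cap j; omega
      rw [if_neg hk0]
      have e1 : ∀ S ∈ (I.obstructions (E / 2)).filter (fun S => S ⊆ U ∧ S.card = k + 1),
          ∏ v ∈ S, θ * y v = θ ^ (k + 1) * ∏ v ∈ S, y v := by
        intro S hS
        rw [prod_mul_distrib, prod_const, (mem_filter.1 hS).2.2]
      rw [sum_congr rfl e1, ← mul_sum]
      have h6 := sum_prod_obstruction_le hγ hγ1 hg hy0 hy1 hy hE hyE U k
      have hγk : γ E ≤ g ^ k := hk ▸ hgγ j
      have hy' : 0 ≤ ∑ v ∈ U, y v := sum_nonneg fun v _ => hy0 v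
      -- Here the constant 400 enters: `24 / 400 < 1 / 16`.
      have h7 : 24 * 2 ^ c * θ * g ≤ 1 / 16 := by linarith
      calc θ ^ (k + 1) * ∑ S ∈ (I.obstructions (E / 2)).filter
            (fun S => S ⊆ U ∧ S.card = k + 1), ∏ v ∈ S, y v
          ≤ θ ^ (k + 1) * (2 * (24 * 2 ^ c) ^ k * γ E * ∑ v ∈ U, y v) := by gcongr
        _ ≤ θ ^ (k + 1) * (2 * (24 * 2 ^ c) ^ k * g ^ k * ∑ v ∈ U, y v) := by gcongr
        _ = 2 * (24 * 2 ^ c * θ * g) ^ k * ∑ v ∈ U, θ * y v := by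
            rw [← mul_sum, mul_pow, mul_pow, pow_succ]; ring
        _ ≤ 2 * (1 / 16) ^ k * ∑ v ∈ U, θ * y v := by gcongr
  · rw [← sum_mul]
    gcongr
    exact sum_pow_sixteen_le I.n

/-- Sampling from a scaled fractional packing and dropping the last vertices of every overfull
hyperedge loses only a constant fraction of the expected weight. -/
theorem half_le_subsetExp_altered {c : ℕ} {γ : ℝ → ℝ} (hγ : MonotoneOn γ (Set.Ici 1))
    (hγ1 : ∀ t, 1 ≤ t → 1 ≤ γ t) (hg : I.BoundedGrowth c γ) {y : Fin I.n → ℝ}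
    (hy0 : ∀ v, 0 ≤ y v) (hy1 : ∀ v, y v ≤ 1)
    (hy : ∀ j, ∑ v ∈ I.edge j, y v ≤ (I.cap j : ℝ)) {E : ℝ} (hE : 4 ≤ E)
    (hyE : ∑ v, y v ≤ 2 * E) {g θ : ℝ} (hg1 : 1 ≤ g) (hgγ : ∀ j, γ E ≤ g ^ I.cap j)
    (hθ0 : 0 ≤ θ) (hθ : θ * (400 * 2 ^ c * g) ≤ 1) (W : Fin I.n → ℕ) :
    1 / 2 * ∑ v, (W v : ℝ) * (θ * y v) ≤
      subsetExp (fun v => θ * y v) (fun R => ∑ v ∈ I.altered W R, (W v : ℝ)) := by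
  obtain ⟨N, hN⟩ : ∃ N, ∀ v, W v ≤ N := ⟨∑ v, W v, fun v =>
    single_le_sum_of_canonicallyOrdered (mem_univ v)⟩
  have hθ1 : θ ≤ 1 / 400 := by
    have h1 : (1 : ℝ) ≤ 2 ^ c * g := one_le_mul_of_one_le_of_one_le (one_le_pow₀ one_le_two) hg1
    nlinarith
  have hp0 : ∀ v, 0 ≤ θ * y v := fun v => mul_nonneg hθ0 (hy0 v)
  have hp1 : ∀ v, θ * y v ≤ 1 := fun v => mul_le_one₀ (by linarith) (hy0 v) (hy1 v)
  -- A sample with more than `E / 2` elements is written off completely; otherwise every obstruction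
  -- inside it has at most `E / 2` elements.
  have key : ∀ R : Finset (Fin I.n), ∑ v ∈ R, (W v : ℝ) -
      ∑ S ∈ I.obstructions (E / 2), I.minWeight W N S * (if S ⊆ R then 1 else 0) -
      (if E / 2 < (R.card : ℝ) then ∑ v ∈ R, (W v : ℝ) else 0) ≤
      ∑ v ∈ I.altered W R, (W v : ℝ) := by
    intro R
    have h1 : 0 ≤ ∑ S ∈ I.obstructions (E / 2), I.minWeight W N S *
        (if S ⊆ R then (1 : ℝ) else 0) := sum_nonneg fun S _ =>
      mul_nonneg (minWeight_nonneg _ _ _) (by split_ifs <;> norm_num)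
    split_ifs with hR
    · have : (0 : ℝ) ≤ ∑ v ∈ I.altered W R, (W v : ℝ) := sum_nonneg fun v _ => by positivity
      linarith
    · have := sum_sub_altered_le hN (not_lt.1 hR)
      linarith
  have h2 := subsetExp_mono hp0 hp1 key
  rw [subsetExp_sub, subsetExp_sub, subsetExp_sum_mem, subsetExp_sum] at h2
  -- The expected size is at most `2 θ E`, so large samples lose at most a fraction `8 θ ≤ 1 / 50`.
  have h3 := subsetExp_sum_card_le (t := E) (a := 2 * θ) hp0 hp1
    (fun v => (W v).cast_nonneg (α := ℝ)) hE (by rw [← mul_sum]; nlinarith)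
  have hpos : 0 ≤ ∑ v, (W v : ℝ) * (θ * y v) :=
    sum_nonneg fun v _ => mul_nonneg (W v).cast_nonneg (hp0 v)
  have h4 : ∑ S ∈ I.obstructions (E / 2), subsetExp (fun v => θ * y v)
      (fun R => I.minWeight W N S * (if S ⊆ R then 1 else 0)) ≤
      1 / 4 * ∑ v, (W v : ℝ) * (θ * y v) := by
    simp only [subsetExp_const_mul, subsetExp_subset]
    -- Exchanging the sums leaves, for each threshold `τ`, an unweighted estimate for the
    -- obstructions inside `{v | τ < W v}`.
    simp only [minWeight, sum_mul]
    rw [sum_comm]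
    calc _ = ∑ τ ∈ range N, ∑ S ∈ (I.obstructions (E / 2)).filter
            (· ⊆ univ.filter fun v => τ < W v), ∏ v ∈ S, θ * y v := by
          refine sum_congr rfl fun τ _ => ?_
          rw [sum_filter]
          exact sum_congr rfl fun S _ => by split_ifs <;> simp
      _ ≤ ∑ τ ∈ range N, 1 / 4 * ∑ v with τ < W v, θ * y v := sum_le_sum fun τ _ =>
          sum_prod_obstructions_le hγ hγ1 hg hy0 hy1 hy hE hyE hg1 hgγ hθ0 hθ _
      _ = _ := by
          rw [← mul_sum]
          congr 1
          simp only [sum_filter]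
          rw [sum_comm]
          refine sum_congr rfl fun v _ => ?_
          rw [← sum_threshold (hN v), sum_mul]
          exact sum_congr rfl fun τ _ => by split_ifs <;> simp
  -- What remains is `1 - 1 / 4 - 8 / 400 ≥ 1 / 2` of the expected weight.
  nlinarith

end Instance
end Packing

/-! ### Multiplicative weights for packing programs, in integer arithmetic -/

namespace Packing

section MultiplicativeWeights

variable (A : ℕ → ℕ → ℕ) (M n : ℕ) (cap W : ℕ → ℕ) (Q : ℕ)

/-- The total weight `Y` of the constraints that contain the variable `v`. -/
def dualLength (Y : ℕ → ℕ) (v : ℕ) : ℕ := ∑ j ∈ range M, A j v * Y j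

/-- A maximizer `v` of `W v / len v` in `{0, …, k - 1}`, together with `W v` and `len v`. -/
def bestRatio (len : ℕ → ℕ) : ℕ → ℕ × ℕ × ℕ
  | 0 => (0, 0, 1)
  | v + 1 => if (bestRatio len v).2.1 * len v < W v * (bestRatio len v).2.2 then
      (v, W v, len v) else bestRatio len v

/-- The variable that is increased when the constraints have weights `Y`. -/
def mwChoice (Y : ℕ → ℕ) : ℕ := (bestRatio W (dualLength A M Y) n).1

/-- One step of the multiplicative weights method for the packing program with constraint matrix
`A`, right-hand side `cap` and objective `W`. -/
def mwStep (s : (ℕ → ℕ) × (ℕ → ℕ)) : (ℕ → ℕ) × (ℕ → ℕ) :=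
  (fun j => s.1 j + A j (mwChoice A M n W s.1) * (s.1 j / cap j),
    Function.update s.2 (mwChoice A M n W s.1) (s.2 (mwChoice A M n W s.1) + 1))

/-- Constraint weights and (unscaled) solution after `t` steps. -/
def mwRun : ℕ → (ℕ → ℕ) × (ℕ → ℕ)
  | 0 => (fun j => Q * Q / cap j, fun _ => 0)
  | t + 1 => mwStep A M n cap W (mwRun t)

variable {A M n cap W Q}

/-- Ratios are compared by cross multiplication. The start value `(0, 0, 1)` stands for the ratio 0
and is kept only as long as all objective coefficients vanish. -/
theorem bestRatio_spec {len : ℕ → ℕ} {k : ℕ} (hlen : ∀ v < k, 0 < len v) :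
    0 < (bestRatio W len k).2.2 ∧
    (∀ v < k, W v * (bestRatio W len k).2.2 ≤ (bestRatio W len k).2.1 * len v) ∧
    (bestRatio W len k = (0, 0, 1) ∨ (bestRatio W len k).1 < k ∧
      (bestRatio W len k).2.1 = W (bestRatio W len k).1 ∧
      (bestRatio W len k).2.2 = len (bestRatio W len k).1) := by
  induction k with
  | zero => simp [bestRatio]
  | succ k ih =>
    obtain ⟨h1, h2, h3⟩ := ih fun v hv => hlen v (by omega)
    have hk := hlen k (by omega)
    rw [bestRatio]
    split_ifs with h
    · refine ⟨hk, fun v hv => ?_, Or.inr ⟨by simp, rfl, rfl⟩⟩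
      rcases Nat.lt_succ_iff_lt_or_eq.1 hv with hv | rfl
      · have h4 := h2 v hv
        have h5 : W v * len k * (bestRatio W len k).2.2 ≤
            W k * len v * (bestRatio W len k).2.2 := by
          calc W v * len k * (bestRatio W len k).2.2
              = (W v * (bestRatio W len k).2.2) * len k := by ring
            _ ≤ ((bestRatio W len k).2.1 * len v) * len k := Nat.mul_le_mul_right _ h4
            _ = ((bestRatio W len k).2.1 * len k) * len v := by ring
            _ ≤ (W k * (bestRatio W len k).2.2) * len v := Nat.mul_le_mul_right _ h.le
            _ = _ := by ring
        exact Nat.le_of_mul_le_mul_right h5 h1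
      · exact le_rfl
    · refine ⟨h1, fun v hv => ?_, h3.imp_right fun ⟨h4, h5⟩ => ⟨by omega, h5⟩⟩
      rcases Nat.lt_succ_iff_lt_or_eq.1 hv with hv | rfl
      · exact h2 v hv
      · exact not_lt.1 h

theorem bestRatio_lt {len : ℕ → ℕ} {k : ℕ} (hk : 0 < k) : (bestRatio W len k).1 < k := by
  induction k with
  | zero => omega
  | succ k ih =>
    rw [bestRatio]
    split_ifs
    · simp
    · rcases Nat.eq_zero_or_pos k with rfl | h
      · simp [bestRatio]
      · exact (ih h).trans (by omega)

theorem mwChoice_lt (hn : 0 < n) (Y : ℕ → ℕ) : mwChoice A M n W Y < n := bestRatio_lt hn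

/-- A step at most doubles a weight, so after polynomially many steps its bit length is still
polynomial. -/
theorem mwRun_fst_le (hA : ∀ j v, A j v ≤ 1) (t j : ℕ) :
    (mwRun A M n cap W Q t).1 j ≤ Q * Q * 2 ^ t := by
  induction t with
  | zero => simpa [mwRun] using Nat.div_le_self _ _
  | succ t ih =>
    have h1 := Nat.div_le_self ((mwRun A M n cap W Q t).1 j) (cap j)
    have h2 := Nat.mul_le_mul (hA j (mwChoice A M n W (mwRun A M n cap W Q t).1)) h1
    simp only [mwRun, mwStep]
    rw [pow_succ, ← mul_assoc]
    omega

theorem mwRun_snd_le (t v : ℕ) : (mwRun A M n cap W Q t).2 v ≤ t := by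
  induction t with
  | zero => simp [mwRun]
  | succ t ih =>
    simp only [mwRun, mwStep, Function.update_apply]
    split_ifs with h
    · rw [← h]; omega
    · omega

theorem sum_update_add_one (a : ℕ → ℕ) (z : ℕ → ℕ) {b : ℕ} (hb : b < n) :
    ∑ v ∈ range n, a v * Function.update z b (z b + 1) v = ∑ v ∈ range n, a v * z v + a b := by
  have h : ∀ v, a v * Function.update z b (z b + 1) v = a v * z v + if v = b then a v else 0 := by
    intro v
    rw [Function.update_apply]
    split_ifs with h
    · rw [h]; ring
    · rfl
  simp only [h, sum_add_distrib, sum_ite_eq', mem_range, hb, if_true]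

theorem sum_mwRun_succ (hn : 0 < n) (a : ℕ → ℕ) (t : ℕ) :
    ∑ v ∈ range n, a v * (mwRun A M n cap W Q (t + 1)).2 v =
      ∑ v ∈ range n, a v * (mwRun A M n cap W Q t).2 v +
        a (mwChoice A M n W (mwRun A M n cap W Q t).1) :=
  sum_update_add_one a _ (mwChoice_lt hn _)

theorem sum_mwRun (hn : 0 < n) (t : ℕ) :
    ∑ v ∈ range n, (mwRun A M n cap W Q t).2 v = t := by
  induction t with
  | zero => simp [mwRun]
  | succ t ih =>
    simpa [ih] using
      sum_mwRun_succ (A := A) (M := M) (cap := cap) (W := W) (Q := Q) hn (fun _ => 1) t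

/-- The start `Q² / cap j` is chosen for this bound: the increment `Y / cap j`, rounded down, never
vanishes and loses at most a factor 2. Later steps only increase the weights. -/
theorem le_mwRun_zero {j : ℕ} (h1 : 1 ≤ cap j) (hQ : cap j ≤ Q) (t : ℕ) :
    cap j ≤ (mwRun A M n cap W Q t).1 j := by
  induction t with
  | zero => exact (Nat.le_div_iff_mul_le h1).2 (Nat.mul_le_mul hQ hQ)
  | succ t ih => exact ih.trans (Nat.le_add_right _ _)

/-- The weight of a constraint grows exponentially with its load. -/
theorem pow_le_mwRun (hn : 0 < n) (hA : ∀ j v, A j v ≤ 1) {j : ℕ} (h1 : 1 ≤ cap j)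
    (hQ : cap j ≤ Q) (t : ℕ) :
    (Q : ℝ) * Q / (2 * cap j) *
      (1 + 1 / (2 * cap j)) ^ (∑ v ∈ range n, A j v * (mwRun A M n cap W Q t).2 v) ≤
        (mwRun A M n cap W Q t).1 j := by
  -- Rounding a quotient that is at least 1 down to an integer loses at most a factor 2.
  have hfloor : ∀ a : ℕ, cap j ≤ a → (a : ℝ) / (2 * cap j) ≤ (a / cap j : ℕ) := by
    intro a ha
    have hc : (0 : ℝ) < cap j := by exact_mod_cast h1
    have h3 : 1 ≤ a / cap j := (Nat.le_div_iff_mul_le h1).2 (by omega)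
    have h2 : a < cap j * (a / cap j + 1) := Nat.lt_mul_div_succ a h1
    have h4 : a ≤ 2 * cap j * (a / cap j) := by nlinarith
    rw [div_le_iff₀ (by positivity)]
    calc (a : ℝ) ≤ 2 * cap j * (a / cap j : ℕ) := by exact_mod_cast h4
      _ = _ := by ring
  induction t with
  | zero =>
    simp only [mwRun, mul_zero, sum_const_zero, pow_zero, mul_one]
    have := hfloor (Q * Q) (by nlinarith)
    push_cast at this ⊢
    exact this
  | succ t ih =>
    rw [sum_mwRun_succ hn]
    simp only [mwRun, mwStep]
    set b := mwChoice A M n W (mwRun A M n cap W Q t).1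
    rcases Nat.le_one_iff_eq_zero_or_eq_one.1 (hA j b) with h | h
    · rw [h]
      simpa using ih
    · rw [h, pow_succ, ← mul_assoc]
      have h3 := hfloor _ (le_mwRun_zero (A := A) (M := M) (n := n) (W := W) h1 hQ t)
      have h4 : (0 : ℝ) ≤ 1 / (2 * cap j) := by positivity
      push_cast
      calc _ ≤ ((mwRun A M n cap W Q t).1 j : ℝ) * (1 + 1 / (2 * cap j)) := by gcongr
        _ = (mwRun A M n cap W Q t).1 j + ((mwRun A M n cap W Q t).1 j : ℝ) / (2 * cap j) := by
          ring
        _ ≤ _ := by linarith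

/-- The chosen variable has a large objective coefficient, compared with any fractional
solution. -/
theorem dualLength_mwChoice_mul_le {Y : ℕ → ℕ} {x : ℕ → ℝ} (hx0 : ∀ v, 0 ≤ x v)
    (hx : ∀ j < M, ∑ v ∈ range n, (A j v : ℝ) * x v ≤ cap j)
    (hlen : ∀ v < n, 0 < dualLength A M Y v) (hW : 0 < ∑ v ∈ range n, (W v : ℝ) * x v) :
    (dualLength A M Y (mwChoice A M n W Y) : ℝ) * ∑ v ∈ range n, (W v : ℝ) * x v ≤
      W (mwChoice A M n W Y) * ∑ j ∈ range M, (cap j : ℝ) * Y j := by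
  obtain ⟨h1, h2, h3⟩ := bestRatio_spec (W := W) hlen
  have h4 : (bestRatio W (dualLength A M Y) n).2.1 = W (mwChoice A M n W Y) ∧
      (bestRatio W (dualLength A M Y) n).2.2 = dualLength A M Y (mwChoice A M n W Y) := by
    rcases h3 with h3 | h3
    -- If the default were never replaced, all coefficients would be 0, against `hW`.
    · exfalso
      rw [h3] at h2
      refine hW.ne' (sum_eq_zero fun v hv => ?_)
      have := h2 v (mem_range.1 hv)
      simp only [mul_one, zero_mul, Nat.le_zero] at this
      simp [this]
    · exact h3.2
  rw [h4.1, h4.2] at h2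
  calc (dualLength A M Y (mwChoice A M n W Y) : ℝ) * ∑ v ∈ range n, (W v : ℝ) * x v
      = ∑ v ∈ range n, ((W v * dualLength A M Y (mwChoice A M n W Y) : ℕ) : ℝ) * x v := by
        rw [mul_sum]
        exact sum_congr rfl fun v _ => by push_cast; ring
    -- This uses that the chosen ratio is maximal; afterwards exchanging the sums brings in the
    -- feasibility of `x`, as in weak duality.
    _ ≤ ∑ v ∈ range n, ((W (mwChoice A M n W Y) * dualLength A M Y v : ℕ) : ℝ) * x v := by
        refine sum_le_sum fun v hv => mul_le_mul_of_nonneg_right ?_ (hx0 v)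
        exact_mod_cast h2 v (mem_range.1 hv)
    _ = W (mwChoice A M n W Y) * ∑ j ∈ range M, (∑ v ∈ range n, (A j v : ℝ) * x v) * Y j := by
        simp only [dualLength, mul_sum, sum_mul, Nat.cast_mul, Nat.cast_sum]
        rw [sum_comm]
        exact sum_congr rfl fun v _ => sum_congr rfl fun j _ => by ring
    _ ≤ W (mwChoice A M n W Y) * ∑ j ∈ range M, (cap j : ℝ) * Y j := by
        gcongr with j hj
        exact hx j (mem_range.1 hj)

/-- The row of capacity 1 through `v` keeps the denominator in the ratio for `v` positive. -/
theorem dualLength_mwRun_pos (hcap : ∀ j < M, 1 ≤ cap j) (hQ : ∀ j < M, cap j ≤ Q)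
    {v : ℕ} (hs : ∃ j < M, cap j = 1 ∧ A j v = 1) (t : ℕ) :
    0 < dualLength A M (mwRun A M n cap W Q t).1 v := by
  obtain ⟨j, hj, -, h2⟩ := hs
  refine sum_pos' (fun _ _ => Nat.zero_le _) ⟨j, mem_range.2 hj, ?_⟩
  have := le_mwRun_zero (A := A) (M := M) (n := n) (W := W) (hcap j hj) (hQ j hj) t
  have := hcap j hj
  rw [h2]
  omega

/-- The potential grows at most exponentially with the value of the solution. -/
theorem potential_mwRun_le (hn : 0 < n) (hcap : ∀ j < M, 1 ≤ cap j) (hQ : ∀ j < M, cap j ≤ Q)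
    (hs : ∀ v < n, ∃ j < M, cap j = 1 ∧ A j v = 1) {x : ℕ → ℝ} (hx0 : ∀ v, 0 ≤ x v)
    (hx : ∀ j < M, ∑ v ∈ range n, (A j v : ℝ) * x v ≤ cap j)
    (hW : 0 < ∑ v ∈ range n, (W v : ℝ) * x v) (t : ℕ) :
    ∑ j ∈ range M, (cap j : ℝ) * (mwRun A M n cap W Q t).1 j ≤
      M * (Q * Q) * Real.exp ((∑ v ∈ range n, W v * (mwRun A M n cap W Q t).2 v : ℕ) /
        ∑ v ∈ range n, (W v : ℝ) * x v) := by
  induction t with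
  | zero =>
    simp only [mwRun, mul_zero, sum_const_zero, Nat.cast_zero, zero_div, Real.exp_zero, mul_one]
    rw [← nsmul_eq_mul, ← card_range M, ← sum_const]
    rw [card_range]
    refine sum_le_sum fun j _ => ?_
    exact_mod_cast Nat.mul_div_le (Q * Q) (cap j)
  | succ t ih =>
    rw [sum_mwRun_succ hn]
    set X := ∑ v ∈ range n, (W v : ℝ) * x v
    set Y := (mwRun A M n cap W Q t).1 with hY
    have h1 := dualLength_mwChoice_mul_le hx0 hx
      (fun v hv => dualLength_mwRun_pos (n := n) (W := W) hcap hQ (hs v hv) t) hW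
    rw [← hY] at h1
    set b := mwChoice A M n W Y with hb
    have h2 : ∑ j ∈ range M, (cap j : ℝ) * (mwRun A M n cap W Q (t + 1)).1 j ≤
        ∑ j ∈ range M, (cap j : ℝ) * Y j + dualLength A M Y b := by
      rw [dualLength, Nat.cast_sum, ← sum_add_distrib]
      refine sum_le_sum fun j _ => ?_
      have h3 : A j b * (cap j * (Y j / cap j)) ≤ A j b * Y j :=
        Nat.mul_le_mul_left _ (Nat.mul_div_le _ _)
      have h4 : cap j * (mwRun A M n cap W Q (t + 1)).1 j ≤ cap j * Y j + A j b * Y j := by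
        simp only [mwRun, mwStep, ← hY, ← hb]
        nlinarith
      exact_mod_cast h4
    -- The greedy choice bounds the relative growth of the potential by `W b / X`, which `1 + u ≤
    -- e^u` turns into a summand of the exponent.
    have h5 : (dualLength A M Y b : ℝ) ≤ W b / X * ∑ j ∈ range M, (cap j : ℝ) * Y j := by
      rw [div_mul_eq_mul_div, le_div_iff₀ hW]
      exact h1
    have h6 : 0 ≤ ∑ j ∈ range M, (cap j : ℝ) * Y j := sum_nonneg fun _ _ => by positivity
    rw [Nat.cast_add, add_div, Real.exp_add]
    have h7 := Real.add_one_le_exp ((W b : ℝ) / X)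
    calc _ ≤ ∑ j ∈ range M, (cap j : ℝ) * Y j * ((W b : ℝ) / X + 1) := by
          rw [← sum_mul]; linarith
      _ = (∑ j ∈ range M, (cap j : ℝ) * Y j) * ((W b : ℝ) / X + 1) := by rw [sum_mul]
      _ ≤ (∑ j ∈ range M, (cap j : ℝ) * Y j) * Real.exp ((W b : ℝ) / X) := by gcongr
      _ ≤ _ := by
          rw [← mul_assoc]
          exact mul_le_mul_of_nonneg_right ih (Real.exp_pos _).le

/-- The multiplicative weights method solves packing programs up to a constant factor. -/
theorem mwRun_spec (hn : 0 < n) (hA : ∀ j v, A j v ≤ 1) (hcap : ∀ j < M, 1 ≤ cap j)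
    (hQ : ∀ j < M, cap j ≤ Q) (hs : ∀ v < n, ∃ j < M, cap j = 1 ∧ A j v = 1) {x : ℕ → ℝ}
    (hx0 : ∀ v, 0 ≤ x v) (hx : ∀ j < M, ∑ v ∈ range n, (A j v : ℝ) * x v ≤ cap j)
    (hW : 0 < ∑ v ∈ range n, (W v : ℝ) * x v) {z : ℕ → ℕ}
    (hz : z = (mwRun A M n cap W Q (12 * n * M)).2) {ρ : ℝ}
    (hρ : ρ = 6 * ((∑ v ∈ range n, W v * z v : ℕ) / ∑ v ∈ range n, (W v : ℝ) * x v)) :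
    1 ≤ ρ ∧ ∀ j < M, ((∑ v ∈ range n, A j v * z v : ℕ) : ℝ) ≤ cap j * ρ := by
  set X := ∑ v ∈ range n, (W v : ℝ) * x v
  set a := ((∑ v ∈ range n, W v * z v : ℕ) : ℝ) / X with ha
  have hM : 0 < M := by
    obtain ⟨j, hj, -⟩ := hs 0 hn
    omega
  have hMR : (1 : ℝ) ≤ M := by exact_mod_cast hM
  set l := Real.log (2 * M) with hl
  -- A single row weight is bounded by the potential. Comparing the exponential lower and upper
  -- bounds cancels `Q * Q` and leaves `(1 + 1 / (2 cap j)) ^ N ≤ 2 M e^a`; logarithms then bound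
  -- the load `N`.
  have key : ∀ j < M, ((∑ v ∈ range n, A j v * z v : ℕ) : ℝ) ≤ 3 * cap j * (l + a) := by
    intro j hj
    set N := ∑ v ∈ range n, A j v * z v with hN
    have hc : (1 : ℝ) ≤ cap j := by exact_mod_cast hcap j hj
    have hc0 : (0 : ℝ) < cap j := by linarith
    have hQ0 : (0 : ℝ) < Q := by exact_mod_cast (hcap j hj).trans (hQ j hj)
    have h1 := potential_mwRun_le hn hcap hQ hs hx0 hx hW (12 * n * M)
    have h2 := pow_le_mwRun (M := M) (W := W) hn hA (hcap j hj) (hQ j hj) (12 * n * M)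
    rw [← hz] at h1 h2
    have h3 : (cap j : ℝ) * (mwRun A M n cap W Q (12 * n * M)).1 j ≤ _ :=
      (single_le_sum (f := fun j => (cap j : ℝ) * (mwRun A M n cap W Q (12 * n * M)).1 j)
        (fun _ _ => by positivity) (mem_range.2 hj)).trans h1
    have h4 : (Q : ℝ) * Q / 2 * (1 + 1 / (2 * cap j)) ^ N ≤ M * (Q * Q) * Real.exp a := by
      refine le_trans ?_ h3
      calc (Q : ℝ) * Q / 2 * (1 + 1 / (2 * cap j)) ^ N
          = cap j * ((Q : ℝ) * Q / (2 * cap j) * (1 + 1 / (2 * cap j)) ^ N) := by field_simp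
        _ ≤ _ := by gcongr
    have h5 : (1 + 1 / (2 * (cap j : ℝ))) ^ N ≤ (2 * M) * Real.exp a := by
      have h6 : (0 : ℝ) < Q * Q / 2 := by positivity
      refine le_of_mul_le_mul_left (h4.trans (le_of_eq ?_)) h6
      ring
    have h7 := Real.log_le_log (by positivity) h5
    rw [Real.log_pow, Real.log_mul (by positivity) (Real.exp_pos _).ne', Real.log_exp] at h7
    -- From `log(1 + 1 / (2c)) ≥ 1 / (2c + 1)` and `c ≥ 1`.
    have h8 : 1 / (3 * (cap j : ℝ)) ≤ Real.log (1 + 1 / (2 * cap j)) := by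
      refine le_trans ?_ (Real.one_sub_inv_le_log_of_pos (by positivity))
      have : 1 - (1 + 1 / (2 * (cap j : ℝ)))⁻¹ = 1 / (2 * cap j + 1) := by field_simp; ring
      rw [this]
      apply one_div_le_one_div_of_le <;> linarith
    have h9 : (N : ℝ) * (1 / (3 * (cap j : ℝ))) ≤ l + a :=
      (mul_le_mul_of_nonneg_left h8 N.cast_nonneg).trans h7
    rw [mul_one_div, div_le_iff₀ (by positivity)] at h9
    linarith
  -- After `12 n M` steps some variable has been raised `12 M` times. Its row of capacity 1 gives
  -- `12 M ≤ 3 (l + a)`, and `l ≤ 2 M` then forces `a ≥ 2 M ≥ l`. Thus the additive error `l` is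
  -- absorbed in `a`, which doubles the factor 3 to the 6 in `ρ`.
  have hla : l ≤ a := by
    obtain ⟨v, hv, hzv⟩ : ∃ v ∈ range n, 12 * M ≤ z v := by
      by_contra! h
      have h1 : ∑ v ∈ range n, z v < ∑ v ∈ range n, 12 * M :=
        sum_lt_sum_of_nonempty ⟨0, mem_range.2 hn⟩ h
      rw [hz, sum_mwRun hn, sum_const, card_range, smul_eq_mul] at h1
      nlinarith
    obtain ⟨j, hj, hc, hAj⟩ := hs v (mem_range.1 hv)
    have h1 := key j hj
    have h2 : A j v * z v ≤ ∑ v ∈ range n, A j v * z v :=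
      single_le_sum_of_canonicallyOrdered (f := fun v => A j v * z v) hv
    rw [hAj, one_mul] at h2
    have h3 : ((12 * M : ℕ) : ℝ) ≤ (∑ v ∈ range n, A j v * z v : ℕ) := by
      exact_mod_cast hzv.trans h2
    rw [hc] at h1
    have h4 : l ≤ 2 * M := (Real.log_le_sub_one_of_pos (by positivity)).trans (by linarith)
    push_cast at h1 h3
    linarith
  have hl2 : 1 / 2 ≤ l := by
    have h1 : Real.log 2 ≤ l := Real.log_le_log (by norm_num) (by linarith)
    have := Real.log_two_gt_d9
    linarith
  refine ⟨by rw [hρ]; linarith, fun j hj => (key j hj).trans ?_⟩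
  rw [hρ]
  have hc : (0 : ℝ) ≤ cap j := (cap j).cast_nonneg
  nlinarith

end MultiplicativeWeights

end Packing

namespace Packing

/-! ### Reasoning about programs -/

/-- All numbers in the memory have at most `B` bits. -/
def State.Bounded (B : ℕ) (σ : State) : Prop :=
  (∀ x, σ.var x < 2 ^ B) ∧ ∀ a i, σ.arr a i < 2 ^ B

@[simp] theorem State.setVar_var (σ : State) (x b y : ℕ) :
    (σ.setVar x b).var y = if y = x then b else σ.var y := by
  simp [State.setVar, Function.update_apply]

@[simp] theorem State.setVar_arr (σ : State) (x b : ℕ) : (σ.setVar x b).arr = σ.arr := rfl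

@[simp] theorem State.setArr_var (σ : State) (a i b : ℕ) : (σ.setArr a i b).var = σ.var := rfl

@[simp] theorem State.setArr_arr (σ : State) (a i b a' : ℕ) :
    (σ.setArr a i b).arr a' = if a' = a then Function.update (σ.arr a) i b else σ.arr a' := by
  simp [State.setArr, Function.update_apply]

theorem State.Bounded.setVar {B : ℕ} {σ : State} (h : σ.Bounded B) (x : ℕ) {b : ℕ}
    (hb : b < 2 ^ B) : (σ.setVar x b).Bounded B := by
  refine ⟨fun y => ?_, h.2⟩
  rw [State.setVar_var]
  split_ifs
  · exact hb
  · exact h.1 y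

theorem State.Bounded.setArr {B : ℕ} {σ : State} (h : σ.Bounded B) (a i : ℕ) {b : ℕ}
    (hb : b < 2 ^ B) : (σ.setArr a i b).Bounded B := by
  refine ⟨h.1, fun a' i' => ?_⟩
  rw [State.setArr_arr]
  split_ifs
  · rw [Function.update_apply]
    split_ifs
    · exact hb
    · exact h.2 a i'
  · exact h.2 a' i'

/-- The value of an expression has at most `valueFactor * (B + 1)` bits. -/
def Expr.valueFactor : Expr → ℕ
  | .lit a => Nat.size a
  | .var _ => 1
  | .get _ _ => 1
  | .add e f => e.valueFactor + f.valueFactor + 1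
  | .sub e _ => e.valueFactor
  | .mul e f => e.valueFactor + f.valueFactor
  | .div e _ => e.valueFactor

/-- The evaluation of an expression takes at most `costFactor * (B + 1)` steps. -/
def Expr.costFactor : Expr → ℕ
  | .lit a => Nat.size a + 1
  | .var _ => 1
  | .get _ i => i.costFactor + i.valueFactor + 1
  | .add e f | .sub e f | .mul e f | .div e f =>
      e.costFactor + f.costFactor + e.valueFactor + f.valueFactor + 1

/-- Bit lengths are measured in units of `B + 1`, so that one extra unit absorbs the carry of an
addition even when `B = 0`. -/
theorem Expr.eval_lt {B : ℕ} {σ : State} (h : σ.Bounded B) (e : Expr) :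
    e.eval σ < 2 ^ (e.valueFactor * (B + 1)) := by
  induction e with
  | lit a =>
    refine (Nat.lt_size_self a).trans_le (Nat.pow_le_pow_right two_pos ?_)
    exact Nat.le_mul_of_pos_right _ B.succ_pos
  | var x => exact (h.1 x).trans_le (Nat.pow_le_pow_right two_pos (by simp [Expr.valueFactor]))
  | get a i => exact (h.2 a _).trans_le (Nat.pow_le_pow_right two_pos (by simp [Expr.valueFactor]))
  | add e f he hf =>
    simp only [Expr.eval, Expr.valueFactor, add_mul, pow_add, one_mul]
    have h1 : 1 ≤ 2 ^ (e.valueFactor * (B + 1)) := Nat.one_le_two_pow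
    have h2 : 1 ≤ 2 ^ (f.valueFactor * (B + 1)) := Nat.one_le_two_pow
    have h3 : 1 ≤ 2 ^ B := Nat.one_le_two_pow
    generalize 2 ^ (e.valueFactor * (B + 1)) = a at *
    generalize 2 ^ (f.valueFactor * (B + 1)) = b at *
    have h4 : a + b ≤ a * b * 2 := by nlinarith
    have h5 : a * b * 2 ≤ a * b * (2 ^ B * 2 ^ 1) := Nat.mul_le_mul_left _ (by omega)
    omega
  | sub e f he hf => exact (Nat.sub_le _ _).trans_lt he
  | mul e f he hf =>
    simp only [Expr.eval, Expr.valueFactor, add_mul, pow_add]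
    exact Nat.mul_lt_mul'' he hf
  | div e f he hf => exact (Nat.div_le_self _ _).trans_lt he

theorem Expr.size_eval_le {B : ℕ} {σ : State} (h : σ.Bounded B) (e : Expr) :
    Nat.size (e.eval σ) ≤ e.valueFactor * (B + 1) :=
  Nat.size_le.2 (e.eval_lt h)

theorem Expr.cost_le {B : ℕ} {σ : State} (h : σ.Bounded B) (e : Expr) :
    e.cost σ ≤ e.costFactor * (B + 1) := by
  induction e with
  | lit a => exact Nat.le_mul_of_pos_right _ B.succ_pos
  | var x =>
    have := Nat.size_le.2 (h.1 x)
    simp only [Expr.cost, Expr.costFactor]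
    omega
  | get a i hi =>
    have h1 := Nat.size_le.2 (h.2 a (i.eval σ))
    have h2 := i.size_eval_le h
    simp only [Expr.cost, Expr.costFactor, add_mul]
    omega
  | add e f he hf | sub e f he hf | mul e f he hf | div e f he hf =>
    have h1 := e.size_eval_le h
    have h2 := f.size_eval_le h
    simp only [Expr.cost, Expr.costFactor, add_mul]
    omega

/-- A bound for the running time of a program in terms of a bound `B` for the bit lengths of the
numbers and for the numbers of iterations of the loops. -/
def Program.timeBound {R : Type*} [CommSemiring R] (B : R) : Program → R
  | .skip => 1
  | .assign _ e => e.costFactor * (B + 1) + 1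
  | .store _ i e =>
      (i.costFactor + e.costFactor + i.valueFactor + e.valueFactor : ℕ) * (B + 1) + 1
  | .seq p q => p.timeBound B + q.timeBound B + 1
  | .cond e p q => e.costFactor * (B + 1) + p.timeBound B + q.timeBound B + 1
  | .loop e p => (B + 1) * (e.costFactor * (B + 1) + p.timeBound B + 1)

/-- The recursion for the time bound makes sense in any commutative semiring. Applied to a
polynomial `B` it yields a polynomial, so a concrete running time becomes a polynomial one. -/
theorem Program.eval_timeBound (B : Polynomial ℕ) (k : ℕ) (p : Program) :
    (p.timeBound B).eval k = p.timeBound (B.eval k) := by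
  induction p <;> simp_all [Program.timeBound]

/-- The variables that a program may change. -/
def Program.vars : Program → Finset ℕ
  | .skip => ∅
  | .assign x _ => {x}
  | .store _ _ _ => ∅
  | .seq p q => p.vars ∪ q.vars
  | .cond _ p q => p.vars ∪ q.vars
  | .loop _ p => p.vars

/-- The arrays that a program may change. -/
def Program.arrs : Program → Finset ℕ
  | .skip => ∅
  | .assign _ _ => ∅
  | .store a _ _ => {a}
  | .seq p q => p.arrs ∪ q.arrs
  | .cond _ p q => p.arrs ∪ q.arrs
  | .loop _ p => p.arrs

/-- `τ` agrees with `σ` except for the variables and arrays that `p` may change. -/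
def Frame (p : Program) (σ τ : State) : Prop :=
  (∀ x ∉ p.vars, τ.var x = σ.var x) ∧ ∀ a ∉ p.arrs, τ.arr a = σ.arr a

/-- With this, a specification need only mention what a program changes; everything else is carried
across by a decidable check on `vars` and `arrs`. -/
theorem Exec.frame {p : Program} {σ τ : State} {t : ℕ} (h : Exec p σ τ t) : Frame p σ τ := by
  induction h with
  | skip σ => exact ⟨fun _ _ => rfl, fun _ _ => rfl⟩
  | assign σ x e =>
    refine ⟨fun y hy => ?_, fun _ _ => rfl⟩
    rw [State.setVar_var, if_neg (by simpa [Program.vars] using hy)]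
  | store σ a i e =>
    refine ⟨fun _ _ => rfl, fun b hb => ?_⟩
    rw [State.setArr_arr, if_neg (by simpa [Program.arrs] using hb)]
  | seq _ _ ih1 ih2 =>
    constructor <;> intro x hx <;> simp only [Program.vars, Program.arrs, mem_union, not_or] at hx
    · rw [ih2.1 x hx.2, ih1.1 x hx.1]
    · rw [ih2.2 x hx.2, ih1.2 x hx.1]
  | cond_true _ _ ih =>
    constructor <;> intro x hx <;> simp only [Program.vars, Program.arrs, mem_union, not_or] at hx
    · exact ih.1 x hx.1
    · exact ih.2 x hx.1
  | cond_false _ _ ih =>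
    constructor <;> intro x hx <;> simp only [Program.vars, Program.arrs, mem_union, not_or] at hx
    · exact ih.1 x hx.2
    · exact ih.2 x hx.2
  | loop_stop _ => exact ⟨fun _ _ => rfl, fun _ _ => rfl⟩
  | loop_step _ _ _ ih1 ih2 =>
    exact ⟨fun x hx => (ih2.1 x hx).trans (ih1.1 x hx),
      fun x hx => (ih2.2 x hx).trans (ih1.2 x hx)⟩

/-- Started in the state `σ`, if its numbers have at most `B` bits, the program `p` halts within
the time bound in a state with the property `Q` whose numbers have at most `B` bits. -/
def Run (B : ℕ) (p : Program) (σ : State) (Q : State → Prop) : Prop :=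
  σ.Bounded B → ∃ τ t, Exec p σ τ t ∧ t ≤ p.timeBound B ∧ τ.Bounded B ∧ Q τ

section Rules

variable {B : ℕ} {p q : Program} {σ : State} {P Q : State → Prop}

theorem Run.mono (h : Run B p σ P) (hQ : ∀ τ, Frame p σ τ → P τ → Q τ) : Run B p σ Q := by
  intro hσ
  obtain ⟨τ, t, h1, h2, h3, h4⟩ := h hσ
  exact ⟨τ, t, h1, h2, h3, hQ τ h1.frame h4⟩

theorem Run.skip (h : Q σ) : Run B .skip σ Q :=
  fun hσ => ⟨σ, 1, .skip σ, le_rfl, hσ, h⟩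

theorem Run.assign {x : ℕ} {e : Expr} (hB : e.eval σ < 2 ^ B) (h : Q (σ.setVar x (e.eval σ))) :
    Run B (.assign x e) σ Q :=
  fun hσ => ⟨_, _, .assign σ x e, Nat.add_le_add_right (e.cost_le hσ) 1, hσ.setVar x hB, h⟩

theorem Run.store {a : ℕ} {i e : Expr} (hB : e.eval σ < 2 ^ B)
    (h : Q (σ.setArr a (i.eval σ) (e.eval σ))) : Run B (.store a i e) σ Q := by
  refine fun hσ => ⟨_, _, .store σ a i e, ?_, hσ.setArr a _ hB, h⟩
  have h1 := i.cost_le hσ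
  have h2 := e.cost_le hσ
  have h3 := i.size_eval_le hσ
  have h4 := e.size_eval_le hσ
  simp only [Program.timeBound, Nat.cast_id, add_mul] at *
  omega

theorem Run.seq (h : Run B p σ fun τ => Run B q τ Q) : Run B (.seq p q) σ Q := by
  intro hσ
  obtain ⟨τ, t, h1, h2, h3, h4⟩ := h hσ
  obtain ⟨ρ, s, h5, h6, h7, h8⟩ := h4 h3
  exact ⟨ρ, _, .seq h1 h5, Nat.add_le_add_right (Nat.add_le_add h2 h6) 1, h7, h8⟩

theorem Run.cond {e : Expr} (h1 : e.eval σ ≠ 0 → Run B p σ Q) (h2 : e.eval σ = 0 → Run B q σ Q) :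
    Run B (.cond e p q) σ Q := by
  intro hσ
  have hc := e.cost_le hσ
  by_cases he : e.eval σ = 0
  · obtain ⟨τ, t, h3, h4, h5, h6⟩ := h2 he hσ
    refine ⟨τ, _, .cond_false he h3, ?_, h5, h6⟩
    simp only [Program.timeBound, Nat.cast_id]
    omega
  · obtain ⟨τ, t, h3, h4, h5, h6⟩ := h1 he hσ
    refine ⟨τ, _, .cond_true he h3, ?_, h5, h6⟩
    simp only [Program.timeBound, Nat.cast_id]
    omega

/-- The loop `for x < y do p`. -/
def Program.forLoop (x y : ℕ) (p : Program) : Program :=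
  .seq (.assign x (.lit 0))
    (.loop (.sub (.var y) (.var x)) (.seq p (.assign x (.add (.var x) (.lit 1)))))

/-- `I k` is the invariant when the counter is about to be tested with value `k`, so the body has to
establish `I (k + 1)` for the state after the increment. The bound `N ≤ B` limits both the number of
rounds and the size of the counter. -/
theorem Run.forLoop {x y N : ℕ} (hy : σ.var y = N) (hN : N ≤ B) (hxp : x ∉ p.vars)
    (hyp : y ∉ insert x p.vars) (I : ℕ → State → Prop) (h0 : I 0 (σ.setVar x 0))
    (hstep : ∀ k < N, ∀ τ, τ.var x = k → Frame (.forLoop x y p) σ τ → I k τ →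
      Run B p τ fun ρ => I (k + 1) (ρ.setVar x (k + 1)))
    (hQ : ∀ τ, Frame (.forLoop x y p) σ τ → I N τ → Q τ) :
    Run B (.forLoop x y p) σ Q := by
  have hNB : N < 2 ^ B := hN.trans_lt Nat.lt_two_pow_self
  rw [mem_insert, not_or] at hyp
  have hvars : (Program.forLoop x y p).vars = insert x p.vars := by
    ext; simp [Program.forLoop, Program.vars]
  have harrs : (Program.forLoop x y p).arrs = p.arrs := by
    ext; simp [Program.forLoop, Program.arrs]
  set e : Expr := .sub (.var y) (.var x) with he
  set b : Program := .seq p (.assign x (.add (.var x) (.lit 1))) with hb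
  -- Induction on the number `d` of remaining rounds; the additional 1 in `d + 1` pays for the final
  -- failing test.
  have hloop : ∀ d k, k + d = N → ∀ τ, τ.Bounded B → τ.var x = k → Frame (.forLoop x y p) σ τ →
      I k τ → ∃ ρ t, Exec (.loop e b) τ ρ t ∧
        t ≤ (d + 1) * (e.costFactor * (B + 1) + b.timeBound B + 1) ∧ ρ.Bounded B ∧
        Frame (.forLoop x y p) σ ρ ∧ I N ρ := by
    intro d
    induction d with
    | zero =>
      intro k hk τ hτ hx hf hI
      have hyv : τ.var y = N := by
        rw [hf.1 y (by rw [hvars, mem_insert]; tauto), hy]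
      refine ⟨τ, _, Exec.loop_stop ?_, ?_, hτ, hf, ?_⟩
      · simp only [he, Expr.eval, hx, hyv]; omega
      · have := e.cost_le hτ
        rw [zero_add, one_mul]
        omega
      · rw [← hk]; exact hI
    | succ d ih =>
      intro k hk τ hτ hx hf hI
      have hyv : τ.var y = N := by
        rw [hf.1 y (by rw [hvars, mem_insert]; tauto), hy]
      have hrun : Run B b τ fun ρ => I (k + 1) ρ ∧ ρ.var x = k + 1 ∧ Frame b τ ρ := by
        refine (Run.seq (Q := fun ρ => I (k + 1) ρ ∧ ρ.var x = k + 1)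
          ((hstep k (by omega) τ hx hf hI).mono fun ρ hρ hIρ => ?_)).mono
            fun ρ h1 h2 => ⟨h2.1, h2.2, h1⟩
        have hxk : ρ.var x = k := by rw [hρ.1 x hxp, hx]
        refine Run.assign ?_ ?_
        · simp only [Expr.eval, hxk]; omega
        · simp only [Expr.eval, hxk]
          exact ⟨hIρ, by simp⟩
      obtain ⟨ρ, t, h1, h2, h3, h4, h5, h6⟩ := hrun hτ
      have hfρ : Frame (.forLoop x y p) σ ρ := by
        constructor
        · intro z hz
          rw [← hf.1 z hz]
          refine h6.1 z ?_
          rw [hvars, mem_insert] at hz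
          simp only [hb, Program.vars, mem_union, mem_singleton]
          tauto
        · intro a ha
          rw [← hf.2 a ha]
          refine h6.2 a ?_
          rw [harrs] at ha
          simpa [hb, Program.arrs] using ha
      obtain ⟨ρ', t', h7, h8, h9⟩ := ih (k + 1) (by omega) ρ h3 h5 hfρ h4
      refine ⟨ρ', _, .loop_step ?_ h1 h7, ?_, h9⟩
      · simp only [he, Expr.eval, hx, hyv]; omega
      · have := e.cost_le hτ
        rw [add_mul (d + 1)]
        omega
  refine Run.seq (Run.assign (by simp [Expr.eval]) ?_)
  have hf : Frame (.forLoop x y p) σ (σ.setVar x 0) := by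
    refine ⟨fun z hz => ?_, fun _ _ => rfl⟩
    rw [hvars, mem_insert, not_or] at hz
    rw [State.setVar_var, if_neg hz.1]
  intro hσ
  obtain ⟨ρ, t, h1, h2, h3, h4, h5⟩ := hloop N 0 (zero_add N) _ hσ (by simp [Expr.eval]) hf h0
  refine ⟨ρ, t, h1, h2.trans ?_, h3, hQ ρ h4 h5⟩
  simp only [Program.timeBound, Nat.cast_id]
  exact Nat.mul_le_mul_right _ (by omega)

end Rules

end Packing

/-! ### Parameters of the algorithm and its memory layout -/

namespace Packing

namespace Instance

variable (I : Instance)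

/-- The number of constraints of the linear program: one for each hyperedge, one for each vertex,
and one for the energy. -/
def numRows : ℕ := I.n + I.m + 1

/-- The number of steps of the multiplicative weights method. -/
def numSteps : ℕ := 12 * I.n * I.numRows

/-- The number of scaling factors that are tried. -/
def numScales : ℕ := 6 * I.numSteps * I.n

/-- An upper bound for all capacities and for the number of vertices. -/
def capBound : ℕ := 1 + I.n + ∑ j, I.cap j

/-- The constraint matrix of the linear program. -/
def rowMatrix (j v : ℕ) : ℕ :=
  if h : j < I.m then if h' : v < I.n then if ⟨v, h'⟩ ∈ I.edge ⟨j, h⟩ then 1 else 0 else 0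
  else if j < I.m + I.n then if j = I.m + v then 1 else 0
  else 1

/-- The right-hand side of the linear program with energy bound `e`. -/
def rowCap (e j : ℕ) : ℕ :=
  if h : j < I.m then I.cap ⟨j, h⟩ else if j < I.m + I.n then 1 else e

/-- The product of the denominators of the weights. -/
def denominator : ℕ := ∏ v, (I.weight v).den

/-- The weights, scaled to integers. -/
def intWeight (v : ℕ) : ℕ :=
  if h : v < I.n then (I.weight ⟨v, h⟩).num * (I.denominator / (I.weight ⟨v, h⟩).den) else 0

/-- The number with the binary digits that the coin tosses `c` provide for the vertex `v`. -/
def coinNumber (c : ℕ → ℕ) (v : ℕ) : ℕ :=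
  ∑ b ∈ range I.numScales, c (v * I.numScales + b) * 2 ^ b

/-- The constraint weights and the solution after `t` steps of the multiplicative weights method
with energy bound `e`. -/
def lpRun (e t : ℕ) : (ℕ → ℕ) × (ℕ → ℕ) :=
  mwRun I.rowMatrix I.numRows I.n (I.rowCap e) I.intWeight I.capBound t

/-- The random sample for energy bound `e` and scaling factor `2 ^ i`. -/
def sample (c : ℕ → ℕ) (e i : ℕ) : Finset (Fin I.n) :=
  univ.filter fun v => I.coinNumber c v < (I.lpRun e I.numSteps).2 v * 2 ^ i

/-- The candidate for the output that is computed for energy bound `e` and scaling factor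
`2 ^ i`. -/
def candidate (c : ℕ → ℕ) (e i : ℕ) : Finset (Fin I.n) :=
  I.altered (fun v => I.intWeight v) (I.sample c e i)

/-- `B` is an upper bound for the bit lengths and the loop lengths that occur in the algorithm. -/
structure FitsIn (B : ℕ) : Prop where
  rows : I.numRows ≤ B
  steps : I.numSteps ≤ B
  scales : I.numScales < B
  denominator : I.denominator < 2 ^ B
  dual : I.numRows * (I.capBound * I.capBound * 2 ^ I.numSteps) < 2 ^ B
  weight : ∑ v ∈ range I.n, I.intWeight v < 2 ^ B

/-- The part of the memory that does not change after the initialization, except for the energy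
bound `e`. -/
structure Ctx (c : ℕ → ℕ) (e : ℕ) (σ : State) : Prop where
  n : σ.var 0 = I.n
  m : σ.var 1 = I.m
  rows : σ.var 2 = I.numRows
  steps : σ.var 3 = I.numSteps
  scales : σ.var 4 = I.numScales
  capBound : σ.var 5 = I.capBound
  matrix : ∀ j < I.numRows, ∀ v < I.n, σ.arr 0 (j * I.n + v) = I.rowMatrix j v
  cap : ∀ j < I.numRows, σ.arr 1 j = I.rowCap e j
  weight : ∀ v < I.n, σ.arr 6 v = I.intWeight v
  coin : ∀ v < I.n, σ.arr 7 v = I.coinNumber c v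

variable {I} {B : ℕ} {c : ℕ → ℕ} {e : ℕ} {σ τ : State}

theorem rowMatrix_le_one (j v : ℕ) : I.rowMatrix j v ≤ 1 := by
  unfold rowMatrix
  split_ifs <;> simp

theorem FitsIn.n (h : I.FitsIn B) : I.n ≤ B := by
  have := h.rows; unfold numRows at this; omega

theorem FitsIn.m (h : I.FitsIn B) : I.m ≤ B := by
  have := h.rows; unfold numRows at this; omega

theorem FitsIn.intWeight_lt (h : I.FitsIn B) {v : ℕ} (hv : v < I.n) : I.intWeight v < 2 ^ B :=
  (single_le_sum_of_canonicallyOrdered (mem_range.2 hv)).trans_lt h.weight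

theorem FitsIn.lpRun_mul_lt (h : I.FitsIn B) {t : ℕ} (ht : t ≤ I.numSteps) (j : ℕ) :
    I.numRows * (I.lpRun e t).1 j < 2 ^ B := by
  refine (Nat.mul_le_mul_left _ ?_).trans_lt h.dual
  refine (mwRun_fst_le rowMatrix_le_one t j).trans ?_
  exact Nat.mul_le_mul_left _ (Nat.pow_le_pow_right two_pos ht)

theorem FitsIn.lpRun_fst_lt (h : I.FitsIn B) {t : ℕ} (ht : t ≤ I.numSteps) (j : ℕ) :
    (I.lpRun e t).1 j < 2 ^ B :=
  (Nat.le_mul_of_pos_left _ (by unfold numRows; omega)).trans_lt (h.lpRun_mul_lt ht j)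

theorem FitsIn.sum_lpRun_lt (h : I.FitsIn B) {t : ℕ} (ht : t ≤ I.numSteps) {k : ℕ}
    (hk : k ≤ I.numRows) (v : ℕ) :
    ∑ j ∈ range k, I.rowMatrix j v * (I.lpRun e t).1 j < 2 ^ B := by
  refine lt_of_le_of_lt ?_ h.dual
  calc ∑ j ∈ range k, I.rowMatrix j v * (I.lpRun e t).1 j
      ≤ ∑ j ∈ range k, I.capBound * I.capBound * 2 ^ I.numSteps := by
        refine sum_le_sum fun j _ => ?_
        have h1 := Nat.mul_le_mul_right ((I.lpRun e t).1 j) (rowMatrix_le_one (I := I) j v)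
        refine h1.trans ?_
        rw [one_mul]
        refine (mwRun_fst_le rowMatrix_le_one t j).trans ?_
        exact Nat.mul_le_mul_left _ (Nat.pow_le_pow_right two_pos ht)
    _ ≤ _ := by
        rw [sum_const, card_range, smul_eq_mul]
        exact Nat.mul_le_mul_right _ hk

/-- The context occupies the variables below 6 and the arrays 0, 1, 6 and 7, so for a concrete
program the side condition is decidable. -/
theorem Ctx.of_frame (h : I.Ctx c e σ) {p : Program} (hf : Frame p σ τ)
    (hp : (∀ x ∈ p.vars, 6 ≤ x) ∧ 0 ∉ p.arrs ∧ 1 ∉ p.arrs ∧ 6 ∉ p.arrs ∧ 7 ∉ p.arrs) :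
    I.Ctx c e τ := by
  obtain ⟨h1, h2, h3, h4, h5⟩ := hp
  have hv : ∀ x < 6, τ.var x = σ.var x := fun x hx => hf.1 x fun hx' => by
    have := h1 x hx'; omega
  constructor
  · rw [hv 0 (by norm_num), h.n]
  · rw [hv 1 (by norm_num), h.m]
  · rw [hv 2 (by norm_num), h.rows]
  · rw [hv 3 (by norm_num), h.steps]
  · rw [hv 4 (by norm_num), h.scales]
  · rw [hv 5 (by norm_num), h.capBound]
  · rw [hf.2 0 h2]; exact h.matrix
  · rw [hf.2 1 h3]; exact h.cap
  · rw [hf.2 6 h4]; exact h.weight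
  · rw [hf.2 7 h5]; exact h.coin

theorem Ctx.setVar (h : I.Ctx c e σ) {x : ℕ} (hx : 6 ≤ x) (b : ℕ) : I.Ctx c e (σ.setVar x b) := by
  have hv : ∀ y < 6, (σ.setVar x b).var y = σ.var y := fun y hy => by
    rw [State.setVar_var, if_neg (by omega)]
  constructor
  · rw [hv 0 (by norm_num), h.n]
  · rw [hv 1 (by norm_num), h.m]
  · rw [hv 2 (by norm_num), h.rows]
  · rw [hv 3 (by norm_num), h.steps]
  · rw [hv 4 (by norm_num), h.scales]
  · rw [hv 5 (by norm_num), h.capBound]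
  · exact h.matrix
  · exact h.cap
  · exact h.weight
  · exact h.coin

theorem Ctx.setArr (h : I.Ctx c e σ) {a : ℕ} (ha : a ≠ 0 ∧ a ≠ 1 ∧ a ≠ 6 ∧ a ≠ 7) (i b : ℕ) :
    I.Ctx c e (σ.setArr a i b) := by
  obtain ⟨h0, h1, h6, h7⟩ := ha
  refine ⟨h.n, h.m, h.rows, h.steps, h.scales, h.capBound, ?_, ?_, ?_, ?_⟩
  · rw [State.setArr_arr, if_neg h0.symm]; exact h.matrix
  · rw [State.setArr_arr, if_neg h1.symm]; exact h.cap
  · rw [State.setArr_arr, if_neg h6.symm]; exact h.weight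
  · rw [State.setArr_arr, if_neg h7.symm]; exact h.coin

end Instance

/-! ### The linear program -/

open Program

/-- The matrix entry in row `var 15` and column `var x`. -/
def matrixEntry (x : ℕ) : Expr := .get 0 (.add (.mul (.var 15) (.var 0)) (.var x))

/-- Computes the dual length of vertex `var 13` in variable `14`. -/
def dualLengthProg : Program :=
  .seq (.assign 14 (.lit 0)) <|
  forLoop 15 2 (.assign 14 (.add (.var 14) (.mul (matrixEntry 13) (.get 8 (.var 15)))))

/-- Computes the choice of the multiplicative weights method in variable `16`. -/
def choiceProg : Program :=
  .seq (.assign 16 (.lit 0)) <| .seq (.assign 17 (.lit 0)) <| .seq (.assign 18 (.lit 1)) <|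
  forLoop 13 0 <| .seq dualLengthProg <|
    .cond (.sub (.mul (.get 6 (.var 13)) (.var 18)) (.mul (.var 17) (.var 14)))
      (.seq (.assign 16 (.var 13)) <| .seq (.assign 17 (.get 6 (.var 13))) <|
        .assign 18 (.var 14))
      .skip

/-- One step of the multiplicative weights method. -/
def mwStepProg : Program :=
  .seq choiceProg <|
  .seq (.store 9 (.var 16) (.add (.get 9 (.var 16)) (.lit 1))) <|
  forLoop 15 2 <| .store 8 (.var 15) <| .add (.get 8 (.var 15)) <|
    .mul (matrixEntry 16) (.div (.get 8 (.var 15)) (.get 1 (.var 15)))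

/-- The multiplicative weights method: the solution is computed in array `9`. -/
def mwProg : Program :=
  .seq (forLoop 12 2 <| .store 8 (.var 12)
    (.div (.mul (.var 5) (.var 5)) (.get 1 (.var 12)))) <|
  .seq (forLoop 12 0 <| .store 9 (.var 12) (.lit 0)) <|
  forLoop 11 3 mwStepProg

namespace Instance

variable {I : Instance} {B : ℕ} {c : ℕ → ℕ} {e : ℕ} {σ τ : State}

theorem Ctx.eval_matrixEntry (h : I.Ctx c e σ) {x j v : ℕ} (hj : σ.var 15 = j)
    (hjM : j < I.numRows) (hx : σ.var x = v) (hv : v < I.n) :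
    (matrixEntry x).eval σ = I.rowMatrix j v := by
  simp only [matrixEntry, Expr.eval, hj, h.n, hx]
  exact h.matrix j hjM v hv

theorem run_dualLengthProg (hB : I.FitsIn B) (h : I.Ctx c e σ) {v t : ℕ} (hv : σ.var 13 = v)
    (hvn : v < I.n) (ht : t ≤ I.numSteps) (hY : ∀ j < I.numRows, σ.arr 8 j = (I.lpRun e t).1 j) :
    Run B dualLengthProg σ fun τ =>
      τ.var 14 = dualLength I.rowMatrix I.numRows (I.lpRun e t).1 v := by
  refine Run.seq (Run.assign (by simp [Expr.eval]) ?_)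
  refine Run.forLoop (N := I.numRows) (by simp [h.rows]) hB.rows (by decide) (by decide)
    (fun k τ => τ.var 14 = ∑ j ∈ range k, I.rowMatrix j v * (I.lpRun e t).1 j)
    (by simp [Expr.eval]) ?_ fun τ _ h14 => h14
  intro k hk τ h15 hf h14
  have hc : I.Ctx c e τ := (h.setVar (by norm_num) _).of_frame hf (by decide)
  have hv' : τ.var 13 = v := by rw [hf.1 13 (by decide)]; simpa using hv
  have h8 : τ.arr 8 k = (I.lpRun e t).1 k := by rw [hf.2 8 (by decide)]; exact hY k hk
  have heval : (Expr.add (.var 14) (.mul (matrixEntry 13) (.get 8 (.var 15)))).eval τ =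
      ∑ j ∈ range (k + 1), I.rowMatrix j v * (I.lpRun e t).1 j := by
    rw [sum_range_succ]
    simp only [Expr.eval, hc.eval_matrixEntry h15 hk hv' hvn, h14, h15, h8]
  refine Run.assign ?_ ?_
  · rw [heval]
    exact hB.sum_lpRun_lt ht hk v
  · simp [heval]

theorem run_choiceProg (hB : I.FitsIn B) (h : I.Ctx c e σ) {t : ℕ} (ht : t ≤ I.numSteps)
    (hY : ∀ j < I.numRows, σ.arr 8 j = (I.lpRun e t).1 j) :
    Run B choiceProg σ fun τ =>
      τ.var 16 = mwChoice I.rowMatrix I.numRows I.n I.intWeight (I.lpRun e t).1 := by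
  set len := dualLength I.rowMatrix I.numRows (I.lpRun e t).1 with hlen
  have h1B : 1 < 2 ^ B := Nat.one_lt_two_pow (by have := hB.rows; unfold numRows at this; omega)
  refine Run.seq (Run.assign (by simp [Expr.eval]) ?_)
  refine Run.seq (Run.assign (by simp [Expr.eval]) ?_)
  refine Run.seq (Run.assign (by simpa [Expr.eval] using h1B) ?_)
  have hc : I.Ctx c e ((((σ.setVar 16 0).setVar 17 0).setVar 18 1)) :=
    ((h.setVar (by norm_num) _).setVar (by norm_num) _).setVar (by norm_num) _
  refine Run.forLoop (N := I.n) (by simp [h.n]) hB.n (by decide) (by decide)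
    (fun k τ => τ.var 16 = (bestRatio I.intWeight len k).1 ∧
      τ.var 17 = (bestRatio I.intWeight len k).2.1 ∧
      τ.var 18 = (bestRatio I.intWeight len k).2.2)
    (by simp [Expr.eval, bestRatio]) ?_ fun τ _ h14 => h14.1
  intro k hk τ h13 hf hI
  obtain ⟨h16, h17, h18⟩ := hI
  have hcτ : I.Ctx c e τ := hc.of_frame hf (by decide)
  have hY' : ∀ j < I.numRows, τ.arr 8 j = (I.lpRun e t).1 j := by
    rw [hf.2 8 (by decide)]; exact hY
  refine Run.seq ((run_dualLengthProg hB hcτ h13 hk ht hY').mono fun ρ hρ h14 => ?_)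
  rw [← hlen] at h14
  have hcρ : I.Ctx c e ρ := hcτ.of_frame hρ (by decide)
  have h13' : ρ.var 13 = k := by rw [hρ.1 13 (by decide), h13]
  have h16' := (hρ.1 16 (by decide)).trans h16
  have h17' := (hρ.1 17 (by decide)).trans h17
  have h18' := (hρ.1 18 (by decide)).trans h18
  have hw := hcρ.weight k hk
  have hlenB : len k < 2 ^ B := hB.sum_lpRun_lt ht le_rfl k
  refine Run.cond (fun hne => ?_) fun he => ?_
  · simp only [Expr.eval, h13', h14, h17', h18', hw] at hne
    refine Run.seq (Run.assign ?_ (Run.seq (Run.assign ?_ (Run.assign ?_ ?_))))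
    · simp only [Expr.eval, h13']
      have := hB.n
      exact (hk.le.trans this).trans_lt Nat.lt_two_pow_self
    · simpa [Expr.eval, h13', hw] using hB.intWeight_lt hk
    · simpa [Expr.eval, h14] using hlenB
    -- A truncated difference is nonzero exactly when the strict comparison holds.
    · rw [bestRatio, if_pos (by omega)]
      simp [Expr.eval, h13', h14, hw]
  · simp only [Expr.eval, h13', h14, h17', h18', hw] at he
    refine Run.skip ?_
    rw [bestRatio, if_neg (by omega)]
    simp [h16', h17', h18']

theorem run_mwStepProg (hB : I.FitsIn B) (h : I.Ctx c e σ) (hn : 0 < I.n) {t : ℕ}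
    (ht : t < I.numSteps) (hY : ∀ j < I.numRows, σ.arr 8 j = (I.lpRun e t).1 j)
    (hz : ∀ v < I.n, σ.arr 9 v = (I.lpRun e t).2 v) :
    Run B mwStepProg σ fun τ => (∀ j < I.numRows, τ.arr 8 j = (I.lpRun e (t + 1)).1 j) ∧
      ∀ v < I.n, τ.arr 9 v = (I.lpRun e (t + 1)).2 v := by
  refine Run.seq ((run_choiceProg hB h ht.le hY).mono fun ρ hρ h16 => ?_)
  set b := mwChoice I.rowMatrix I.numRows I.n I.intWeight (I.lpRun e t).1 with hb
  have hbn : b < I.n := mwChoice_lt hn _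
  have hcρ : I.Ctx c e ρ := h.of_frame hρ (by decide)
  have hz' : ∀ v < I.n, ρ.arr 9 v = (I.lpRun e t).2 v := by
    rw [hρ.2 9 (by decide)]; exact hz
  have hY' : ∀ j < I.numRows, ρ.arr 8 j = (I.lpRun e t).1 j := by
    rw [hρ.2 8 (by decide)]; exact hY
  have hzt : (I.lpRun e t).2 b ≤ t := mwRun_snd_le t b
  refine Run.seq (Run.store ?_ ?_)
  · simp only [Expr.eval, h16, hz' b hbn]
    exact (show _ ≤ B by have := hB.steps; omega).trans_lt Nat.lt_two_pow_self
  simp only [Expr.eval, h16, hz' b hbn]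
  set ρ' := ρ.setArr 9 b ((I.lpRun e t).2 b + 1) with hρ'
  have hcρ' : I.Ctx c e ρ' := hcρ.setArr (by decide) _ _
  -- The weights may be overwritten in place: the choice is already fixed, and the update of a row
  -- reads only its own weight. After `k` rounds the rows below `k` are new and the others old.
  refine Run.forLoop (N := I.numRows) hcρ'.rows hB.rows (by decide) (by decide)
    (fun k τ => ∀ j < I.numRows, τ.arr 8 j =
      if j < k then (I.lpRun e (t + 1)).1 j else (I.lpRun e t).1 j) ?_ ?_ ?_
  · intro j hj
    simpa [hρ'] using hY' j hj
  · intro k hk τ h15 hf hI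
    have hcτ : I.Ctx c e τ := hcρ'.of_frame hf (by decide)
    have h16τ : τ.var 16 = b := by rw [hf.1 16 (by decide)]; exact h16
    have h8k := hI k hk
    rw [if_neg (lt_irrefl k)] at h8k
    have heval : (Expr.add (.get 8 (.var 15))
        (.mul (matrixEntry 16) (.div (.get 8 (.var 15)) (.get 1 (.var 15))))).eval τ =
        (I.lpRun e (t + 1)).1 k := by
      simp only [Expr.eval, hcτ.eval_matrixEntry h15 hk h16τ hbn, h15, h8k, hcτ.cap k hk]
      rfl
    refine Run.store ?_ ?_
    · rw [heval]
      exact hB.lpRun_fst_lt ht k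
    · intro j hj
      rw [heval]
      simp only [State.setVar_arr, State.setArr_arr, if_true, Expr.eval, h15,
        Function.update_apply]
      by_cases hjk : j = k
      · simp [hjk]
      · rw [if_neg hjk, hI j hj]
        have : j < k ↔ j < k + 1 := by omega
        simp only [this]
  · intro τ hf hI
    refine ⟨fun j hj => by rw [hI j hj, if_pos hj], fun v hv => ?_⟩
    rw [hf.2 9 (by decide)]
    simp only [hρ', State.setArr_arr, if_true, Function.update_apply]
    simp only [lpRun, mwRun, mwStep, Function.update_apply]
    rw [← lpRun, ← hb]
    split_ifs
    · rfl
    · exact hz' v hv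

theorem run_mwProg (hB : I.FitsIn B) (h : I.Ctx c e σ) (hn : 0 < I.n) :
    Run B mwProg σ fun τ => ∀ v < I.n, τ.arr 9 v = (I.lpRun e I.numSteps).2 v := by
  refine Run.seq ?_
  refine Run.forLoop (N := I.numRows) h.rows hB.rows (by decide) (by decide)
    (fun k τ => ∀ j < k, τ.arr 8 j = (I.lpRun e 0).1 j) (by simp) ?_ fun τ hf hY => ?_
  · intro k hk τ h12 hf hI
    have hcτ : I.Ctx c e τ := h.of_frame hf (by decide)
    have heval : (Expr.div (.mul (.var 5) (.var 5)) (.get 1 (.var 12))).eval τ =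
        (I.lpRun e 0).1 k := by
      simp only [Expr.eval, h12, hcτ.capBound, hcτ.cap k hk]
      rfl
    refine Run.store ?_ ?_
    · rw [heval]
      exact hB.lpRun_fst_lt (Nat.zero_le _) k
    · intro j hj
      rw [heval]
      simp only [State.setVar_arr, State.setArr_arr, if_true, Expr.eval, h12,
        Function.update_apply]
      split_ifs with hjk
      · rw [hjk]
      · exact hI j (by omega)
  have hcτ : I.Ctx c e τ := h.of_frame hf (by decide)
  refine Run.seq ?_
  refine Run.forLoop (N := I.n) hcτ.n hB.n (by decide) (by decide)
    (fun k τ => ∀ v < k, τ.arr 9 v = (I.lpRun e 0).2 v) (by simp) ?_ fun ρ hfρ hz => ?_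
  · intro k hk τ h12 hf hI
    refine Run.store (by simp [Expr.eval]) ?_
    intro j hj
    simp only [State.setVar_arr, State.setArr_arr, if_true, Expr.eval, h12,
      Function.update_apply]
    split_ifs with hjk
    · rfl
    · exact hI j (by omega)
  have hcρ : I.Ctx c e ρ := hcτ.of_frame hfρ (by decide)
  refine Run.forLoop (N := I.numSteps) hcρ.steps hB.steps (by decide) (by decide)
    (fun t τ => (∀ j < I.numRows, τ.arr 8 j = (I.lpRun e t).1 j) ∧
      ∀ v < I.n, τ.arr 9 v = (I.lpRun e t).2 v) ⟨?_, hz⟩ ?_ fun τ _ hτ => hτ.2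
  · intro j hj
    rw [State.setVar_arr, hfρ.2 8 (by decide)]
    exact hY j hj
  · intro t ht τ _ hf hI
    exact run_mwStepProg hB (hcρ.of_frame hf (by decide)) hn ht hI.1 hI.2

end Instance

end Packing

namespace Packing

/-! ### Rounding -/

open Program

/-- Computes the indicator function of the sample in array `10`. -/
def sampleProg : Program :=
  forLoop 12 0 <| .cond (.sub (.mul (.get 9 (.var 12)) (.var 9)) (.get 7 (.var 12)))
    (.store 10 (.var 12) (.lit 1)) (.store 10 (.var 12) (.lit 0))

/-- The position in the linear order of the vertices for the vertex `var x`. -/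
def keyExpr (x : ℕ) : Expr := .add (.mul (.get 6 (.var x)) (.var 0)) (.var x)

/-- Counts in variable `14` the sampled vertices of hyperedge `var 15` that do not come after the
vertex `var 13`. -/
def countProg : Program :=
  .seq (.assign 14 (.lit 0)) <|
  forLoop 12 0 <| .cond (.sub (.add (keyExpr 12) (.lit 1)) (keyExpr 13))
    (.assign 14 (.add (.var 14) (.mul (.get 10 (.var 12)) (matrixEntry 12)))) .skip

/-- Decides in variable `16` whether the vertex `var 13` is kept. -/
def keepProg : Program :=
  .seq (.assign 16 (.get 10 (.var 13))) <|
  forLoop 15 1 <| .seq countProg <|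
    .cond (.mul (.sub (.var 14) (.get 1 (.var 15))) (matrixEntry 13)) (.assign 16 (.lit 0)) .skip

/-- Computes the indicator function of the altered sample in array `11`, and its weight in
variable `17`. -/
def alterProg : Program :=
  .seq (.assign 17 (.lit 0)) <|
  forLoop 13 0 <| .seq keepProg <| .seq (.store 11 (.var 13) (.var 16)) <|
    .assign 17 (.add (.var 17) (.mul (.var 16) (.get 6 (.var 13))))

/-- Replaces the output by the altered sample if this has a larger weight. -/
def updateProg : Program :=
  .cond (.sub (.var 17) (.var 10))
    (.seq (.assign 10 (.var 17)) <| forLoop 12 0 <| .store 5 (.var 12) (.get 11 (.var 12)))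
    .skip

/-- Tries one scaling factor. -/
def roundProg : Program := .seq sampleProg <| .seq alterProg updateProg

/-- Tries all scaling factors. -/
def scaleProg : Program :=
  .seq (.assign 9 (.lit 1)) <|
  forLoop 8 4 <| .seq roundProg <| .assign 9 (.mul (.lit 2) (.var 9))

/-- Tries all energy bounds. -/
def energyProg : Program :=
  forLoop 7 0 <| .seq (.store 1 (.add (.var 1) (.var 0)) (.add (.var 7) (.lit 1))) <|
    .seq mwProg scaleProg

namespace Instance

variable {I : Instance} {B : ℕ} {c : ℕ → ℕ} {e : ℕ} {σ τ : State}

/-- The indicator function of a set of vertices. -/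
def indicator (X : Finset (Fin I.n)) (v : ℕ) : ℕ := if ∃ h : v < I.n, ⟨v, h⟩ ∈ X then 1 else 0

theorem indicator_coe (X : Finset (Fin I.n)) (v : Fin I.n) :
    indicator X v = if v ∈ X then 1 else 0 := by
  simp [indicator]

theorem indicator_le_one (X : Finset (Fin I.n)) (v : ℕ) : indicator X v ≤ 1 := by
  unfold indicator
  split_ifs <;> simp

variable (I) in
/-- The scaled weight of a set of vertices. -/
def value (X : Finset (Fin I.n)) : ℕ := ∑ v ∈ X, I.intWeight v

theorem sum_indicator_mul (X : Finset (Fin I.n)) :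
    ∑ v ∈ range I.n, indicator X v * I.intWeight v = I.value X := by
  rw [Finset.sum_range, value]
  simp [indicator_coe]

theorem value_le (X : Finset (Fin I.n)) : I.value X ≤ ∑ v ∈ range I.n, I.intWeight v := by
  rw [← sum_indicator_mul]
  refine sum_le_sum fun v _ => ?_
  have := Nat.mul_le_mul_right (I.intWeight v) (indicator_le_one X v)
  omega

variable (I) in
/-- Array `5` holds a packing, and variable `10` its weight. -/
def Stored (σ : State) : Prop :=
  ∃ X : Finset (Fin I.n), I.IsPacking X ∧ (∀ v : Fin I.n, v ∈ X ↔ σ.arr 5 v ≠ 0) ∧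
    σ.var 10 = I.value X

theorem Stored.congr (h : I.Stored σ) (h5 : τ.arr 5 = σ.arr 5) (h10 : τ.var 10 = σ.var 10) :
    I.Stored τ := by
  obtain ⟨X, h1, h2, h3⟩ := h
  exact ⟨X, h1, by rw [h5]; exact h2, by rw [h10]; exact h3⟩

theorem FitsIn.one_lt (hB : I.FitsIn B) : 1 < 2 ^ B :=
  Nat.one_lt_two_pow (by have := hB.rows; unfold numRows at this; omega)

theorem run_sampleProg (hB : I.FitsIn B) (h : I.Ctx c e σ) {i : ℕ} (hF : σ.var 9 = 2 ^ i)
    (hz : ∀ v < I.n, σ.arr 9 v = (I.lpRun e I.numSteps).2 v) :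
    Run B sampleProg σ fun τ => ∀ v < I.n, τ.arr 10 v = indicator (I.sample c e i) v := by
  refine Run.forLoop (N := I.n) h.n hB.n (by decide) (by decide)
    (fun k τ => ∀ v < k, τ.arr 10 v = indicator (I.sample c e i) v) (by simp) ?_
    fun τ _ hτ => hτ
  intro k hk τ h12 hf hI
  have hc : I.Ctx c e τ := h.of_frame hf (by decide)
  have h9 : τ.var 9 = 2 ^ i := by rw [hf.1 9 (by decide)]; exact hF
  have hzk : τ.arr 9 k = (I.lpRun e I.numSteps).2 k := by rw [hf.2 9 (by decide)]; exact hz k hk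
  have hstep : ∀ b, b = indicator (I.sample c e i) k → ∀ v < k + 1,
      (Function.update (τ.arr 10) k b) v = indicator (I.sample c e i) v := by
    intro b hb v hv
    rw [Function.update_apply]
    split_ifs with hvk
    · rw [hvk, hb]
    · exact hI v (by omega)
  have hmem : ⟨k, hk⟩ ∈ I.sample c e i ↔
      I.coinNumber c k < (I.lpRun e I.numSteps).2 k * 2 ^ i := by simp [sample]
  have hind := indicator_coe (I.sample c e i) ⟨k, hk⟩
  simp only [hmem] at hind
  refine Run.cond (fun hne => ?_) fun heq => ?_
  · simp only [Expr.eval, h12, h9, hzk, hc.coin k hk] at hne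
    refine Run.store (by simpa [Expr.eval] using hB.one_lt) ?_
    simp only [State.setVar_arr, State.setArr_arr, if_true, Expr.eval, h12]
    exact hstep 1 (by rw [hind, if_pos (by omega)])
  · simp only [Expr.eval, h12, h9, hzk, hc.coin k hk] at heq
    refine Run.store (by simp [Expr.eval]) ?_
    simp only [State.setVar_arr, State.setArr_arr, if_true, Expr.eval, h12]
    exact hstep 0 (by rw [hind, if_neg (by omega)])

theorem Ctx.eval_keyExpr (h : I.Ctx c e σ) {x v : ℕ} (hx : σ.var x = v) (hv : v < I.n) :
    (keyExpr x).eval σ = I.intWeight v * I.n + v := by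
  simp only [keyExpr, Expr.eval, hx, h.n, h.weight v hv]

theorem rowMatrix_coe (j : Fin I.m) (v : Fin I.n) :
    I.rowMatrix j v = if v ∈ I.edge j then 1 else 0 := by
  simp [rowMatrix]

theorem run_countProg (hB : I.FitsIn B) (h : I.Ctx c e σ) {R : Finset (Fin I.n)}
    (hR : ∀ v < I.n, σ.arr 10 v = indicator R v) {v : Fin I.n} (hv : σ.var 13 = v)
    {j : Fin I.m} (hj : σ.var 15 = j) :
    Run B countProg σ fun τ => τ.var 14 = ((R ∩ I.edge j).filter fun u =>
      I.rankKey (fun v => I.intWeight v) v ≤ I.rankKey (fun v => I.intWeight v) u).card := by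
  have hjM : (j : ℕ) < I.numRows := by have := j.2; unfold numRows; omega
  set f : ℕ → ℕ := fun u => if I.intWeight v * I.n + v ≤ I.intWeight u * I.n + u then
    indicator R u * I.rowMatrix j u else 0 with hf
  have hf1 : ∀ u, f u ≤ 1 := fun u => by
    have := Nat.mul_le_mul (indicator_le_one R u) (rowMatrix_le_one (I := I) j u)
    simp only [hf]
    split_ifs <;> omega
  refine Run.seq (Run.assign (by simp [Expr.eval]) ?_)
  refine Run.forLoop (N := I.n) (by simp [h.n]) hB.n (by decide) (by decide)
    (fun k τ => τ.var 14 = ∑ u ∈ range k, f u) (by simp [Expr.eval]) ?_ fun τ _ h14 => ?_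
  · intro k hk τ h12 hfr h14
    have hc : I.Ctx c e τ := (h.setVar (by norm_num) _).of_frame hfr (by decide)
    have h13 : τ.var 13 = v := by rw [hfr.1 13 (by decide)]; simpa using hv
    have h15 : τ.var 15 = j := by rw [hfr.1 15 (by decide)]; simpa using hj
    have h10 : τ.arr 10 k = indicator R k := by
      rw [hfr.2 10 (by decide)]; simpa using hR k hk
    refine Run.cond (fun hne => ?_) fun heq => ?_
    · simp only [Expr.eval, hc.eval_keyExpr h12 hk, hc.eval_keyExpr h13 v.2] at hne
      have heval : (Expr.add (.var 14) (.mul (.get 10 (.var 12)) (matrixEntry 12))).eval τ =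
          ∑ u ∈ range (k + 1), f u := by
        rw [sum_range_succ]
        simp only [Expr.eval, hc.eval_matrixEntry h15 hjM h12 hk, h14, h12, h10, hf]
        rw [if_pos (by omega)]
      refine Run.assign ?_ (by simp [heval])
      rw [heval]
      refine lt_of_le_of_lt (sum_le_sum fun u _ => hf1 u) ?_
      rw [sum_const, card_range, smul_eq_mul, mul_one]
      exact (show k + 1 ≤ B by have := hB.n; omega).trans_lt Nat.lt_two_pow_self
    · simp only [Expr.eval, hc.eval_keyExpr h12 hk, hc.eval_keyExpr h13 v.2] at heq
      refine Run.skip ?_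
      rw [sum_range_succ]
      simp only [State.setVar_var, hf]
      rw [if_neg (by omega), if_neg (by omega), add_zero]
      exact h14
  · rw [h14, Finset.sum_range, card_eq_sum_ones, sum_filter, ← univ_inter (R ∩ I.edge j),
      ← sum_ite_mem]
    refine sum_congr rfl fun u _ => ?_
    simp only [hf, indicator_coe, rowMatrix_coe, rankKey, mem_inter]
    by_cases h1 : u ∈ R <;> by_cases h2 : u ∈ I.edge j <;> simp [h1, h2]
    congr

/-- The flag starts as membership in the sample and can only be cleared. The matrix entry in the
test silences the hyperedges that do not contain `v`. -/
theorem run_keepProg (hB : I.FitsIn B) (h : I.Ctx c e σ) {R : Finset (Fin I.n)}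
    (hR : ∀ v < I.n, σ.arr 10 v = indicator R v) {v : Fin I.n} (hv : σ.var 13 = v) :
    Run B keepProg σ fun τ =>
      τ.var 16 = indicator (I.altered (fun v => I.intWeight v) R) v := by
  set cnt : Fin I.m → ℕ := fun j => ((R ∩ I.edge j).filter fun u =>
      I.rankKey (fun v => I.intWeight v) v ≤ I.rankKey (fun v => I.intWeight v) u).card with hcnt
  have hRv := hR v v.2
  refine Run.seq (Run.assign ?_ ?_)
  · simp only [Expr.eval, hv, hRv]
    exact (indicator_le_one R v).trans_lt hB.one_lt
  refine Run.forLoop (N := I.m) (by simp [h.m]) hB.m (by decide) (by decide)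
    (fun k τ => τ.var 16 = if v ∈ R ∧ ∀ j : Fin I.m, (j : ℕ) < k → v ∈ I.edge j →
      cnt j ≤ I.cap j then 1 else 0) ?_ ?_ fun τ _ h16 => ?_
  · simp [Expr.eval, hv, hRv, indicator_coe]
  · intro k hk τ h15 hfr h16
    have hc : I.Ctx c e τ := (h.setVar (by norm_num) _).of_frame hfr (by decide)
    have h13 : τ.var 13 = v := by rw [hfr.1 13 (by decide)]; simpa using hv
    have hR' : ∀ v < I.n, τ.arr 10 v = indicator R v := by
      rw [hfr.2 10 (by decide)]; simpa using hR
    refine Run.seq ((run_countProg hB hc hR' h13 (j := ⟨k, hk⟩) h15).mono fun ρ hρ h14 => ?_)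
    have hcρ : I.Ctx c e ρ := hc.of_frame hρ (by decide)
    have h13' : ρ.var 13 = v := by rw [hρ.1 13 (by decide), h13]
    have h15' : ρ.var 15 = k := by rw [hρ.1 15 (by decide), h15]
    have h16' := (hρ.1 16 (by decide)).trans h16
    have hkM : k < I.numRows := by unfold numRows; omega
    have hcap : ρ.arr 1 k = I.cap ⟨k, hk⟩ := by
      rw [hcρ.cap k hkM]
      simp [rowCap, hk]
    have hmat : I.rowMatrix k v = if v ∈ I.edge ⟨k, hk⟩ then 1 else 0 := rowMatrix_coe ⟨k, hk⟩ v
    have hiff : (∀ j : Fin I.m, (j : ℕ) < k + 1 → v ∈ I.edge j → cnt j ≤ I.cap j) ↔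
        (∀ j : Fin I.m, (j : ℕ) < k → v ∈ I.edge j → cnt j ≤ I.cap j) ∧
          (v ∈ I.edge ⟨k, hk⟩ → cnt ⟨k, hk⟩ ≤ I.cap ⟨k, hk⟩) := by
      refine ⟨fun h => ⟨fun j hj => h j (by omega), h ⟨k, hk⟩ (by simp)⟩, fun h j hj => ?_⟩
      rcases Nat.lt_succ_iff_lt_or_eq.1 hj with hj | hj
      · exact h.1 j hj
      · have : j = ⟨k, hk⟩ := Fin.ext hj
        rw [this]
        exact h.2
    refine Run.cond (fun hne => ?_) fun heq => ?_
    · simp only [Expr.eval, hcρ.eval_matrixEntry h15' hkM h13' v.2, h14, h15', hcap, hmat] at hne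
      refine Run.assign (by simp [Expr.eval]) ?_
      have h1 : ¬ (v ∈ I.edge ⟨k, hk⟩ → cnt ⟨k, hk⟩ ≤ I.cap ⟨k, hk⟩) := by
        intro h2
        by_cases h3 : v ∈ I.edge ⟨k, hk⟩
        · have h4 := h2 h3
          simp only [hcnt] at h4
          exact hne (by rw [Nat.sub_eq_zero_of_le h4, zero_mul])
        · exact hne (by simp [h3])
      have h2 : ¬ (v ∈ R ∧ ∀ j : Fin I.m, (j : ℕ) < k + 1 → v ∈ I.edge j → cnt j ≤ I.cap j) := by
        rw [hiff]
        tauto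
      rw [if_neg h2]
      simp [Expr.eval]
    · simp only [Expr.eval, hcρ.eval_matrixEntry h15' hkM h13' v.2, h14, h15', hcap, hmat] at heq
      refine Run.skip ?_
      have h1 : v ∈ I.edge ⟨k, hk⟩ → cnt ⟨k, hk⟩ ≤ I.cap ⟨k, hk⟩ := by
        intro h3
        rw [if_pos h3, mul_one] at heq
        exact Nat.sub_eq_zero_iff_le.1 heq
      rw [State.setVar_var, if_neg (by norm_num), h16']
      refine if_congr ?_ rfl rfl
      rw [hiff]
      tauto
  · rw [h16, indicator_coe]
    refine if_congr ?_ rfl rfl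
    simp only [altered, mem_filter, Fin.is_lt, true_imp_iff, hcnt]

theorem run_alterProg (hB : I.FitsIn B) (h : I.Ctx c e σ) {R : Finset (Fin I.n)}
    (hR : ∀ v < I.n, σ.arr 10 v = indicator R v) :
    Run B alterProg σ fun τ => (∀ v < I.n, τ.arr 11 v =
        indicator (I.altered (fun v => I.intWeight v) R) v) ∧
      τ.var 17 = I.value (I.altered (fun v => I.intWeight v) R) := by
  set X := I.altered (fun v => I.intWeight v) R with hX
  refine Run.seq (Run.assign (by simp [Expr.eval]) ?_)
  refine Run.forLoop (N := I.n) (by simp [h.n]) hB.n (by decide) (by decide)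
    (fun k τ => (∀ v < k, τ.arr 11 v = indicator X v) ∧
      τ.var 17 = ∑ v ∈ range k, indicator X v * I.intWeight v) (by simp [Expr.eval]) ?_
    fun τ _ hτ => ⟨hτ.1, hτ.2.trans (sum_indicator_mul X)⟩
  intro k hk τ h13 hfr hI
  have hc : I.Ctx c e τ := (h.setVar (by norm_num) _).of_frame hfr (by decide)
  have hR' : ∀ v < I.n, τ.arr 10 v = indicator R v := by
    rw [hfr.2 10 (by decide)]; simpa using hR
  refine Run.seq ((run_keepProg hB hc hR' (v := ⟨k, hk⟩) h13).mono fun ρ hρ h16 => ?_)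
  rw [← hX] at h16
  have hcρ : I.Ctx c e ρ := hc.of_frame hρ (by decide)
  have h13' : ρ.var 13 = k := by rw [hρ.1 13 (by decide), h13]
  have h17' : ρ.var 17 = _ := (hρ.1 17 (by decide)).trans hI.2
  have h11' : ∀ v < k, ρ.arr 11 v = indicator X v := by
    rw [hρ.2 11 (by decide)]; exact hI.1
  have heval : ρ.var 17 + ρ.var 16 * ρ.arr 6 (ρ.var 13) =
      ∑ v ∈ range (k + 1), indicator X v * I.intWeight v := by
    rw [h17', h16, h13', hcρ.weight k hk, sum_range_succ]
  refine Run.seq (Run.store ?_ (Run.assign ?_ ⟨?_, ?_⟩))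
  · simp only [Expr.eval, h16]
    exact (indicator_le_one X k).trans_lt hB.one_lt
  · simp only [Expr.eval, State.setArr_var, State.setArr_arr]
    rw [if_neg (by norm_num), heval]
    refine lt_of_le_of_lt ?_ ((value_le X).trans_lt hB.weight)
    rw [← sum_indicator_mul]
    exact sum_le_sum_of_subset (range_subset_range.2 hk)
  · intro v hv
    simp only [State.setVar_arr, State.setArr_arr, if_true, Expr.eval, h13', h16,
      Function.update_apply]
    split_ifs with hvk
    · rw [hvk]
    · exact h11' v (by omega)
  · simpa [Expr.eval] using heval

/-- Variable `10` never decreases, so the final output dominates every candidate for the same coin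
tosses. -/
theorem run_updateProg (hB : I.FitsIn B) (h : I.Ctx c e σ) {X : Finset (Fin I.n)}
    (hX : I.IsPacking X) (h11 : ∀ v < I.n, σ.arr 11 v = indicator X v)
    (h17 : σ.var 17 = I.value X) (hσ : I.Stored σ) :
    Run B updateProg σ fun τ => I.Stored τ ∧ σ.var 10 ≤ τ.var 10 ∧ I.value X ≤ τ.var 10 := by
  refine Run.cond (fun hne => ?_) fun heq => ?_
  · simp only [Expr.eval, h17] at hne
    refine Run.seq (Run.assign ?_ ?_)
    · simp only [Expr.eval, h17]
      exact (value_le X).trans_lt hB.weight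
    refine Run.forLoop (N := I.n) (by simp [h.n]) hB.n (by decide) (by decide)
      (fun k τ => ∀ v < k, τ.arr 5 v = indicator X v) (by simp) ?_ fun τ hfr hτ => ?_
    · intro k hk τ h12 hfr hI
      have h11' : τ.arr 11 k = indicator X k := by
        rw [hfr.2 11 (by decide)]; simpa using h11 k hk
      refine Run.store ?_ ?_
      · simp only [Expr.eval, h12, h11']
        exact (indicator_le_one X k).trans_lt hB.one_lt
      · intro v hv
        simp only [State.setVar_arr, State.setArr_arr, if_true, Expr.eval, h12, h11',
          Function.update_apply]
        split_ifs with hvk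
        · rw [hvk]
        · exact hI v (by omega)
    · have h10 : τ.var 10 = I.value X := by
        rw [hfr.1 10 (by decide)]; simp [Expr.eval, h17]
      refine ⟨⟨X, hX, fun v => ?_, h10⟩, by omega, h10.ge⟩
      rw [hτ v v.2, indicator_coe]
      simp
  · simp only [Expr.eval, h17] at heq
    exact Run.skip ⟨hσ, le_rfl, by omega⟩

theorem run_roundProg (hB : I.FitsIn B) (h : I.Ctx c e σ) {i : ℕ} (hF : σ.var 9 = 2 ^ i)
    (hz : ∀ v < I.n, σ.arr 9 v = (I.lpRun e I.numSteps).2 v) (hσ : I.Stored σ) :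
    Run B roundProg σ fun τ => I.Stored τ ∧ σ.var 10 ≤ τ.var 10 ∧
      I.value (I.candidate c e i) ≤ τ.var 10 := by
  refine Run.seq ((run_sampleProg hB h hF hz).mono fun τ hf h10 => ?_)
  have hc : I.Ctx c e τ := h.of_frame hf (by decide)
  refine Run.seq ((run_alterProg hB hc h10).mono fun ρ hρ h11 => ?_)
  have hcρ : I.Ctx c e ρ := hc.of_frame hρ (by decide)
  have h1 : ρ.var 10 = σ.var 10 := (hρ.1 10 (by decide)).trans (hf.1 10 (by decide))
  have h2 : ρ.arr 5 = σ.arr 5 := (hρ.2 5 (by decide)).trans (hf.2 5 (by decide))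
  refine (run_updateProg hB hcρ (isPacking_altered _ _) h11.1 h11.2 (hσ.congr h2 h1)).mono
    fun π _ hπ => ?_
  rw [← h1]
  exact hπ

theorem run_scaleProg (hB : I.FitsIn B) (h : I.Ctx c e σ)
    (hz : ∀ v < I.n, σ.arr 9 v = (I.lpRun e I.numSteps).2 v) (hσ : I.Stored σ) :
    Run B scaleProg σ fun τ => I.Stored τ ∧ σ.var 10 ≤ τ.var 10 ∧
      ∀ i < I.numScales, I.value (I.candidate c e i) ≤ τ.var 10 := by
  refine Run.seq (Run.assign (by simpa [Expr.eval] using hB.one_lt) ?_)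
  refine Run.forLoop (N := I.numScales) (by simp [h.scales]) hB.scales.le (by decide) (by decide)
    (fun k τ => τ.var 9 = 2 ^ k ∧ I.Stored τ ∧ σ.var 10 ≤ τ.var 10 ∧
      ∀ i < k, I.value (I.candidate c e i) ≤ τ.var 10) ?_ ?_ fun τ _ hτ => hτ.2
  · exact ⟨by simp [Expr.eval], hσ.congr rfl (by simp), by simp, by simp⟩
  · intro k hk τ _ hf ⟨h9, hst, h10, hcand⟩
    have hc : I.Ctx c e τ := (h.setVar (by norm_num) _).of_frame hf (by decide)
    have hz' : ∀ v < I.n, τ.arr 9 v = (I.lpRun e I.numSteps).2 v := by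
      rw [hf.2 9 (by decide)]; exact hz
    refine Run.seq ((run_roundProg hB hc h9 hz' hst).mono fun ρ hρ ⟨h1, h2, h3⟩ => ?_)
    have h9' : ρ.var 9 = 2 ^ k := by rw [hρ.1 9 (by decide), h9]
    refine Run.assign ?_ ⟨?_, h1.congr rfl (by simp), ?_, fun i hi => ?_⟩
    · simp only [Expr.eval, h9', ← pow_succ']
      -- The scaling factor is doubled once more after the last round, which is why `FitsIn.scales`
      -- is strict.
      exact Nat.pow_lt_pow_right one_lt_two (by have := hB.scales; omega)
    · simp [Expr.eval, h9', pow_succ']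
    · simpa using h10.trans h2
    · simp only [State.setVar_var]
      norm_num
      rcases Nat.lt_succ_iff_lt_or_eq.1 hi with hi | rfl
      · exact (hcand i hi).trans h2
      · exact h3

/-- The energy bound occurs only as the capacity of row `m + n`, so a single write switches to
another linear program. -/
theorem Ctx.setEnergy (h : I.Ctx c e σ) (e' : ℕ) :
    I.Ctx c e' (σ.setArr 1 (I.m + I.n) e') := by
  refine ⟨h.n, h.m, h.rows, h.steps, h.scales, h.capBound, h.matrix, fun j hj => ?_, h.weight,
    h.coin⟩
  have h1 := h.cap j hj
  simp only [State.setArr_arr, if_true, Function.update_apply]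
  unfold rowCap numRows at *
  split_ifs at * <;> omega

theorem run_energyProg (hB : I.FitsIn B) (h : I.Ctx c 0 σ) (hσ : I.Stored σ) :
    Run B energyProg σ fun τ => I.Stored τ ∧ σ.var 10 ≤ τ.var 10 ∧
      ∀ e < I.n, ∀ i < I.numScales, I.value (I.candidate c (e + 1) i) ≤ τ.var 10 := by
  -- After `k` rounds the energy cell contains `k`: round `k` installs the bound `k + 1`, so the
  -- bounds tried are `1, …, n`.
  refine Run.forLoop (N := I.n) h.n hB.n (by decide) (by decide)
    (fun k τ => I.Ctx c k τ ∧ I.Stored τ ∧ σ.var 10 ≤ τ.var 10 ∧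
      ∀ e < k, ∀ i < I.numScales, I.value (I.candidate c (e + 1) i) ≤ τ.var 10) ?_ ?_
    fun τ _ hτ => hτ.2
  · exact ⟨h.setVar (by norm_num) _, hσ.congr rfl (by simp), by simp, by simp⟩
  · intro k hk τ h7 _ ⟨hc, hst, h10, hcand⟩
    refine Run.seq (Run.store ?_ ?_)
    · simp only [Expr.eval, h7]
      exact (show k + 1 ≤ B by have := hB.n; omega).trans_lt Nat.lt_two_pow_self
    simp only [Expr.eval, h7, hc.n, hc.m]
    have hc1 := hc.setEnergy (k + 1)
    refine Run.seq ((run_mwProg hB hc1 (by omega)).mono fun ρ hρ hz => ?_)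
    have hcρ : I.Ctx c (k + 1) ρ := hc1.of_frame hρ (by decide)
    have h1 : ρ.var 10 = τ.var 10 := hρ.1 10 (by decide)
    have h2 : ρ.arr 5 = τ.arr 5 := hρ.2 5 (by decide)
    refine (run_scaleProg hB hcρ hz (hst.congr h2 h1)).mono fun π hπ ⟨h3, h4, h5⟩ => ?_
    refine ⟨(hcρ.of_frame hπ (by decide)).setVar (by norm_num) _, h3.congr rfl (by simp), ?_, ?_⟩
    · simp only [State.setVar_var]
      norm_num
      omega
    · intro e' he' i hi
      simp only [State.setVar_var]
      norm_num
      rcases Nat.lt_succ_iff_lt_or_eq.1 he' with he' | rfl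
      · have := hcand e' he' i hi
        omega
      · exact h5 i hi

end Instance

end Packing

namespace Packing

/-! ### Initialization -/

open Program

/-- Computes the numbers of rows, of steps and of scales in variables `2`, `3` and `4`. -/
def countersProg : Program :=
  .seq (.assign 2 (.add (.add (.var 0) (.var 1)) (.lit 1))) <|
  .seq (.assign 3 (.mul (.mul (.lit 12) (.var 0)) (.var 2))) <|
  .assign 4 (.mul (.mul (.lit 6) (.var 3)) (.var 0))

/-- Computes the integer weights in array `6`. -/
def weightsProg : Program :=
  .seq (.assign 6 (.lit 1)) <|
  .seq (forLoop 12 0 <| .assign 6 (.mul (.var 6) (.get 3 (.var 12)))) <|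
  forLoop 12 0 <| .store 6 (.var 12)
    (.mul (.get 2 (.var 12)) (.div (.var 6) (.get 3 (.var 12))))

/-- Computes the bound for the capacities in variable `5`. -/
def capBoundProg : Program :=
  .seq (.assign 5 (.add (.lit 1) (.var 0))) <|
  forLoop 12 1 <| .assign 5 (.add (.var 5) (.get 1 (.var 12)))

/-- Computes the random number of the vertex `var 13` in variable `14`. -/
def coinNumberProg : Program :=
  .seq (.assign 14 (.lit 0)) <| .seq (.assign 15 (.lit 1)) <|
  forLoop 12 4 <|
    .seq (.assign 14 (.add (.var 14)
      (.mul (.get 4 (.add (.mul (.var 13) (.var 4)) (.var 12))) (.var 15)))) <|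
    .assign 15 (.mul (.var 15) (.lit 2))

/-- Computes the random numbers of the vertices in array `7`. -/
def coinsProg : Program :=
  forLoop 13 0 <| .seq coinNumberProg <| .store 7 (.var 13) (.var 14)

/-- Appends the rows for the vertices and for the energy to the constraint matrix. -/
def matrixProg : Program :=
  forLoop 12 0 <|
    .seq (.store 0 (.add (.mul (.add (.var 1) (.var 12)) (.var 0)) (.var 12)) (.lit 1)) <|
    .seq (.store 0 (.add (.mul (.add (.var 1) (.var 0)) (.var 0)) (.var 12)) (.lit 1)) <|
    .store 1 (.add (.var 1) (.var 12)) (.lit 1)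

/-- Stores a heaviest vertex as the first output. -/
def singleProg : Program :=
  .seq (.assign 10 (.lit 0)) <| .seq (.assign 16 (.lit 0)) <|
  .seq (forLoop 12 0 <| .cond (.sub (.get 6 (.var 12)) (.var 10))
    (.seq (.assign 16 (.var 12)) (.assign 10 (.get 6 (.var 12)))) .skip) <|
  .store 5 (.var 16) (.lit 1)

/-- The complete algorithm. -/
def mainProg : Program :=
  .seq countersProg <| .seq weightsProg <| .seq capBoundProg <| .seq coinsProg <|
  .seq matrixProg <| .seq singleProg energyProg

namespace Instance

variable {I : Instance} {B : ℕ} {c : ℕ → ℕ} {e : ℕ} {σ τ : State}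

theorem FitsIn.lt_two_pow {a : ℕ} (h : a ≤ B) : a < 2 ^ B := h.trans_lt Nat.lt_two_pow_self

theorem FitsIn.capBound_lt (hB : I.FitsIn B) : I.capBound < 2 ^ B := by
  refine lt_of_le_of_lt ?_ hB.dual
  have h1 : 0 < I.capBound := by unfold capBound; omega
  have h2 : 0 < I.numRows := by unfold numRows; omega
  calc I.capBound ≤ I.capBound * (I.capBound * 2 ^ I.numSteps) :=
        Nat.le_mul_of_pos_right _ (by positivity)
    _ = I.capBound * I.capBound * 2 ^ I.numSteps := (mul_assoc _ _ _).symm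
    _ ≤ _ := Nat.le_mul_of_pos_left _ h2

theorem run_countersProg (hB : I.FitsIn B) (hn : σ.var 0 = I.n) (hm : σ.var 1 = I.m) :
    Run B countersProg σ fun τ =>
      τ.var 2 = I.numRows ∧ τ.var 3 = I.numSteps ∧ τ.var 4 = I.numScales := by
  refine Run.seq (Run.assign ?_ (Run.seq (Run.assign ?_ (Run.assign ?_ ?_))))
  · simp only [Expr.eval, hn, hm]
    exact FitsIn.lt_two_pow hB.rows
  · simp only [Expr.eval, hn, hm, State.setVar_var]
    exact FitsIn.lt_two_pow hB.steps
  · simp only [Expr.eval, hn, hm, State.setVar_var]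
    exact FitsIn.lt_two_pow hB.scales.le
  · simp [Expr.eval, hn, hm, numRows, numSteps, numScales]

theorem denominator_pos : 0 < I.denominator := prod_pos fun v _ => (I.weight v).den_pos

theorem den_dvd_denominator (v : Fin I.n) : (I.weight v).den ∣ I.denominator :=
  dvd_prod_of_mem _ (mem_univ v)

theorem run_weightsProg (hB : I.FitsIn B) (hn : σ.var 0 = I.n)
    (h2 : ∀ v : Fin I.n, σ.arr 2 v = (I.weight v).num)
    (h3 : ∀ v : Fin I.n, σ.arr 3 v = (I.weight v).den) :
    Run B weightsProg σ fun τ => ∀ v < I.n, τ.arr 6 v = I.intWeight v := by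
  have hD : ∏ v ∈ range I.n, σ.arr 3 v = I.denominator := by
    rw [Finset.prod_range, denominator]
    exact prod_congr rfl fun v _ => h3 v
  have h3pos : ∀ v ∈ range I.n, 1 ≤ σ.arr 3 v := fun v hv => by
    rw [h3 ⟨v, mem_range.1 hv⟩]; exact (I.weight _).den_pos
  refine Run.seq (Run.assign (by simpa [Expr.eval] using hB.one_lt) (Run.seq ?_))
  refine Run.forLoop (N := I.n) (by simp [hn]) hB.n (by decide) (by decide)
    (fun k τ => τ.var 6 = ∏ v ∈ range k, σ.arr 3 v) (by simp [Expr.eval]) ?_ fun τ hf h6 => ?_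
  · intro k hk τ h12 hf h6
    have h3' : τ.arr 3 = σ.arr 3 := by rw [hf.2 3 (by decide)]; rfl
    have heval : (Expr.mul (.var 6) (.get 3 (.var 12))).eval τ =
        ∏ v ∈ range (k + 1), σ.arr 3 v := by
      rw [prod_range_succ]
      simp only [Expr.eval, h6, h12, h3']
    refine Run.assign ?_ (by simp [heval])
    rw [heval]
    refine lt_of_le_of_lt ?_ hB.denominator
    rw [← hD]
    exact prod_le_prod_of_subset_of_one_le' (range_subset_range.2 hk) fun v hv _ => h3pos v hv
  · rw [hD] at h6
    refine Run.forLoop (N := I.n) (by rw [hf.1 0 (by decide)]; simp [hn]) hB.n (by decide)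
      (by decide) (fun k τ => ∀ v < k, τ.arr 6 v = I.intWeight v) (by simp) ?_ fun τ _ hτ => hτ
    intro k hk ρ h12 hρ hI
    have h6' : ρ.var 6 = I.denominator := by rw [hρ.1 6 (by decide), h6]
    have h2' : ρ.arr 2 k = (I.weight ⟨k, hk⟩).num := by
      rw [hρ.2 2 (by decide), hf.2 2 (by decide)]; exact h2 ⟨k, hk⟩
    have h3' : ρ.arr 3 k = (I.weight ⟨k, hk⟩).den := by
      rw [hρ.2 3 (by decide), hf.2 3 (by decide)]; exact h3 ⟨k, hk⟩
    have heval : (Expr.mul (.get 2 (.var 12)) (.div (.var 6) (.get 3 (.var 12)))).eval ρ =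
        I.intWeight k := by
      simp only [Expr.eval, h12, h6', h2', h3', intWeight, hk, dif_pos]
    refine Run.store ?_ ?_
    · rw [heval]
      exact hB.intWeight_lt hk
    · intro v hv
      rw [heval]
      simp only [State.setVar_arr, State.setArr_arr, if_true, Expr.eval, h12,
        Function.update_apply]
      split_ifs with hvk
      · rw [hvk]
      · exact hI v (by omega)

theorem run_capBoundProg (hB : I.FitsIn B) (hn : σ.var 0 = I.n) (hm : σ.var 1 = I.m)
    (h1 : ∀ j : Fin I.m, σ.arr 1 j = I.cap j) :
    Run B capBoundProg σ fun τ => τ.var 5 = I.capBound := by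
  have hsum : 1 + I.n + ∑ j ∈ range I.m, σ.arr 1 j = I.capBound := by
    rw [Finset.sum_range, capBound]
    congr 1
    exact sum_congr rfl fun j _ => h1 j
  have hle : ∀ k ≤ I.m, 1 + I.n + ∑ j ∈ range k, σ.arr 1 j < 2 ^ B := by
    intro k hk
    refine lt_of_le_of_lt ?_ hB.capBound_lt
    rw [← hsum]
    exact Nat.add_le_add_left (sum_le_sum_of_subset (range_subset_range.2 hk)) _
  refine Run.seq (Run.assign ?_ ?_)
  · simpa [Expr.eval, hn] using hle 0 (Nat.zero_le _)
  refine Run.forLoop (N := I.m) (by simp [hm]) hB.m (by decide) (by decide)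
    (fun k τ => τ.var 5 = 1 + I.n + ∑ j ∈ range k, σ.arr 1 j) (by simp [Expr.eval, hn]) ?_
    fun τ _ h5 => h5.trans hsum
  intro k hk τ h12 hf h5
  have h1' : τ.arr 1 = σ.arr 1 := by rw [hf.2 1 (by decide)]; rfl
  have heval : (Expr.add (.var 5) (.get 1 (.var 12))).eval τ =
      1 + I.n + ∑ j ∈ range (k + 1), σ.arr 1 j := by
    rw [sum_range_succ]
    simp only [Expr.eval, h5, h12, h1', add_assoc]
  refine Run.assign ?_ (by simp [heval])
  rw [heval]
  exact hle (k + 1) hk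

theorem sum_bits_lt {d : ℕ → ℕ} (hd : ∀ b, d b ≤ 1) (k : ℕ) :
    ∑ b ∈ range k, d b * 2 ^ b < 2 ^ k := by
  induction k with
  | zero => simp
  | succ k ih =>
    rw [sum_range_succ, pow_succ]
    have := Nat.mul_le_mul_right (2 ^ k) (hd k)
    omega

theorem run_coinsProg (hB : I.FitsIn B) (hn : σ.var 0 = I.n) (hs : σ.var 4 = I.numScales)
    (hc : ∀ b, σ.arr 4 b ≤ 1) :
    Run B coinsProg σ fun τ => ∀ v < I.n, τ.arr 7 v = I.coinNumber (σ.arr 4) v := by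
  refine Run.forLoop (N := I.n) hn hB.n (by decide) (by decide)
    (fun k τ => ∀ v < k, τ.arr 7 v = I.coinNumber (σ.arr 4) v) (by simp) ?_ fun τ _ hτ => hτ
  intro k hk τ h13 hf hI
  have hs' : τ.var 4 = I.numScales := by rw [hf.1 4 (by decide), hs]
  have h4' : τ.arr 4 = σ.arr 4 := hf.2 4 (by decide)
  have hlt : ∀ l ≤ I.numScales,
      ∑ b ∈ range l, σ.arr 4 (k * I.numScales + b) * 2 ^ b < 2 ^ B := fun l hl =>
    (sum_bits_lt (fun b => hc _) l).trans_le
      (Nat.pow_le_pow_right two_pos (hl.trans hB.scales.le))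
  have hrun : Run B coinNumberProg τ fun ρ => ρ.var 14 = I.coinNumber (σ.arr 4) k := by
    refine Run.seq (Run.assign (by simp [Expr.eval]) ?_)
    refine Run.seq (Run.assign (by simpa [Expr.eval] using hB.one_lt) ?_)
    refine Run.forLoop (N := I.numScales) (by simp [hs']) hB.scales.le (by decide) (by decide)
      (fun l ρ => ρ.var 14 = ∑ b ∈ range l, σ.arr 4 (k * I.numScales + b) * 2 ^ b ∧
        ρ.var 15 = 2 ^ l) (by simp [Expr.eval]) ?_ fun ρ _ hρ => hρ.1
    intro l hl ρ h12 hρ ⟨h14, h15⟩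
    have h13' : ρ.var 13 = k := by rw [hρ.1 13 (by decide)]; simpa using h13
    have hs'' : ρ.var 4 = I.numScales := by rw [hρ.1 4 (by decide)]; simpa using hs'
    have h4'' : ρ.arr 4 = σ.arr 4 := by rw [hρ.2 4 (by decide)]; simpa using h4'
    have heval : (Expr.add (.var 14)
        (.mul (.get 4 (.add (.mul (.var 13) (.var 4)) (.var 12))) (.var 15))).eval ρ =
        ∑ b ∈ range (l + 1), σ.arr 4 (k * I.numScales + b) * 2 ^ b := by
      rw [sum_range_succ]
      simp only [Expr.eval, h14, h15, h13', hs'', h12, h4'']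
    refine Run.seq (Run.assign ?_ (Run.assign ?_ ?_))
    · rw [heval]
      exact hlt (l + 1) hl
    · simp only [Expr.eval, State.setVar_var, h15]
      norm_num
      rw [← pow_succ]
      exact Nat.pow_lt_pow_right one_lt_two (by have := hB.scales; omega)
    · rw [heval]
      simp [Expr.eval, h15, pow_succ]
  refine Run.seq (hrun.mono fun ρ hρ h14 => ?_)
  have h13' : ρ.var 13 = k := by rw [hρ.1 13 (by decide), h13]
  have h7' : ∀ v < k, ρ.arr 7 v = I.coinNumber (σ.arr 4) v := by
    rw [hρ.2 7 (by decide)]; exact hI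
  refine Run.store ?_ ?_
  · simp only [Expr.eval, h14]
    exact hlt _ le_rfl
  · intro v hv
    simp only [State.setVar_arr, State.setArr_arr, if_true, Expr.eval, h13', h14,
      Function.update_apply]
    split_ifs with hvk
    · rw [hvk]
    · exact h7' v (by omega)

/-- Uniqueness of division with remainder: matrix cells in row-major order do not collide, and
neither do the coin blocks of different vertices. -/
theorem mul_add_inj {n i j u v : ℕ} (hu : u < n) (hv : v < n) :
    i * n + u = j * n + v ↔ i = j ∧ u = v := by
  refine ⟨fun h => ?_, fun ⟨h1, h2⟩ => by rw [h1, h2]⟩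
  have h1 : (i * n + u) % n = (j * n + v) % n := by rw [h]
  have h2 : (i * n + u) / n = (j * n + v) / n := by rw [h]
  have hn : 0 < n := by omega
  rw [Nat.mul_add_mod', Nat.mul_add_mod', Nat.mod_eq_of_lt hu, Nat.mod_eq_of_lt hv] at h1
  rw [mul_comm i, mul_comm j, Nat.mul_add_div hn, Nat.mul_add_div hn, Nat.div_eq_of_lt hu,
    Nat.div_eq_of_lt hv] at h2
  exact ⟨by simpa using h2, h1⟩

/-- The incidence rows are part of the input and all further cells start at 0, so only the diagonal
of the vertex rows and the all-ones energy row have to be written, one column per round. -/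
theorem run_matrixProg (hB : I.FitsIn B) (hn : σ.var 0 = I.n) (hm : σ.var 1 = I.m)
    (h0 : ∀ j < I.numRows, ∀ v < I.n, σ.arr 0 (j * I.n + v) =
      if j < I.m then I.rowMatrix j v else 0)
    (h1 : ∀ j, σ.arr 1 j = if h : j < I.m then I.cap ⟨j, h⟩ else 0) :
    Run B matrixProg σ fun τ =>
      (∀ j < I.numRows, ∀ v < I.n, τ.arr 0 (j * I.n + v) = I.rowMatrix j v) ∧
      ∀ j < I.numRows, τ.arr 1 j = I.rowCap 0 j := by
  refine Run.forLoop (N := I.n) hn hB.n (by decide) (by decide)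
    (fun k τ => (∀ j < I.numRows, ∀ v < I.n, τ.arr 0 (j * I.n + v) =
        if j < I.m then I.rowMatrix j v else if j < I.m + I.n then
          (if j = I.m + v ∧ v < k then 1 else 0) else if v < k then 1 else 0) ∧
      ∀ j, τ.arr 1 j = if h : j < I.m then I.cap ⟨j, h⟩ else if j < I.m + k then 1 else 0)
    ⟨?_, ?_⟩ ?_ fun τ _ hτ => ⟨?_, ?_⟩
  · intro j hj v hv
    rw [State.setVar_arr, h0 j hj v hv]
    simp
  · intro j
    rw [State.setVar_arr, h1 j]
    split_ifs <;> first | rfl | omega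
  · intro k hk τ h12 hf ⟨hI0, hI1⟩
    have hn' : τ.var 0 = I.n := by rw [hf.1 0 (by decide), hn]
    have hm' : τ.var 1 = I.m := by rw [hf.1 1 (by decide), hm]
    have h1B : (1 : ℕ) < 2 ^ B := hB.one_lt
    refine Run.seq (Run.store h1B (Run.seq (Run.store h1B (Run.store h1B ⟨?_, ?_⟩))))
    · intro j hj v hv
      simp only [State.setVar_arr, State.setArr_arr, State.setArr_var, if_true, Expr.eval, h12,
        hn', hm']
      norm_num
      simp only [Function.update_apply, mul_add_inj hv hk]
      rw [hI0 j hj v hv]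
      unfold numRows at hj
      by_cases hjm : j < I.m
      · rw [if_neg (by omega), if_neg (by omega)]
        simp [hjm]
      · by_cases hjn : j < I.m + I.n
        · rw [if_neg (by omega), if_neg hjm, if_pos hjn, if_neg hjm, if_pos hjn]
          split_ifs <;> first | rfl | omega
        · rw [if_neg hjm, if_neg hjn, if_neg hjm, if_neg hjn]
          split_ifs <;> first | rfl | omega
    · intro j
      simp only [State.setVar_arr, State.setArr_arr, State.setArr_var, if_true, Expr.eval, h12,
        hm', Function.update_apply]
      norm_num
      rw [hI1 j]
      split_ifs <;> first | rfl | omega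
  · intro j hj v hv
    rw [hτ.1 j hj v hv]
    unfold rowMatrix
    split_ifs <;> first | rfl | omega
  · intro j hj
    rw [hτ.2 j]
    unfold rowCap
    split_ifs <;> rfl

theorem isPacking_singleton (v : Fin I.n) : I.IsPacking {v} := fun j =>
  (card_le_card inter_subset_left).trans (by simpa using I.one_le_cap j)

theorem run_singleProg (hB : I.FitsIn B) (h : I.Ctx c e σ) (h5 : ∀ v, σ.arr 5 v = 0) :
    Run B singleProg σ fun τ => I.Stored τ ∧ ∀ v < I.n, I.intWeight v ≤ τ.var 10 := by
  refine Run.seq (Run.assign (by simp [Expr.eval]) ?_)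
  refine Run.seq (Run.assign (by simp [Expr.eval]) (Run.seq ?_))
  -- As long as only zero weights occur, variable `16` keeps its default 0. This is a legitimate
  -- vertex if `n > 0`; for `n = 0` the cell written at the end stands for no vertex.
  refine Run.forLoop (N := I.n) (by simp [h.n]) hB.n (by decide) (by decide)
    (fun k τ => (∀ v < k, I.intWeight v ≤ τ.var 10) ∧ (τ.var 10 = 0 ∧ τ.var 16 = 0 ∨
      τ.var 16 < I.n ∧ τ.var 10 = I.intWeight (τ.var 16))) (by simp [Expr.eval]) ?_
    fun τ hf hI => ?_
  · intro k hk τ h12 hf ⟨hI1, hI2⟩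
    have hc : I.Ctx c e τ :=
      ((h.setVar (by norm_num) _).setVar (by norm_num) _).of_frame hf (by decide)
    have hwk := hc.weight k hk
    refine Run.cond (fun hne => ?_) fun heq => ?_
    · simp only [Expr.eval, h12, hwk] at hne
      refine Run.seq (Run.assign ?_ (Run.assign ?_ ⟨fun v hv => ?_, Or.inr ?_⟩))
      · simp only [Expr.eval, h12]
        exact FitsIn.lt_two_pow (hk.le.trans hB.n)
      · simpa [Expr.eval, h12, hwk] using hB.intWeight_lt hk
      · simp only [Expr.eval, State.setVar_var, State.setVar_arr, h12]
        norm_num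
        rw [hwk]
        rcases Nat.lt_succ_iff_lt_or_eq.1 hv with hv | rfl
        · have := hI1 v hv
          omega
        · exact le_rfl
      · simp [Expr.eval, h12, hwk, hk]
    · simp only [Expr.eval, h12, hwk] at heq
      refine Run.skip ⟨fun v hv => ?_, by simpa using hI2⟩
      simp only [State.setVar_var]
      norm_num
      rcases Nat.lt_succ_iff_lt_or_eq.1 hv with hv | rfl
      · exact hI1 v hv
      · omega
  · obtain ⟨hI1, hI2⟩ := hI
    have h5' : ∀ v, τ.arr 5 v = 0 := by
      rw [hf.2 5 (by decide)]; simpa using h5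
    refine Run.store hB.one_lt ⟨?_, hI1⟩
    rcases Nat.eq_zero_or_pos I.n with hn | hn
    · refine ⟨∅, fun j => by simp, fun v => absurd v.2 (by omega), ?_⟩
      rcases hI2 with h | h
      · simpa [value] using h.1
      · omega
    · have hb : τ.var 16 < I.n := by rcases hI2 with h | h <;> omega
      have hval : τ.var 10 = I.intWeight (τ.var 16) := by
        rcases hI2 with h | h
        · have := hI1 _ hb
          omega
        · exact h.2
      refine ⟨{⟨τ.var 16, hb⟩}, isPacking_singleton _, fun v => ?_, ?_⟩
      · simp only [mem_singleton, Expr.eval, State.setArr_arr, if_true, Function.update_apply, h5',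
          Fin.ext_iff]
        split_ifs with hv <;> simp [hv]
      · simpa [value] using hval

theorem initialState_bounded (hB : I.FitsIn B) {L : ℕ} (r : Fin L → Bool) :
    (initialState I r).Bounded B := by
  have h1 := hB.one_lt
  have hpos : 0 < 2 ^ B := by omega
  constructor
  · intro x
    simp only [initialState]
    split_ifs
    · exact FitsIn.lt_two_pow hB.n
    · exact FitsIn.lt_two_pow hB.m
    · exact hpos
  · intro a i
    simp only [initialState]
    split_ifs with _ _ _ hi _ hi _ hi
    · exact h1
    · exact hpos
    · refine lt_of_le_of_lt ?_ hB.capBound_lt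
      have := single_le_sum_of_canonicallyOrdered (f := I.cap) (mem_univ ⟨i, hi⟩)
      unfold capBound
      omega
    · exact hpos
    · refine lt_of_le_of_lt ?_ (hB.intWeight_lt hi)
      rw [intWeight, dif_pos hi]
      exact Nat.le_mul_of_pos_right _ (Nat.div_pos (Nat.le_of_dvd denominator_pos
        (den_dvd_denominator _)) (I.weight _).den_pos)
    · exact hpos
    · exact (Nat.le_of_dvd denominator_pos (den_dvd_denominator _)).trans_lt hB.denominator
    · exact hpos
    · exact (Bool.toNat_le _).trans_lt h1
    · exact hpos
    · exact hpos

theorem run_mainProg (hB : I.FitsIn B) {L : ℕ} (r : Fin L → Bool) :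
    Run B mainProg (initialState I r) fun τ => I.Stored τ ∧
      (∀ v < I.n, I.intWeight v ≤ τ.var 10) ∧ ∀ e < I.n, ∀ i < I.numScales,
        I.value (I.candidate ((initialState I r).arr 4) (e + 1) i) ≤ τ.var 10 := by
  set σ := initialState I r with hσ
  have hn : σ.var 0 = I.n := rfl
  have hm : σ.var 1 = I.m := rfl
  refine Run.seq ((run_countersProg hB hn hm).mono fun σ₁ hf₁ ⟨h2, h3, h4⟩ => ?_)
  have hn₁ : σ₁.var 0 = I.n := by rw [hf₁.1 0 (by decide), hn]
  have hm₁ : σ₁.var 1 = I.m := by rw [hf₁.1 1 (by decide), hm]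
  have ha₁ : σ₁.arr = σ.arr := funext fun a => hf₁.2 a (by simp [countersProg, Program.arrs])
  refine Run.seq ((run_weightsProg hB hn₁ (fun v => ?_) fun v => ?_).mono fun σ₂ hf₂ h6 => ?_)
  · rw [ha₁]; simp [hσ, initialState]
  · rw [ha₁]; simp [hσ, initialState]
  have hn₂ : σ₂.var 0 = I.n := by rw [hf₂.1 0 (by decide), hn₁]
  have hm₂ : σ₂.var 1 = I.m := by rw [hf₂.1 1 (by decide), hm₁]
  refine Run.seq ((run_capBoundProg hB hn₂ hm₂ fun j => ?_).mono fun σ₃ hf₃ h5 => ?_)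
  · rw [hf₂.2 1 (by decide), ha₁]; simp [hσ, initialState]
  have hn₃ : σ₃.var 0 = I.n := by rw [hf₃.1 0 (by decide), hn₂]
  have hm₃ : σ₃.var 1 = I.m := by rw [hf₃.1 1 (by decide), hm₂]
  have hs₃ : σ₃.var 4 = I.numScales := by rw [hf₃.1 4 (by decide), hf₂.1 4 (by decide), h4]
  have hc₃ : σ₃.arr 4 = σ.arr 4 := by rw [hf₃.2 4 (by decide), hf₂.2 4 (by decide), ha₁]
  refine Run.seq ((run_coinsProg hB hn₃ hs₃ fun b => ?_).mono fun σ₄ hf₄ h7 => ?_)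
  · rw [hc₃]
    simp only [hσ, initialState]
    norm_num
    split_ifs
    · exact Bool.toNat_le _
    · exact Nat.zero_le _
  rw [hc₃] at h7
  have hn₄ : σ₄.var 0 = I.n := by rw [hf₄.1 0 (by decide), hn₃]
  have hm₄ : σ₄.var 1 = I.m := by rw [hf₄.1 1 (by decide), hm₃]
  refine Run.seq ((run_matrixProg hB hn₄ hm₄ (fun j hj v hv => ?_) fun j => ?_).mono
    fun σ₅ hf₅ ⟨h0, h1⟩ => ?_)
  · rw [hf₄.2 0 (by decide), hf₃.2 0 (by decide), hf₂.2 0 (by decide), ha₁]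
    have hiff : (∃ (j' : Fin I.m) (v' : Fin I.n), v' ∈ I.edge j' ∧
        j * I.n + v = j' * I.n + v') ↔ ∃ h : j < I.m, ⟨v, hv⟩ ∈ I.edge ⟨j, h⟩ := by
      constructor
      · rintro ⟨j', v', h1, h2⟩
        obtain ⟨rfl, rfl⟩ := (mul_add_inj hv v'.2).1 h2
        exact ⟨j'.2, h1⟩
      · rintro ⟨h, h1⟩
        exact ⟨⟨j, h⟩, ⟨v, hv⟩, h1, rfl⟩
    simp only [hσ, initialState, if_true, hiff, rowMatrix, hv, dif_pos]
    by_cases hj : j < I.m <;> simp [hj]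
  · rw [hf₄.2 1 (by decide), hf₃.2 1 (by decide), hf₂.2 1 (by decide), ha₁]
    simp [hσ, initialState]
  have hctx : I.Ctx (σ.arr 4) 0 σ₅ := by
    refine ⟨?_, ?_, ?_, ?_, ?_, ?_, h0, h1, ?_, ?_⟩
    · rw [hf₅.1 0 (by decide), hn₄]
    · rw [hf₅.1 1 (by decide), hm₄]
    · rw [hf₅.1 2 (by decide), hf₄.1 2 (by decide), hf₃.1 2 (by decide), hf₂.1 2 (by decide), h2]
    · rw [hf₅.1 3 (by decide), hf₄.1 3 (by decide), hf₃.1 3 (by decide), hf₂.1 3 (by decide), h3]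
    · rw [hf₅.1 4 (by decide), hf₄.1 4 (by decide), hs₃]
    · rw [hf₅.1 5 (by decide), hf₄.1 5 (by decide), h5]
    · rw [hf₅.2 6 (by decide), hf₄.2 6 (by decide), hf₃.2 6 (by decide)]; exact h6
    · rw [hf₅.2 7 (by decide)]; exact h7
  refine Run.seq ((run_singleProg hB hctx fun v => ?_).mono fun σ₆ hf₆ ⟨hst, hmax⟩ => ?_)
  · rw [hf₅.2 5 (by decide), hf₄.2 5 (by decide), hf₃.2 5 (by decide), hf₂.2 5 (by decide), ha₁]
    simp [hσ, initialState]
  refine (run_energyProg hB (hctx.of_frame hf₆ (by decide)) hst).mono fun τ _ ⟨h8, h9, h10⟩ => ?_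
  exact ⟨h8, fun v hv => (hmax v hv).trans h9, h10⟩

end Instance

end Packing

namespace Packing

/-! ### The distribution of the random numbers -/

/-- Coins outside the range of `ι` are irrelevant: the cube splits as a product, and the sum over
the other factor cancels part of the normalization. Surplus coin tosses are therefore harmless. -/
theorem sum_comp_injective {α β : Type*} [Fintype α] [Fintype β] [DecidableEq α] [DecidableEq β]
    {ι : α → β} (hι : Function.Injective ι) (g : (α → Bool) → ℝ) :
    (∑ r : β → Bool, g (r ∘ ι)) / 2 ^ Fintype.card β =
      (∑ q : α → Bool, g q) / 2 ^ Fintype.card α := by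
  classical
  let E : α ⊕ ((Set.range ι)ᶜ : Set β) ≃ β :=
    ((Equiv.ofInjective ι hι).sumCongr (Equiv.refl _)).trans (Equiv.Set.sumCompl (Set.range ι))
  have hE : ∀ a, E (Sum.inl a) = ι a := fun a => by simp [E]
  have hcard : Fintype.card β = Fintype.card α + Fintype.card ((Set.range ι)ᶜ : Set β) := by
    rw [← Fintype.card_sum, Fintype.card_congr E]
  let F : (β → Bool) ≃ (α → Bool) × (((Set.range ι)ᶜ : Set β) → Bool) :=
    (Equiv.arrowCongr E.symm (Equiv.refl _)).trans (Equiv.sumArrowEquivProdArrow _ _ _)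
  have hF : ∀ r, (F r).1 = r ∘ ι := fun r => by
    ext a
    simp [F, Equiv.sumArrowEquivProdArrow, Equiv.arrowCongr, hE]
  have h1 : ∑ r : β → Bool, g (r ∘ ι) =
      2 ^ Fintype.card ((Set.range ι)ᶜ : Set β) * ∑ q : α → Bool, g q := by
    calc ∑ r : β → Bool, g (r ∘ ι) = ∑ r : β → Bool, g (F r).1 := by simp only [hF]
      _ = ∑ x : (α → Bool) × (((Set.range ι)ᶜ : Set β) → Bool), g x.1 :=
          Equiv.sum_comp F fun x => g x.1
      _ = _ := by
          rw [Fintype.sum_prod_type]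
          simp [mul_sum]
  rw [h1, hcard, pow_add]
  field_simp

/-- The number with the binary digits `b`. -/
def bitsNumber {s : ℕ} (b : Fin s → Bool) : ℕ := ∑ i, (b i).toNat * 2 ^ (i : ℕ)

/-- Binary expansion is a bijection from `s` bits onto the numbers below `2 ^ s`, so a comparison
with `a` succeeds with probability exactly `a / 2 ^ s`. -/
theorem card_bitsNumber_lt {s a : ℕ} (ha : a ≤ 2 ^ s) :
    (univ.filter fun b : Fin s → Bool => bitsNumber b < a).card = a := by
  let E : (Fin s → Bool) ≃ Fin (2 ^ s) :=
    (Equiv.arrowCongr (Equiv.refl _) finTwoEquiv.symm).trans finFunctionFinEquiv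
  have hE : ∀ b, (E b : ℕ) = bitsNumber b := fun b => by
    simp only [E, Equiv.trans_apply, finFunctionFinEquiv_apply, bitsNumber]
    refine sum_congr rfl fun i _ => ?_
    congr 1
    simp only [Equiv.arrowCongr, Equiv.coe_fn_mk, Function.comp, Equiv.refl_symm, Equiv.refl_apply]
    cases b i <;> rfl
  have h1 : (univ.filter fun b : Fin s → Bool => bitsNumber b < a).map
      (E.toEmbedding.trans Fin.valEmbedding) = range a := by
    ext x
    simp only [mem_map, mem_filter, mem_univ, true_and, mem_range, Function.Embedding.trans_apply,
      Equiv.coe_toEmbedding, Fin.valEmbedding_apply, hE]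
    constructor
    · rintro ⟨b, h1, h2⟩
      omega
    · intro hx
      have h2 : bitsNumber (E.symm ⟨x, hx.trans_le ha⟩) = x := by rw [← hE]; simp
      exact ⟨E.symm ⟨x, hx.trans_le ha⟩, by omega, h2⟩
  rw [← card_map, h1, card_range]

/-- Comparing independent random numbers with thresholds gives a random subset. -/
theorem sum_bitsNumber_lt {n s : ℕ} {a : Fin n → ℕ} (ha : ∀ v, a v ≤ 2 ^ s)
    (f : Finset (Fin n) → ℝ) :
    (∑ Q : Fin n → Fin s → Bool, f (univ.filter fun v => bitsNumber (Q v) < a v)) /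
      2 ^ (n * s) = subsetExp (fun v => (a v : ℝ) / 2 ^ s) f := by
  have hcard : ∀ R : Finset (Fin n), ((univ.filter fun Q : Fin n → Fin s → Bool =>
      univ.filter (fun v => bitsNumber (Q v) < a v) = R).card : ℝ) =
      (∏ v ∈ R, (a v : ℝ)) * ∏ v ∈ univ \ R, (2 ^ s - (a v : ℝ)) := by
    intro R
    have h1 : (univ.filter fun Q : Fin n → Fin s → Bool =>
        univ.filter (fun v => bitsNumber (Q v) < a v) = R) =
        Fintype.piFinset fun v => univ.filter fun b : Fin s → Bool =>
          (bitsNumber b < a v ↔ v ∈ R) := by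
      ext Q
      simp [Finset.ext_iff]
    have h2 : ∀ v, ((univ.filter fun b : Fin s → Bool =>
        (bitsNumber b < a v ↔ v ∈ R)).card : ℝ) = if v ∈ R then (a v : ℝ) else 2 ^ s - a v := by
      intro v
      split_ifs with hv
      · simp only [hv, iff_true]
        rw [card_bitsNumber_lt (ha v)]
      · simp only [hv, iff_false]
        have h3 := card_filter_add_card_filter_not (s := (univ : Finset (Fin s → Bool)))
          fun b => bitsNumber b < a v
        rw [card_bitsNumber_lt (ha v)] at h3
        have h4 : (univ : Finset (Fin s → Bool)).card = 2 ^ s := by simp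
        rw [h4] at h3
        rw [eq_sub_iff_add_eq, add_comm]
        exact_mod_cast h3
    rw [h1, Fintype.card_piFinset, Nat.cast_prod, prod_congr rfl fun v _ => h2 v, prod_ite]
    congr 1
    · refine prod_congr ?_ fun _ _ => rfl
      ext; simp
    · refine prod_congr ?_ fun _ _ => rfl
      ext; simp
  -- Grouping the outcomes by the resulting subset leaves a count for each subset, which is a
  -- product because the vertices use separate bits.
  rw [← sum_fiberwise univ fun Q : Fin n → Fin s → Bool =>
    univ.filter fun v => bitsNumber (Q v) < a v, subsetExp, sum_div]
  refine sum_congr rfl fun R _ => ?_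
  rw [sum_congr rfl (g := fun _ => f R) fun Q hQ => by rw [(mem_filter.1 hQ).2], sum_const,
    nsmul_eq_mul, hcard]
  have h5 : ∀ v, 1 - (a v : ℝ) / 2 ^ s = (2 ^ s - a v) / 2 ^ s := fun v => by field_simp
  simp only [h5, prod_div_distrib, prod_const]
  have h6 : (2 : ℝ) ^ (n * s) = (2 ^ s) ^ R.card * (2 ^ s) ^ (univ \ R).card := by
    rw [← pow_add, add_comm R.card, card_sdiff_add_card_eq_card (subset_univ R), card_univ,
      Fintype.card_fin, ← pow_mul, mul_comm n]
  rw [h6]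
  field_simp

namespace Instance

variable {I : Instance}

/-- The samples of the algorithm have the intended distribution. -/
theorem sum_coinNumber_lt {L : ℕ} (hL : I.n * I.numScales ≤ L) {a : Fin I.n → ℕ}
    (ha : ∀ v, a v ≤ 2 ^ I.numScales) (f : Finset (Fin I.n) → ℝ) :
    (∑ r : Fin L → Bool, f (univ.filter fun v : Fin I.n =>
      I.coinNumber ((initialState I r).arr 4) v < a v)) / 2 ^ L =
      subsetExp (fun v => (a v : ℝ) / 2 ^ I.numScales) f := by
  have hlt : ∀ x : Fin I.n × Fin I.numScales, (x.1 : ℕ) * I.numScales + x.2 < L := fun x =>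
    lt_of_lt_of_le (by have h1 := x.1.2; have h2 := x.2.2; nlinarith) hL
  set ι : Fin I.n × Fin I.numScales → Fin L := fun x => ⟨x.1 * I.numScales + x.2, hlt x⟩ with hι
  have hinj : Function.Injective ι := by
    intro x y hxy
    have h1 := (mul_add_inj x.2.2 y.2.2).1 (Fin.ext_iff.1 hxy)
    exact Prod.ext (Fin.ext h1.1) (Fin.ext h1.2)
  have hcoin : ∀ (r : Fin L → Bool) (v : Fin I.n),
      I.coinNumber ((initialState I r).arr 4) v = bitsNumber fun b => (r ∘ ι) (v, b) := by
    intro r v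
    rw [coinNumber, Finset.sum_range, bitsNumber]
    refine sum_congr rfl fun b _ => ?_
    have := hlt (v, b)
    simp only at this
    simp [initialState, hι, this]
  have h1 := sum_comp_injective hinj fun q => f (univ.filter fun v : Fin I.n =>
    bitsNumber (fun b => q (v, b)) < a v)
  simp only [Fintype.card_fin, Fintype.card_prod] at h1
  simp only [hcoin]
  rw [h1, ← sum_bitsNumber_lt ha f]
  congr 1
  exact Equiv.sum_comp (Equiv.curry (Fin I.n) (Fin I.numScales) Bool) fun Q =>
    f (univ.filter fun v => bitsNumber (Q v) < a v)

/-! ### Polynomial bounds in the size of the instance -/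

/-- A bound for all bit lengths and loop lengths, in terms of the size of the instance. -/
noncomputable def sizeBound : Polynomial ℕ :=
  72 * .X ^ 2 * (.X + 1) + 12 * .X * (.X + 1) + 5 * .X + 3

/-- The number of coin tosses, in terms of the size of the instance. -/
noncomputable def coinBound : Polynomial ℕ := 72 * .X ^ 3 * (.X + 1)

variable (I)

theorem numRows_le : I.numRows ≤ I.size + 1 := by unfold numRows size; omega

theorem n_le_size : I.n ≤ I.size := by unfold size; omega

theorem numSteps_le : I.numSteps ≤ 12 * I.size * (I.size + 1) :=
  Nat.mul_le_mul (Nat.mul_le_mul_left _ I.n_le_size) I.numRows_le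

theorem numScales_le : I.numScales ≤ 72 * I.size ^ 2 * (I.size + 1) := by
  calc I.numScales ≤ 6 * (12 * I.size * (I.size + 1)) * I.size :=
        Nat.mul_le_mul (Nat.mul_le_mul_left _ I.numSteps_le) I.n_le_size
    _ = _ := by ring

theorem mul_numScales_le : I.n * I.numScales ≤ coinBound.eval I.size := by
  refine (Nat.mul_le_mul I.n_le_size I.numScales_le).trans (le_of_eq ?_)
  simp [coinBound]
  ring

theorem denominator_le : I.denominator ≤ 2 ^ I.size := by
  calc I.denominator ≤ ∏ v, 2 ^ Nat.size (I.weight v).den :=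
        prod_le_prod' fun v _ => (Nat.lt_size_self _).le
    _ = 2 ^ ∑ v, Nat.size (I.weight v).den := prod_pow_eq_pow_sum _ _ _
    _ ≤ _ := by
        refine Nat.pow_le_pow_right two_pos ?_
        unfold size
        rw [sum_add_distrib]
        omega

theorem capBound_le : I.capBound ≤ 2 ^ (2 * I.size + 1) := by
  have h1 : ∀ j, I.cap j ≤ 2 ^ I.size := fun j => by
    refine (Nat.lt_size_self _).le.trans (Nat.pow_le_pow_right two_pos ?_)
    have := single_le_sum_of_canonicallyOrdered (f := fun j => Nat.size (I.cap j)) (mem_univ j)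
    unfold size
    omega
  have h2 : ∑ j, I.cap j ≤ I.m * 2 ^ I.size := by
    refine (sum_le_sum fun j _ => h1 j).trans ?_
    simp
  have h3 : I.m ≤ I.size := by unfold size; omega
  have h4 := I.n_le_size
  have h5 : I.size < 2 ^ I.size := Nat.lt_two_pow_self
  rw [pow_succ, mul_comm 2 I.size, pow_mul, sq]
  unfold capBound
  nlinarith

theorem sum_intWeight_le : ∑ v ∈ range I.n, I.intWeight v ≤ 2 ^ (3 * I.size) := by
  have h1 : ∀ v ∈ range I.n, I.intWeight v ≤ 2 ^ I.size * 2 ^ I.size := by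
    intro v hv
    rw [intWeight, dif_pos (mem_range.1 hv)]
    refine Nat.mul_le_mul ?_ ((Nat.div_le_self _ _).trans I.denominator_le)
    refine (Nat.lt_size_self _).le.trans (Nat.pow_le_pow_right two_pos ?_)
    have := single_le_sum_of_canonicallyOrdered
      (f := fun v => Nat.size (I.weight v).num) (mem_univ ⟨v, mem_range.1 hv⟩)
    unfold size
    rw [sum_add_distrib]
    omega
  refine (sum_le_sum h1).trans ?_
  rw [sum_const, card_range, smul_eq_mul, mul_comm 3, pow_mul]
  have h5 : I.n ≤ 2 ^ I.size := I.n_le_size.trans Nat.lt_two_pow_self.le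
  calc I.n * (2 ^ I.size * 2 ^ I.size) ≤ 2 ^ I.size * (2 ^ I.size * 2 ^ I.size) :=
        Nat.mul_le_mul_right _ h5
    _ = _ := by ring

theorem fitsIn_sizeBound : I.FitsIn (sizeBound.eval I.size) := by
  have hB : sizeBound.eval I.size = 72 * I.size ^ 2 * (I.size + 1) +
      12 * I.size * (I.size + 1) + 5 * I.size + 3 := by simp [sizeBound]
  rw [hB]
  have hT := I.numSteps_le
  have hs := I.numScales_le
  have hM := I.numRows_le
  set S := I.size
  refine ⟨by omega, by omega, by omega, ?_, ?_, ?_⟩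
  · exact I.denominator_le.trans_lt (Nat.pow_lt_pow_right one_lt_two (by omega))
  -- The largest numbers are the dual lengths; their exponent `S + 2 (2 S + 1) + 12 S (S + 1)`
  -- accounts for the terms `12 S (S + 1)` and `5 S + 3` of `sizeBound`.
  · have hQ := I.capBound_le
    have h1 : S + 1 ≤ 2 ^ S := Nat.lt_two_pow_self
    calc I.numRows * (I.capBound * I.capBound * 2 ^ I.numSteps)
        ≤ 2 ^ S * (2 ^ (2 * S + 1) * 2 ^ (2 * S + 1) * 2 ^ (12 * S * (S + 1))) := by
          gcongr
          · omega
          · exact one_le_two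
      _ = 2 ^ (S + (2 * S + 1 + (2 * S + 1) + 12 * S * (S + 1))) := by
          simp only [pow_add]
      _ < _ := Nat.pow_lt_pow_right one_lt_two (by omega)
  · exact I.sum_intWeight_le.trans_lt (Nat.pow_lt_pow_right one_lt_two (by omega))

end Instance

end Packing

namespace Packing
namespace Instance

variable {I : Instance}

/-! ### Linear programming and the optimum -/

theorem isFractionalPacking_indicator {X : Finset (Fin I.n)} (hX : I.IsPacking X) :
    I.IsFractionalPacking fun v => if v ∈ X then 1 else 0 := by
  refine ⟨fun v => by dsimp only; split_ifs <;> norm_num, fun j => ?_⟩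
  rw [sum_ite_mem, sum_const, nsmul_eq_mul, mul_one, inter_comm]
  exact_mod_cast hX j

theorem fractionalWeight_indicator (X : Finset (Fin I.n)) :
    I.fractionalWeight (fun v => if v ∈ X then 1 else 0) = I.totalWeight X := by
  simp [fractionalWeight, totalWeight, NNRat.cast_sum]

theorem opt_le_fractionalWeight {x : Fin I.n → ℝ} (hx : I.IsOptimalFractional x) :
    (I.opt : ℝ) ≤ I.fractionalWeight x := by
  classical
  obtain ⟨X, hX, h⟩ := exists_mem_eq_sup (univ.filter fun X : Finset (Fin I.n) => I.IsPacking X)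
    ⟨∅, mem_filter.2 ⟨mem_univ _, fun j => by simp⟩⟩ I.totalWeight
  have h1 : I.opt = I.totalWeight X := by rw [← h]; unfold opt; congr
  rw [h1, ← fractionalWeight_indicator]
  exact hx.2 _ (isFractionalPacking_indicator (mem_filter.1 hX).2)

theorem weight_le_fractionalWeight {x : Fin I.n → ℝ} (hx : I.IsOptimalFractional x)
    (v : Fin I.n) : (I.weight v : ℝ) ≤ I.fractionalWeight x := by
  have h := hx.2 _ (isFractionalPacking_indicator (isPacking_singleton v))
  rw [fractionalWeight_indicator] at h
  simpa [totalWeight] using h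

/-- An optimal solution of energy less than one can be improved, unless all weights are zero. -/
theorem weight_eq_zero_of_energy_lt_one {x : Fin I.n → ℝ} (hx : I.IsOptimalFractional x)
    (hE : I.energy x < 1) (v : Fin I.n) : I.weight v = 0 := by
  obtain ⟨⟨h01, hcap⟩, hopt⟩ := hx
  have hle : ∀ s : Finset (Fin I.n), ∑ u ∈ s, x u ≤ I.energy x := fun s =>
    sum_le_sum_of_subset_of_nonneg (subset_univ s) fun u _ _ => (h01 u).1
  -- Raising `x v` by the slack `1 - I.energy x` keeps the total at most 1, so no constraint can be
  -- violated.
  have hsum : ∀ s : Finset (Fin I.n),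
      ∑ u ∈ s, (x u + if u = v then 1 - I.energy x else 0) ≤ 1 := by
    intro s
    rw [sum_add_distrib, sum_ite_eq']
    have := hle s
    split_ifs <;> linarith
  have h0 : ∀ u, 0 ≤ x u + if u = v then 1 - I.energy x else 0 := fun u => by
    have := (h01 u).1
    split_ifs <;> linarith
  have h := hopt (fun u => x u + if u = v then 1 - I.energy x else 0) ⟨fun u => ⟨h0 u, ?_⟩,
    fun j => (hsum _).trans (by exact_mod_cast I.one_le_cap j)⟩
  · have h1 : I.fractionalWeight (fun u => x u + if u = v then 1 - I.energy x else 0) =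
        I.fractionalWeight x + I.weight v * (1 - I.energy x) := by
      simp [fractionalWeight, mul_add, sum_add_distrib]
    rw [h1] at h
    have h2 : (I.weight v : ℝ) ≤ 0 := by
      by_contra! h3
      nlinarith
    have h3 : (0 : ℝ) ≤ I.weight v := NNRat.cast_nonneg _
    exact_mod_cast le_antisymm h2 h3
  · simpa using hsum {u}

theorem intWeight_eq (v : Fin I.n) :
    (I.intWeight v : ℝ) = I.denominator * (I.weight v : ℝ) := by
  rw [intWeight, dif_pos v.2, Nat.cast_mul, Nat.cast_div (den_dvd_denominator _)
    (by exact_mod_cast (I.weight _).den_ne_zero), NNRat.cast_def]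
  ring

theorem value_eq (X : Finset (Fin I.n)) :
    (I.value X : ℝ) = I.denominator * (I.totalWeight X : ℝ) := by
  rw [value, totalWeight, NNRat.cast_sum, mul_sum, Nat.cast_sum]
  exact sum_congr rfl fun v _ => intWeight_eq v

/-- If `X` is at least as good as a random set, then so is its expected weight. -/
theorem le_expectedWeight {L : ℕ} {X Y : (Fin L → Bool) → Finset (Fin I.n)}
    (h : ∀ r, I.value (Y r) ≤ I.value (X r)) :
    (∑ r, (I.value (Y r) : ℝ)) / 2 ^ L ≤ I.denominator * expectedWeight I X := by
  rw [expectedWeight, ← mul_div_assoc, mul_sum]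
  gcongr with r
  rw [← value_eq]
  exact_mod_cast h r

/-- The linear program for the energy bound `e` is solved up to a constant factor. -/
theorem exists_scaled_lpRun {x : Fin I.n → ℝ} (hx : I.IsFractionalPacking x) {e : ℕ}
    (he1 : 1 ≤ e) (hen : e ≤ I.n) (hxe : I.energy x ≤ e) (hW : 0 < I.fractionalWeight x) :
    ∃ ρ : ℝ, 1 ≤ ρ ∧ (∀ v : Fin I.n, ((I.lpRun e I.numSteps).2 v : ℝ) ≤ ρ) ∧
      (∀ j, ∑ v ∈ I.edge j, ((I.lpRun e I.numSteps).2 v : ℝ) ≤ I.cap j * ρ) ∧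
      ∑ v : Fin I.n, ((I.lpRun e I.numSteps).2 v : ℝ) ≤ e * ρ ∧
      ∑ v : Fin I.n, (I.weight v : ℝ) * (I.lpRun e I.numSteps).2 v =
        ρ * (I.fractionalWeight x / 6) := by
  have hn : 0 < I.n := by omega
  have hDpos : (0 : ℝ) < I.denominator := by exact_mod_cast denominator_pos
  set z := (I.lpRun e I.numSteps).2 with hz
  set x' : ℕ → ℝ := fun v => if h : v < I.n then x ⟨v, h⟩ else 0 with hx'
  have hx'v : ∀ v : Fin I.n, x' v = x v := fun v => by simp [hx']
  have hx'W : ∑ v ∈ range I.n, (I.intWeight v : ℝ) * x' v =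
      I.denominator * I.fractionalWeight x := by
    rw [Finset.sum_range, fractionalWeight, mul_sum]
    exact sum_congr rfl fun v _ => by rw [intWeight_eq, hx'v, mul_assoc]
  have hzW : ((∑ v ∈ range I.n, I.intWeight v * z v : ℕ) : ℝ) =
      I.denominator * ∑ v : Fin I.n, (I.weight v : ℝ) * z v := by
    rw [Nat.cast_sum, Finset.sum_range, mul_sum]
    exact sum_congr rfl fun v _ => by rw [Nat.cast_mul, intWeight_eq, mul_assoc]
  have hcap : ∀ j < I.numRows, 1 ≤ I.rowCap e j ∧ I.rowCap e j ≤ I.capBound := by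
    intro j _
    unfold rowCap capBound
    split_ifs with h1
    · have := single_le_sum_of_canonicallyOrdered (f := I.cap) (mem_univ ⟨j, h1⟩)
      exact ⟨I.one_le_cap _, by omega⟩
    · omega
    · omega
  have hsum_row : ∀ j : Fin I.m, ∀ y : ℕ → ℝ, ∑ v ∈ range I.n, (I.rowMatrix j v : ℝ) * y v =
      ∑ v ∈ I.edge j, y v := by
    intro j y
    rw [Finset.sum_range]
    simp [rowMatrix_coe]
  have hvertex_row : ∀ v : Fin I.n, ∀ y : ℕ → ℝ,
      ∑ u ∈ range I.n, (I.rowMatrix (I.m + v) u : ℝ) * y u = y v := by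
    intro v y
    have : ∀ u, (I.rowMatrix (I.m + v) u : ℝ) * y u = if u = (v : ℕ) then y u else 0 := by
      intro u
      unfold rowMatrix
      rw [dif_neg (by omega), if_pos (by omega)]
      by_cases h : u = v
      · simp [h]
      · simp [h, Ne.symm h]
    simp [this]
  have henergy_row : ∀ y : ℕ → ℝ,
      ∑ u ∈ range I.n, (I.rowMatrix (I.m + I.n) u : ℝ) * y u = ∑ v : Fin I.n, y v := by
    intro y
    rw [Finset.sum_range]
    refine sum_congr rfl fun u _ => ?_
    unfold rowMatrix
    rw [dif_neg (by omega), if_neg (by omega)]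
    simp
  have hfeas : ∀ j < I.numRows,
      ∑ v ∈ range I.n, (I.rowMatrix j v : ℝ) * x' v ≤ I.rowCap e j := by
    intro j hj
    unfold numRows at hj
    rcases lt_or_ge j I.m with h1 | h1
    · have h2 := hsum_row ⟨j, h1⟩ x'
      simp only at h2
      rw [h2, sum_congr rfl fun v _ => hx'v v, rowCap, dif_pos h1]
      exact hx.2 _
    · rcases lt_or_ge j (I.m + I.n) with h2 | h2
      · obtain ⟨v, rfl⟩ : ∃ v : Fin I.n, j = I.m + v := ⟨⟨j - I.m, by omega⟩, by simp; omega⟩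
        rw [hvertex_row, hx'v, rowCap, dif_neg (by omega), if_pos (by omega)]
        simpa using (hx.1 v).2
      · obtain rfl : j = I.m + I.n := by omega
        rw [henergy_row, sum_congr rfl fun v _ => hx'v v, rowCap, dif_neg (by omega),
          if_neg (by omega)]
        exact hxe
  -- The rows `x v ≤ 1` are the rows of capacity 1 that the method needs through every variable.
  obtain ⟨h1, h2⟩ := mwRun_spec (z := z) hn rowMatrix_le_one (fun j hj => (hcap j hj).1)
    (fun j hj => (hcap j hj).2)
    (fun v hv => ⟨I.m + v, by unfold numRows; omega, by
      rw [rowCap, dif_neg (by omega), if_pos (by omega)], by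
      rw [rowMatrix, dif_neg (by omega), if_pos (by omega), if_pos rfl]⟩)
    (fun v => by simp only [hx']; split_ifs; exacts [(hx.1 _).1, le_rfl])
    hfeas (by rw [hx'W]; positivity) rfl rfl
  rw [hzW, hx'W] at h1 h2
  set ρ := 6 * ((I.denominator * ∑ v : Fin I.n, (I.weight v : ℝ) * z v) /
    (I.denominator * I.fractionalWeight x)) with hρ
  simp only [Nat.cast_sum, Nat.cast_mul] at h2
  refine ⟨ρ, h1, fun v => ?_, fun j => ?_, ?_, ?_⟩
  · have h := h2 (I.m + v) (by unfold numRows; omega)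
    rw [hvertex_row v fun v => (z v : ℝ), rowCap, dif_neg (by omega), if_pos (by omega)] at h
    simpa using h
  · have h := h2 j (by unfold numRows; omega)
    rw [hsum_row j fun v => (z v : ℝ), rowCap, dif_pos j.2] at h
    exact h
  · have h := h2 (I.m + I.n) (by unfold numRows; omega)
    rw [henergy_row fun v => (z v : ℝ), rowCap, dif_neg (by omega), if_neg (by omega)] at h
    exact h
  · rw [hρ]
    field_simp

/-! ### The approximation guarantee -/

/-- The properties of the output `X` for the coin tosses `r` on which the analysis depends. -/
def GoodOutput (I : Instance) {L : ℕ} (r : Fin L → Bool) (X : Finset (Fin I.n)) : Prop :=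
  (∀ v : Fin I.n, I.value {v} ≤ I.value X) ∧ ∀ e < I.n, ∀ i < I.numScales,
    I.value (I.candidate ((initialState I r).arr 4) (e + 1) i) ≤ I.value X

/-- Every capacity is at least `ν`, so for a base at least 1 the exponent `cap j / ν ≥ 1` can only
increase it. -/
theorem le_rpow_pow_cap {a : ℝ} (ha : 1 ≤ a) (j : Fin I.m) :
    a ≤ (a ^ (1 / (I.minCapacity : ℝ))) ^ I.cap j := by
  have h1 : I.minCapacity ≤ I.cap j := ciInf_le (OrderBot.bddBelow _) j
  have h2 : 1 ≤ I.minCapacity := by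
    have : Nonempty (Fin I.m) := ⟨j⟩
    exact le_ciInf I.one_le_cap
  have h3 : (0 : ℝ) < I.minCapacity := by exact_mod_cast h2
  rw [← Real.rpow_natCast, ← Real.rpow_mul (by linarith)]
  refine Real.self_le_rpow_of_one_le ha ?_
  rw [one_div, inv_mul_eq_div, le_div_iff₀ h3, one_mul]
  exact_mod_cast h1

theorem weight_le_expectedWeight {L : ℕ} {X : (Fin L → Bool) → Finset (Fin I.n)}
    (hX : ∀ r, I.GoodOutput r (X r)) (v : Fin I.n) :
    (I.weight v : ℝ) ≤ expectedWeight I X := by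
  have h := le_expectedWeight (Y := fun _ => {v}) fun r => (hX r).1 v
  have hDpos : (0 : ℝ) < I.denominator := by exact_mod_cast denominator_pos
  simp only [sum_const, card_univ, Fintype.card_fun, Fintype.card_bool, Fintype.card_fin,
    nsmul_eq_mul, Nat.cast_pow, Nat.cast_ofNat, value_eq] at h
  rw [mul_div_cancel_left₀ _ (by positivity)] at h
  simpa [totalWeight] using le_of_mul_le_mul_left h hDpos

/-- The main case of the analysis: the energy is not too small, and the loss is not too large. -/
theorem fractionalWeight_le_of_four_le_energy {L : ℕ} (hL : I.n * I.numScales ≤ L)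
    {X : (Fin L → Bool) → Finset (Fin I.n)} (hX : ∀ r, I.GoodOutput r (X r)) {c : ℕ} {γ : ℝ → ℝ}
    (hγ : MonotoneOn γ (Set.Ici 1)) (hγ1 : ∀ t, 1 ≤ t → 1 ≤ γ t) (hg : I.BoundedGrowth c γ)
    {x : Fin I.n → ℝ} (hx : I.IsOptimalFractional x) (hW : 0 < I.fractionalWeight x)
    (hE : 4 ≤ I.energy x) {g : ℝ} (hg1 : 1 ≤ g) (hgγ : ∀ j, γ (I.energy x) ≤ g ^ I.cap j)
    (hgn : 400 * 2 ^ c * g < I.n) :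
    I.fractionalWeight x ≤ 24 * (400 * 2 ^ c * g) * expectedWeight I X := by
  have hDpos : (0 : ℝ) < I.denominator := by exact_mod_cast denominator_pos
  set E := I.energy x with hEdef
  set C := 400 * 2 ^ c * g with hC
  have hC400 : 400 ≤ C := by
    have h1 : (1 : ℝ) ≤ 2 ^ c * g := one_le_mul_of_one_le_of_one_le (one_le_pow₀ one_le_two) hg1
    rw [hC]; linarith
  have hEn : E ≤ I.n := by
    refine (sum_le_sum fun v _ => (hx.1.1 v).2).trans ?_
    simp
  -- Rounding up keeps `x` feasible for the extra constraint and at most doubles the energy. The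
  -- form `e + 1` matches the loop index of the program.
  obtain ⟨e, he⟩ : ∃ e, ⌈E⌉₊ = e + 1 := Nat.exists_eq_succ_of_ne_zero
    (Nat.ceil_pos.2 (by linarith)).ne'
  have hen : e + 1 ≤ I.n := by rw [← he]; exact Nat.ceil_le.2 hEn
  have heE : ((e + 1 : ℕ) : ℝ) ≤ 2 * E := by
    rw [← he]
    have := Nat.ceil_lt_add_one (show (0 : ℝ) ≤ E by linarith)
    linarith
  obtain ⟨ρ, hρ1, hρv, hρj, hρE, hρW⟩ := exists_scaled_lpRun hx.1 (e := e + 1) (by omega) hen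
    (by rw [← hEdef, ← he]; exact Nat.le_ceil E) hW
  set z := (I.lpRun (e + 1) I.numSteps).2 with hz
  have hρ0 : 0 < ρ := by linarith
  have hn : 0 < I.n := by omega
  -- The coordinates of `z` sum to the number of steps, and no single weight exceeds the LP optimum,
  -- since singletons are packings.
  have hρT : ρ ≤ 6 * I.numSteps := by
    have h1 : ∑ v : Fin I.n, (I.weight v : ℝ) * z v ≤ I.fractionalWeight x * I.numSteps := by
      have h2 : ∑ v : Fin I.n, (z v : ℝ) = I.numSteps := by
        have := sum_mwRun (A := I.rowMatrix) (M := I.numRows) (cap := I.rowCap (e + 1))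
          (W := I.intWeight) (Q := I.capBound) hn I.numSteps
        rw [Finset.sum_range] at this
        exact_mod_cast this
      rw [← h2, mul_sum]
      gcongr with v
      exact weight_le_fractionalWeight hx v
    rw [hρW] at h1
    nlinarith
  set P : ℝ := 2 ^ I.numScales with hP
  have hP0 : 0 < P := by positivity
  have hPC : ρ * C ≤ P := by
    -- `numScales` was defined as `6 * numSteps * n` for this estimate: it bounds `ρ * C`, because
    -- `C < n`.
    have h1 : ((I.numScales : ℕ) : ℝ) ≤ P := by
      rw [hP]
      exact_mod_cast Nat.lt_two_pow_self.le
    have h2 : (I.numScales : ℝ) = 6 * I.numSteps * I.n := by simp [numScales]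
    refine le_trans ?_ (h2 ▸ h1)
    gcongr
  -- The largest power of two not exceeding `P / (ρ * C)`; it places `θ` between `1 / (2 C)` and `1
  -- / C`.
  obtain ⟨i, hi1, hi2⟩ := exists_nat_pow_near (x := P / (ρ * C)) (y := 2)
    ((one_le_div (by positivity)).2 hPC) one_lt_two
  rw [le_div_iff₀ (by positivity)] at hi1
  rw [div_lt_iff₀ (by positivity), pow_succ] at hi2
  have his : i < I.numScales := by
    have h1 : (2 : ℝ) ^ i < 2 ^ I.numScales := by
      have : (2 : ℝ) ^ i * 1 < 2 ^ i * (ρ * C) := by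
        gcongr
        nlinarith
      linarith
    exact (pow_lt_pow_iff_right₀ one_lt_two).1 h1
  set θ : ℝ := ρ * 2 ^ i / P with hθ
  have hθ0 : 0 ≤ θ := by positivity
  have hθC : θ * C ≤ 1 := by
    rw [hθ, div_mul_eq_mul_div, div_le_one hP0]
    linarith
  have hθC2 : 1 ≤ 2 * θ * C := by
    have : 2 * θ * C = 2 ^ i * 2 * (ρ * C) / P := by rw [hθ]; ring
    rw [this, one_le_div hP0]
    exact hi2.le
  set y : Fin I.n → ℝ := fun v => z v / ρ with hy
  have hy1 : ∀ v, y v ≤ 1 := fun v => (div_le_one hρ0).2 (hρv v)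
  -- The unknown normalization `ρ` cancels, so the program samples with the probabilities `θ * y v`
  -- without computing `ρ`.
  have hp : ∀ v, θ * y v = ((z v * 2 ^ i : ℕ) : ℝ) / 2 ^ I.numScales := by
    intro v
    rw [← hP, hθ, hy]
    push_cast
    field_simp
  have hround := half_le_subsetExp_altered hγ hγ1 hg (y := y)
    (fun v => by positivity) hy1
    (fun j => by rw [← sum_div, div_le_iff₀ hρ0]; exact hρj j) hE
    (by rw [← sum_div, div_le_iff₀ hρ0]; exact hρE.trans (by gcongr)) hg1 hgγ hθ0 hθC
    (fun v => I.intWeight v)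
  have ha : ∀ v : Fin I.n, z v * 2 ^ i ≤ 2 ^ I.numScales := by
    intro v
    have h1 : θ * y v ≤ 1 := mul_le_one₀ (by nlinarith) (by positivity) (hy1 v)
    rw [hp, div_le_one (by positivity)] at h1
    exact_mod_cast h1
  have hdist := sum_coinNumber_lt hL ha
    fun R => ∑ v ∈ I.altered (fun v => I.intWeight v) R, (I.intWeight v : ℝ)
  have hcand := le_expectedWeight
    (Y := fun r => I.candidate ((initialState I r).arr 4) (e + 1) i)
    fun r => (hX r).2 e hen i his
  simp only [candidate, sample, value, Nat.cast_sum, ← hz] at hcand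
  rw [hdist] at hcand
  simp only [hp] at hround
  have hfinal := hround.trans hcand
  simp only [← hp] at hfinal
  have hval : ∑ v : Fin I.n, (I.intWeight v : ℝ) * (θ * y v) =
      I.denominator * (θ * (I.fractionalWeight x / 6)) := by
    have h1 : ∑ v : Fin I.n, (I.weight v : ℝ) * y v = I.fractionalWeight x / 6 := by
      have h2 : ∑ v : Fin I.n, (I.weight v : ℝ) * y v =
          (∑ v : Fin I.n, (I.weight v : ℝ) * z v) / ρ := by
        rw [sum_div]
        exact sum_congr rfl fun v _ => by rw [hy, mul_div_assoc]
      rw [h2, hρW]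
      field_simp
    rw [← h1, mul_sum, mul_sum]
    exact sum_congr rfl fun v _ => by rw [intWeight_eq]; ring
  rw [hval] at hfinal
  have h3 : θ * (I.fractionalWeight x / 12) ≤ expectedWeight I X := by
    refine le_of_mul_le_mul_left ?_ hDpos
    linarith
  calc I.fractionalWeight x ≤ (2 * θ * C) * I.fractionalWeight x :=
        le_mul_of_one_le_left hW.le hθC2
    _ = 24 * C * (θ * (I.fractionalWeight x / 12)) := by ring
    _ ≤ _ := by gcongr

/-- The heaviest vertex already gives a fraction `1 / E` of the LP value, where `E ≤ n`. This
suffices when `E < 4` or when the admissible loss `400 * 2 ^ c * g` reaches `n`; the remaining case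
is the sampling argument. -/
theorem le_expectedWeight_of_goodOutput {L : ℕ} (hL : I.n * I.numScales ≤ L)
    {X : (Fin L → Bool) → Finset (Fin I.n)} (hX : ∀ r, I.GoodOutput r (X r)) {c : ℕ} {γ : ℝ → ℝ}
    (hγ : MonotoneOn γ (Set.Ici 1)) (hγ1 : ∀ t, 1 ≤ t → 1 ≤ γ t) (hg : I.BoundedGrowth c γ)
    {x : Fin I.n → ℝ} (hx : I.IsOptimalFractional x) :
    1 / (24 * (400 * 2 ^ c)) * ((I.opt : ℝ) / γ (I.energy x) ^ (1 / (I.minCapacity : ℝ))) ≤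
      expectedWeight I X := by
  have hopt := opt_le_fractionalWeight hx
  have havg : 0 ≤ expectedWeight I X := by
    unfold expectedWeight
    exact div_nonneg (sum_nonneg fun r _ => NNRat.cast_nonneg _) (by positivity)
  have hopt0 : (0 : ℝ) ≤ I.opt := NNRat.cast_nonneg _
  rcases hopt0.eq_or_lt with h0 | hpos
  · rw [← h0]
    simpa using havg
  have hW : 0 < I.fractionalWeight x := hpos.trans_le hopt
  -- An energy below 1 would make all weights zero, so it cannot occur once `opt` is positive; only
  -- from here on is anything known about `γ (I.energy x)`.
  have hE1 : 1 ≤ I.energy x := by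
    by_contra! h
    refine hW.ne' (sum_eq_zero fun v _ => ?_)
    simp [weight_eq_zero_of_energy_lt_one hx h v]
  have hγE := hγ1 _ hE1
  set g := γ (I.energy x) ^ (1 / (I.minCapacity : ℝ)) with hgdef
  have hg1 : 1 ≤ g := Real.one_le_rpow hγE (by positivity)
  have hg0 : 0 < g := by linarith
  have h2c : (1 : ℝ) ≤ 2 ^ c := one_le_pow₀ one_le_two
  suffices h : I.fractionalWeight x ≤ 24 * (400 * 2 ^ c * g) * expectedWeight I X by
    rw [one_div, inv_mul_le_iff₀ (by positivity), div_le_iff₀ hg0]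
    calc (I.opt : ℝ) ≤ _ := hopt.trans h
      _ = _ := by ring
  have hle : I.fractionalWeight x ≤ expectedWeight I X * I.energy x := by
    rw [energy, mul_sum]
    exact sum_le_sum fun v _ =>
      mul_le_mul_of_nonneg_right (weight_le_expectedWeight hX v) (hx.1.1 v).1
  have hEn : I.energy x ≤ I.n := by
    refine (sum_le_sum fun v _ => (hx.1.1 v).2).trans ?_
    simp
  have hCpos : 1 ≤ 2 ^ c * g := one_le_mul_of_one_le_of_one_le h2c hg1
  rcases lt_or_ge (I.energy x) 4 with h4 | h4
  · nlinarith
  rcases lt_or_ge (400 * 2 ^ c * g) (I.n : ℝ) with hn | hn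
  · exact fractionalWeight_le_of_four_le_energy hL hX hγ hγ1 hg hx hW h4 hg1
      (fun j => le_rpow_pow_cap hγE j) hn
  · nlinarith

/-- For all coin tosses, the program halts in polynomial time with a good output. -/
theorem exists_outputs_mainProg (I : Instance) {L : ℕ} (r : Fin L → Bool) :
    ∃ X, Outputs mainProg I r ((mainProg.timeBound sizeBound).eval I.size) X ∧ I.IsPacking X ∧
      I.GoodOutput r X := by
  have hB := I.fitsIn_sizeBound
  obtain ⟨τ, t, h1, h2, -, ⟨X, hX, hX5, hX10⟩, h3, h4⟩ :=
    run_mainProg hB r (initialState_bounded hB r)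
  rw [hX10] at h3 h4
  refine ⟨X, ⟨τ, t, h1, ?_, hX5⟩, hX, fun v => ?_, h4⟩
  · rw [Program.eval_timeBound]
    exact h2
  · simpa [value] using h3 v v.2

end Instance
end Packing

/-- There is a randomized polynomial-time algorithm (program `p`, with at most `T` steps and `L`
coin tosses, polynomials in the size of the instance) whose output `X` is always a packing, and
whose expected weight is `Ω(Opt / γ(E) ^ (1 / ν))` under bounded growth, where the constant
depends only on the constant in `2 ^ O(k)`. -/
theorem theoremp :
    ∃ (p : Packing.Program) (T L : Polynomial ℕ)
      (X : ∀ I : Packing.Instance, (Fin (L.eval I.size) → Bool) → Finset (Fin I.n)),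
      (∀ (I : Packing.Instance) (r : Fin (L.eval I.size) → Bool),
        Packing.Outputs p I r (T.eval I.size) (X I r) ∧ I.IsPacking (X I r)) ∧
      ∀ c : ℕ, ∃ K : ℝ, 0 < K ∧
        ∀ γ : ℝ → ℝ, MonotoneOn γ (Set.Ici 1) → (∀ t, 1 ≤ t → 1 ≤ γ t) →
          ∀ I : Packing.Instance, I.BoundedGrowth c γ →
            ∀ x : Fin I.n → ℝ, I.IsOptimalFractional x →
              K * ((I.opt : ℝ) / γ (I.energy x) ^ (1 / (I.minCapacity : ℝ))) ≤
                Packing.expectedWeight I (X I) := by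
  choose X hX1 hX2 hX3 using fun (I : Packing.Instance)
    (r : Fin (Packing.Instance.coinBound.eval I.size) → Bool) => I.exists_outputs_mainProg r
  refine ⟨Packing.mainProg, Packing.mainProg.timeBound Packing.Instance.sizeBound,
    Packing.Instance.coinBound, X, fun I r => ⟨hX1 I r, hX2 I r⟩, fun c => ?_⟩
  refine ⟨1 / (24 * (400 * 2 ^ c)), by positivity, fun γ hγ hγ1 I hg x hx => ?_⟩
  exact Packing.Instance.le_expectedWeight_of_goodOutput I.mul_numScales_le (hX3 I) hγ hγ1 hg hx
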